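/- Let $n\ge 2$, $r\ge 1$, and let $T=\sum_{i=1}^r\sigma_i\,(x_i\otimes y_i\otimes z_i)$ be a real $n\times n\times n$ tensor, where $x_i,y_i,z_i\in\mathbb R^n$ are unit vectors and $\sigma_1\ge\dots\ge\sigma_r>0$. Let $V_x,V_y,V_z$ be the spans of the $x_i$, the $y_i$ and the $z_i$. Assume that for some $c>0$ the smallest ($r$-th) singular value of each of the three $n\times r$ matrices with columns $x_i$, $y_i$, $z_i$ is at least $c$, and that $V_x,V_y,V_z$ are $\mu$-incoherent: the projection of every standard basis vector onto each of them has length at most $\sqrt{\mu r/n}$. For $r$-dimensional subspaces $U,V\subseteq\mathbb R^n$ let $\alpha(U,V)=\|P_{V^\perp}|_U\|_{\mathrm{op}}$ be the sine of the principal angle. Norms are Euclidean (Frobenius). Let $$p_3=2\,\frac{\log^2 n}{n^2}\left(\frac{10r\mu}{c}\cdot\frac{\sigma_1}{\sigma_r}\right)^{10},$$ assumed to be at most $1$ so that it is a probability, and let $\widehat V_x,\widehat V_y,\widehat V_z\subseteq\mathbb R^n$ be subspaces of dimension $r$ with $$\max\left(\alpha(V_x,\widehat V_x),\alpha(V_y,\widehat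 V_y),\alpha(V_z,\widehat V_z)\right)\le\left(\frac{\sigma_r c}{10\sigma_1 n}\right)^{10^2}.$$ Consider the following algorithm. 1. Observe each entry of $T$ independently with probability $p_3$, and split the set of observed entries into two independent samples, in each of which every entry is present independently with probability $p_3/2$. Let $S$ be the set of entries in the first sample. 2. Projection: let $T'$ minimize $\|(T'-T)|_S\|^2$ over $\widehat V_x\otimes\widehat V_y\otimes\widehat V_z$. 3. Jennrich's algorithm: independently of the samples, draw independent uniformly random unit vectors $a,b\in\mathbb R^n$. Put $T^{(a)}_{ij}=\sum_k T'_{ijk}a_k$, $T^{(b)}_{ij}=\sum_k T'_{ijk}b_k$, and let $T^{(a)}_r,T^{(b)}_r$ be obtained by keeping the top $r$ terms of a singular value decomposition. Compute $r$ linearly independent real eigenvectors $u_1,\dots,u_r$ of $T_r^{(a)}(T_r^{(b)})^+$ and $v_1,\dots,v_r$ of $\big((T_r^{(a)})^+T_r^{(b)}\big)^T$, all with nonzero real eigenvalues ($M^+$ is the pseudoinverse). Order the $v_i$ so that the eigenvalues $\lambda_i$ of $u_i$ and $\lambda_i'$ of $v_i$ are as nearly reciprocal as possible, i.e. $\sum_i|\lambda_i\lambda'_i-1|$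 is minimal over all pairings. Let $w_1,\dots,w_r$ minimize $\|T'-\sum_i u_i\otimes v_i\otimes w_i\|^2$. 4. Write $u_i\otimes v_i\otimes w_i=\widehat{\sigma_i}\,\widehat{x_i}\otimes\widehat{y_i}\otimes\widehat{z_i}$ with $\widehat{\sigma_i}\ge 0$ and unit vectors $\widehat{x_i},\widehat{y_i},\widehat{z_i}$. Then with probability at least $0.95$ the algorithm can be carried out, and whatever admissible choices it makes (of minimizers, decompositions, eigenvectors and signs), there are a permutation $\pi$ of $\{1,\dots,r\}$ and signs $\epsilon_{x,i},\epsilon_{y,i},\epsilon_{z,i}\in\{-1,1\}$ such that for all $1\le i\le r$ $$\frac{|\sigma_i-\widehat{\sigma_{\pi(i)}}|}{\sigma_1},\ \ \|x_i-\epsilon_{x,i}\widehat{x_{\pi(i)}}\|,\ \ \|y_i-\epsilon_{y,i}\widehat{y_{\pi(i)}}\|,\ \ \|z_i-\epsilon_{z,i}\widehat{z_{\pi(i)}}\|\ \le\ \epsilon,\qquad \epsilon=\left(\frac{c\sigma_r}{10n\sigma_1}\right)^{20}.$$ -/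

import Mathlib

open MeasureTheory ProbabilityTheory

namespace TensorCompletion

noncomputable section

/-- `ℝⁿ` with the Euclidean norm. -/
abbrev Vec (n : ℕ) := EuclideanSpace ℝ (Fin n)

/-- Real `n × n × n` tensors, with the norm given by the root of the sum of squared entries. -/
abbrev Tensor (n : ℕ) := EuclideanSpace ℝ (Fin n × Fin n × Fin n)

/-- The rank-one tensor `x ⊗ y ⊗ z`. -/
def outer {n : ℕ} (x y z : Vec n) : Tensor n :=
  WithLp.toLp 2 fun e => x e.1 * y e.2.1 * z e.2.2

/-- The restriction `T|_S`: entries outside `S` are set to `0`. -/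
def restrictTo {n : ℕ} (S : Set (Fin n × Fin n × Fin n)) (T : Tensor n) : Tensor n :=
  WithLp.toLp 2 (S.indicator fun e => T e)

/-- The subspace `U ⊗ V ⊗ W` of the space of tensors. -/
def tensorSubspace {n : ℕ} (U V W : Submodule ℝ (Vec n)) : Submodule ℝ (Tensor n) :=
  Submodule.span ℝ {X | ∃ x ∈ U, ∃ y ∈ V, ∃ z ∈ W, X = outer x y z}

/-- The smallest of the `r` singular values of the `n × r` matrix with columns `x₁, …, x_r`
(Mathlib numbers the singular values from `0`, in decreasing order). -/
def smallestSingularValue {n r : ℕ} (x : Fin r → Vec n) : ℝ :=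
  (Matrix.toEuclideanLin (Matrix.of fun (k : Fin n) (i : Fin r) => x i k)).singularValues (r - 1)

/-- The span of the vectors `x₁, …, x_r`. -/
def spanOf {n r : ℕ} (x : Fin r → Vec n) : Submodule ℝ (Vec n) :=
  Submodule.span ℝ (Set.range x)

/-- `V` is `μ`-incoherent: the projection onto `V` of each standard basis vector of `ℝⁿ`
has length at most `√(μ (dim V) / n)`. -/
def Incoherent {n : ℕ} (V : Submodule ℝ (Vec n)) (μ : ℝ) : Prop :=
  ∀ i : Fin n, ‖V.starProjection (EuclideanSpace.single i (1 : ℝ))‖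
    ≤ √(μ * (Module.finrank ℝ V : ℝ) / n)

/-- The sine `α(U, V)` of the principal angle between subspaces of equal dimension: the operator
norm of the orthogonal projection onto the orthogonal complement of `V`, restricted to `U`. -/
def sinAngle {n : ℕ} (U V : Submodule ℝ (Vec n)) : ℝ :=
  ‖(Vᗮ.starProjection).comp U.subtypeL‖

/-- The tensor `∑ σᵢ (xᵢ ⊗ yᵢ ⊗ zᵢ)`. -/
def cpTensor {n r : ℕ} (σ : Fin r → ℝ) (x y z : Fin r → Vec n) : Tensor n :=
  ∑ i, σ i • outer (x i) (y i) (z i)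

/-- The assumptions on the hidden tensor `∑ σᵢ (xᵢ ⊗ yᵢ ⊗ zᵢ)`: unit vectors,
`σ₁ ≥ … ≥ σ_r > 0`, robust linear independence with constant `c`, and `μ`-incoherence. -/
structure CPAssumptions {n r : ℕ} (σ : Fin r → ℝ) (x y z : Fin r → Vec n) (c μ : ℝ) : Prop where
  norm_x : ∀ i, ‖x i‖ = 1
  norm_y : ∀ i, ‖y i‖ = 1
  norm_z : ∀ i, ‖z i‖ = 1
  antitone : Antitone σ
  pos : ∀ i, 0 < σ i
  c_pos : 0 < c
  robust_x : c ≤ smallestSingularValue x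
  robust_y : c ≤ smallestSingularValue y
  robust_z : c ≤ smallestSingularValue z
  incoherent_x : Incoherent (spanOf x) μ
  incoherent_y : Incoherent (spanOf y) μ
  incoherent_z : Incoherent (spanOf z) μ

/-- `σ₁`, the first weight. -/
def sigmaFirst {r : ℕ} (hr : 0 < r) (σ : Fin r → ℝ) : ℝ := σ ⟨0, hr⟩

/-- `σ_r`, the last weight. -/
def sigmaLast {r : ℕ} (hr : 0 < r) (σ : Fin r → ℝ) : ℝ := σ ⟨r - 1, Nat.sub_lt hr Nat.one_pos⟩

/-! ### Jennrich's algorithm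

An algorithmic step that involves a choice (of a singular value decomposition, of eigenvectors,
of a minimizer) is a relation between its input and its admissible outputs. -/

/-- The matrix `T^{(a)}` with entries `T_{i,j,·} · a`. -/
def contract {n : ℕ} (T : Tensor n) (a : Vec n) : Matrix (Fin n) (Fin n) ℝ :=
  Matrix.of fun i j => ∑ k, T (i, j, k) * a k

/-- `N` consists of the top `r` principal components of `M`: it is obtained from a singular value
decomposition of `M` by keeping the first `r` terms (singular values in decreasing order). -/
def IsTopComponents {n : ℕ} (r : ℕ) (M N : Matrix (Fin n) (Fin n) ℝ) : Prop :=
  ∃ (s : Fin n → ℝ) (p q : Fin n → Vec n),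
    Antitone s ∧ (∀ k, 0 ≤ s k) ∧ Orthonormal ℝ p ∧ Orthonormal ℝ q ∧
    (∀ i j, M i j = ∑ k, s k * p k i * q k j) ∧
    (∀ i j, N i j = ∑ k : Fin n, if k.val < r then s k * p k i * q k j else 0)

/-- `N` is the (Moore–Penrose) pseudoinverse of the real matrix `M`. -/
structure IsPseudoinverse {n : ℕ} (M N : Matrix (Fin n) (Fin n) ℝ) : Prop where
  mul_mul_left : M * N * M = M
  mul_mul_right : N * M * N = N
  symm_left : (M * N).transpose = M * N
  symm_right : (N * M).transpose = N * M

/-- `u₁, …, u_r` are linearly independent eigenvectors of `M` for the nonzero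
eigenvalues `ev₁, …, ev_r`. -/
def IsEigensystem {n r : ℕ} (M : Matrix (Fin n) (Fin n) ℝ) (u : Fin r → Vec n)
    (ev : Fin r → ℝ) : Prop :=
  LinearIndependent ℝ u ∧ (∀ i, ev i ≠ 0) ∧ ∀ i, Matrix.toEuclideanLin M (u i) = ev i • u i

/-- `comp₁, …, comp_r` is an output of Jennrich's algorithm on the tensor `T'`, the target rank `r`
and the random directions `a`, `b`. -/
def IsJennrichOutput {n r : ℕ} (T' : Tensor n) (a b : Vec n) (comp : Fin r → Tensor n) : Prop :=
  ∃ (Ta Tb Tai Tbi : Matrix (Fin n) (Fin n) ℝ) (u v w : Fin r → Vec n) (eu ev : Fin r → ℝ),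
    -- truncation to the top `r` principal components, and the pseudoinverses
    IsTopComponents r (contract T' a) Ta ∧ IsTopComponents r (contract T' b) Tb ∧
    IsPseudoinverse Ta Tai ∧ IsPseudoinverse Tb Tbi ∧
    -- the two eigendecompositions
    IsEigensystem (Ta * Tbi) u eu ∧ IsEigensystem (Tai * Tb).transpose v ev ∧
    -- the eigenvectors are paired so that paired eigenvalues are as close as possible to reciprocal
    (∀ τ : Equiv.Perm (Fin r), ∑ i, |eu i * ev i - 1| ≤ ∑ i, |eu i * ev (τ i) - 1|) ∧
    -- least squares for the third factors
    (∀ w' : Fin r → Vec n, ‖T' - ∑ i, outer (u i) (v i) (w i)‖ ^ 2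
      ≤ ‖T' - ∑ i, outer (u i) (v i) (w' i)‖ ^ 2) ∧
    ∀ i, comp i = outer (u i) (v i) (w i)

/-! ### The estimation part of the post-processing algorithm -/

/-- `T'` minimizes `‖(T' - That)|_S‖²` over `U ⊗ V ⊗ W`. -/
def IsProjectionStep {n : ℕ} (S : Set (Fin n × Fin n × Fin n)) (That : Tensor n)
    (U V W : Submodule ℝ (Vec n)) (T' : Tensor n) : Prop :=
  T' ∈ tensorSubspace U V W ∧
    ∀ X ∈ tensorSubspace U V W,
      ‖restrictTo S (T' - That)‖ ^ 2 ≤ ‖restrictTo S (X - That)‖ ^ 2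

/-- `σh, xh, yh, zh` are estimates computed by the post-processing algorithm from the entries
of `T` in the set `S` (the sample used for the projection step), the input subspaces `U, V, W` and
the directions `a, b` drawn by Jennrich's algorithm. -/
structure IsEstimate {n r : ℕ} (T : Tensor n) (S : Set (Fin n × Fin n × Fin n))
    (U V W : Submodule ℝ (Vec n)) (a b : Vec n)
    (σh : Fin r → ℝ) (xh yh zh : Fin r → Vec n) : Prop where
  norm_x : ∀ i, ‖xh i‖ = 1
  norm_y : ∀ i, ‖yh i‖ = 1
  norm_z : ∀ i, ‖zh i‖ = 1
  nonneg : ∀ i, 0 ≤ σh i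
  run : ∃ T' : Tensor n, IsProjectionStep S (restrictTo S T) U V W T' ∧
    IsJennrichOutput T' a b fun i => σh i • outer (xh i) (yh i) (zh i)

/-- The uniform probability distribution on the unit sphere of `ℝⁿ`. -/
def uniformSphere (n : ℕ) : Measure (Metric.sphere (0 : Vec n) 1) :=
  ((volume : Measure (Vec n)).toSphere Set.univ)⁻¹ • (volume : Measure (Vec n)).toSphere

/-- The probability `p / 2`. -/
def halfProb (p : unitInterval) : unitInterval :=
  ⟨(p : ℝ) / 2, by have := p.2.1; positivity, by linarith [p.2.1, p.2.2]⟩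

/-- The randomness of a run of the post-processing algorithm. The set `obs` of observed entries
contains each entry independently with probability `p`; it is split into two independent
samples `obsMinus` (for the projection step) and `obsTilde`, each containing each entry
independently with probability `p / 2`; and `a`, `b` are the independent uniform unit vectors
drawn by Jennrich's algorithm, independent of the samples. -/
structure IsRunRandomness {n : ℕ} {Ω : Type*} [MeasurableSpace Ω] (P : Measure Ω)
    (p : unitInterval) (obs obsMinus obsTilde : Ω → Set (Fin n × Fin n × Fin n))
    (a b : Ω → Metric.sphere (0 : Vec n) 1) : Prop where
  law_obs : IsSetBernoulli obs Set.univ p P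
  split_minus : ∀ ω, obsMinus ω ⊆ obs ω
  split_tilde : ∀ ω, obsTilde ω ⊆ obs ω
  law_minus : IsSetBernoulli obsMinus Set.univ (halfProb p) P
  law_tilde : IsSetBernoulli obsTilde Set.univ (halfProb p) P
  indep_split : IndepFun obsMinus obsTilde P
  law_a : HasLaw a (uniformSphere n) P
  law_b : HasLaw b (uniformSphere n) P
  indep_directions : IndepFun a b P
  indep_samples : IndepFun (fun ω => (obs ω, obsMinus ω, obsTilde ω)) (fun ω => (a ω, b ω)) P

end

end TensorCompletion

open TensorCompletion

/-! All errors are measured in powers of κ = cσ_r/(10nσ₁). The given subspaces are within κ^100 of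
the true ones and the target accuracy is κ^20. Since κ is at most c/(10n) and at most σ_r/σ₁, each
factor n, r, 1/c or σ₁/σ_r costs about one power of κ, and one spare power absorbs numerical
constants.

Chance enters twice. For the sampling, put q = p₃/2. The form X ↦ ‖X|_S‖² on V̂_x⊗V̂_y⊗V̂_z has, in
an orthonormal basis, a Gram matrix of mean qI. Its expected squared Frobenius deviation is at most
q times a sum of fourth powers of lengths of projected unit tensors, which incoherence makes small.
Incoherence passes to the perturbed subspaces (`sq_norm_starProjection_le`). Markov's inequality
then gives ‖X|_S‖² ≥ (q/2)‖X‖² outside probability 1/100 (`measure_sample_le`). As qn²/2 ≥ 1, least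
squares on the sample loses at most a factor of order n, and T' is within σ₁κ^98 of T. For the
directions, a thin slab around an equator of the sphere has small measure (`uniformSphere_slab_le`),
so outside probability 1/100 all ⟨z_i,a⟩, ⟨z_i,b⟩ are at least κ^4 and all 2×2 minors formed from
them at least κ^9 in absolute value.

The rest is deterministic. In the bases of projected x_i and y_i the slices of T' are X(sA)Yᵀ and
X(sB)Yᵀ, s = σ₁, with r×r matrices A, B within κ^96 of diag α, diag β entrywise. In particular they
have rank at most r, so truncation changes nothing. Eigenvectors with nonzero eigenvalue l are
multiples of XBf with Af = lBf. The gaps |α_iβ_j − α_jβ_i| force f to concentrate on one coordinate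
k (`exists_concentrated`), so the eigenvector is nearly a multiple of x_k. Two null vectors at the
same k are proportional (`eq_of_concentrated`), so linear independence makes the assignment
bijective. That real eigenvalues exist follows from sign changes of det(A − lB) near each α_k/β_k
(`exists_det_eq_zero`). The second eigenproblem is the transposed pencil with A and B exchanged; its
eigenvalues are near β_k/α_k, so reciprocal pairing matches the coordinates (`pairing_eq`).

Comparing the least squares solution with the true third factors gives rank-one terms accurate to
σ₁κ^62 (`norm_outer_sub_smul_outer_le`), and `rankOne_close` extracts the weights and the factors up
to sign. -/

namespace TensorCompletion

open scoped RealInnerProductSpace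

/-! ### The smallest singular value as a lower bound -/

section SingularValues

/-- The last singular value bounds a linear map from below. -/
theorem singularValue_mul_norm_le {E F : Type*} [NormedAddCommGroup E] [InnerProductSpace ℝ E]
    [FiniteDimensional ℝ E] [NormedAddCommGroup F] [InnerProductSpace ℝ F] [FiniteDimensional ℝ F]
    (A : E →ₗ[ℝ] F) {m : ℕ} (hm : Module.finrank ℝ E = m) (hpos : 0 < m) (g : E) :
    A.singularValues (m - 1) * ‖g‖ ≤ ‖A g‖ := by
  have hlt : m - 1 < m := Nat.sub_lt hpos Nat.one_pos
  set hs := A.isSymmetric_adjoint_comp_self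
  set v := hs.eigenvectorBasis hm
  refine le_of_sq_le_sq ?_ (norm_nonneg _)
  have h1 : ‖A g‖ ^ 2 = ∑ i, hs.eigenvalues hm i * ⟪v i, g⟫ ^ 2 := by
    have : ‖A g‖ ^ 2 = ⟪g, (LinearMap.adjoint A ∘ₗ A) g⟫ := by
      rw [LinearMap.comp_apply, LinearMap.adjoint_inner_right, real_inner_self_eq_norm_sq]
    rw [this, ← v.sum_inner_mul_inner]
    refine Finset.sum_congr rfl fun i _ => ?_
    rw [← hs (v i) g, hs.apply_eigenvectorBasis hm i, real_inner_comm]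
    simp only [RCLike.ofReal_real_eq_id, id_eq, inner_smul_left, conj_trivial]
    ring
  have h2 : ‖g‖ ^ 2 = ∑ i, ⟪v i, g⟫ ^ 2 := by
    rw [← v.sum_sq_norm_inner_right]; simp
  rw [mul_pow, h1, h2, Finset.mul_sum]
  refine Finset.sum_le_sum fun i _ => mul_le_mul_of_nonneg_right ?_ (sq_nonneg _)
  rw [← A.sq_singularValues_fin hm i]
  exact pow_le_pow_left₀ (A.singularValues_nonneg _)
    (A.singularValues_antitone (by have := i.2; omega)) 2

theorem mul_norm_le_norm_sum {n r : ℕ} (hr : 0 < r) {x : Fin r → Vec n} {c : ℝ}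
    (hx : c ≤ smallestSingularValue x) (g : Vec r) : c * ‖g‖ ≤ ‖∑ i, g i • x i‖ := by
  have h := singularValue_mul_norm_le
    (Matrix.toEuclideanLin (Matrix.of fun (k : Fin n) (i : Fin r) => x i k)) (m := r)
    (by simp) hr g
  refine (mul_le_mul_of_nonneg_right hx (norm_nonneg _)).trans (h.trans (le_of_eq ?_))
  congr 1
  ext k
  simp [Matrix.mulVec, dotProduct, mul_comm]

end SingularValues

/-- `x₁, …, x_r` are linearly independent with robustness constant `c`. -/
def Robust {n r : ℕ} (c : ℝ) (x : Fin r → Vec n) : Prop :=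
  ∀ g : Vec r, c * ‖g‖ ≤ ‖∑ i, g i • x i‖

/-! ### Quantitative linear independence and dual vectors -/

section Robust

variable {n r : ℕ} {c : ℝ} {x : Fin r → Vec n}

theorem Robust.linearIndependent (hc : 0 < c) (hx : Robust c x) : LinearIndependent ℝ x := by
  rw [Fintype.linearIndependent_iff]
  intro g hg i
  have h := hx (WithLp.toLp 2 g)
  simp only [hg, norm_zero] at h
  have h0 : WithLp.toLp 2 g = (0 : Vec r) := by
    rw [← norm_le_zero_iff]
    nlinarith [norm_nonneg (WithLp.toLp 2 g : Vec r)]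
  have := congrArg (fun v : Vec r => v i) h0
  simpa using this

theorem Robust.le_norm (hx : Robust c x) (i : Fin r) : c ≤ ‖x i‖ := by
  have h := hx (EuclideanSpace.single i 1)
  simpa using h

/-- Needed with `s`, `t` the signed inner products of two `z`'s with `b`: the combination is then
the vector whose inner product with `a` is a 2×2 minor. -/
theorem Robust.mul_abs_le_norm_add (hc : 0 < c) (hx : Robust c x) {i j : Fin r} (hij : i ≠ j)
    (s t : ℝ) : c * |s| ≤ ‖s • x i + t • x j‖ := by
  have h := hx (EuclideanSpace.single i s + EuclideanSpace.single j t)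
  have h1 : ∑ k, (EuclideanSpace.single i s + EuclideanSpace.single j t : Vec r) k • x k
      = s • x i + t • x j := by
    simp [add_smul, Finset.sum_add_distrib]
  rw [h1] at h
  refine le_trans (mul_le_mul_of_nonneg_left ?_ hc.le) h
  have := PiLp.norm_apply_le (EuclideanSpace.single i s + EuclideanSpace.single j t : Vec r) i
  simpa [hij] using this

/-- Dual vectors of a robustly independent family. -/
theorem Robust.exists_dual (hc : 0 < c) (hx : Robust c x) :
    ∃ x' : Fin r → Vec n, (∀ i, x' i ∈ spanOf x) ∧ (∀ i, ‖x' i‖ ≤ c⁻¹) ∧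
      ∀ i j, ⟪x' i, x j⟫ = if i = j then 1 else 0 := by
  classical
  -- The dual vector is the part `d i` of `x i` orthogonal to the other vectors, rescaled. It is a
  -- combination of the family with `i`-th coefficient 1, so robustness gives `c ≤ ‖d i‖`.
  let W : Fin r → Submodule ℝ (Vec n) := fun i => Submodule.span ℝ (x '' {i}ᶜ)
  let d : Fin r → Vec n := fun i => x i - (W i).starProjection (x i)
  have hdW : ∀ i, ∀ w ∈ W i, ⟪d i, w⟫ = 0 := fun i w hw => by
    have := (W i).sub_starProjection_mem_orthogonal (x i)
    exact Submodule.inner_left_of_mem_orthogonal hw this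
  have hd : ∀ i, c ≤ ‖d i‖ := fun i => by
    have hmem : (W i).starProjection (x i) ∈ W i := Submodule.starProjection_apply_mem _ _
    obtain ⟨l, hl, hl2⟩ := (Finsupp.mem_span_image_iff_linearCombination ℝ).1 hmem
    have h := hx (WithLp.toLp 2 fun j => if j = i then 1 else - l j)
    have hli : l i = 0 := by
      by_contra h0
      have := (Finsupp.mem_supported ℝ l).1 hl (Finsupp.mem_support_iff.2 h0)
      simp at this
    have hsum : ∑ j, (if j = i then (1 : ℝ) else - l j) • x j = d i := by
      have h3 : ∑ j, l j • x j = (W i).starProjection (x i) := by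
        rw [← hl2, Finsupp.linearCombination_apply, Finsupp.sum_fintype _ _ (by simp)]
      have : ∀ j, (if j = i then (1 : ℝ) else - l j) • x j
          = (if j = i then x j else 0) - l j • x j := fun j => by
        split_ifs with hj
        · subst hj; simp [hli]
        · simp
      simp only [this, Finset.sum_sub_distrib, h3]
      simp [d]
    have h1 : (1 : ℝ) ≤ ‖(WithLp.toLp 2 fun j => if j = i then (1 : ℝ) else - l j : Vec r)‖ := by
      have := PiLp.norm_apply_le
        (WithLp.toLp 2 fun j => if j = i then (1 : ℝ) else - l j : Vec r) i
      simpa using this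
    have h2 : ‖d i‖ = ‖∑ j, (if j = i then (1 : ℝ) else - l j) • x j‖ := by rw [hsum]
    rw [h2]
    refine le_trans ?_ h
    nlinarith
  have hd0 : ∀ i, 0 < ‖d i‖ := fun i => hc.trans_le (hd i)
  refine ⟨fun i => (‖d i‖ ^ 2)⁻¹ • d i, fun i => ?_, fun i => ?_, fun i j => ?_⟩
  · refine Submodule.smul_mem _ _ (Submodule.sub_mem _ (Submodule.subset_span ⟨i, rfl⟩) ?_)
    exact Submodule.span_mono (Set.image_subset_range x {i}ᶜ)
      (Submodule.starProjection_apply_mem (W i) _)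
  · rw [norm_smul, norm_inv, norm_pow, norm_norm]
    have := hd0 i
    rw [show (‖d i‖ ^ 2)⁻¹ * ‖d i‖ = ‖d i‖⁻¹ by field_simp]
    exact inv_anti₀ hc (hd i)
  · rw [inner_smul_left]
    split_ifs with h
    · subst h
      have h1 : ⟪d i, x i⟫ = ‖d i‖ ^ 2 := by
        have h2 : x i = d i + (W i).starProjection (x i) := by simp [d]
        have h3 := hdW i _ (Submodule.starProjection_apply_mem (W i) (x i))
        calc ⟪d i, x i⟫ = ⟪d i, d i + (W i).starProjection (x i)⟫ := by rw [← h2]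
          _ = ‖d i‖ ^ 2 := by rw [inner_add_right, h3, add_zero, real_inner_self_eq_norm_sq]
      rw [h1]
      have := hd0 i
      simp only [conj_trivial]
      field_simp
    · rw [hdW i (x j) (Submodule.subset_span ⟨j, by simpa using Ne.symm h, rfl⟩)]
      simp

end Robust

/-! ### Subspaces at a small angle to a given span -/

section Perturb

variable {n r : ℕ} {c δ : ℝ} {x : Fin r → Vec n} {V : Submodule ℝ (Vec n)}

theorem norm_sub_starProjection_le (h : sinAngle (spanOf x) V ≤ δ) {v : Vec n}
    (hv : v ∈ spanOf x) : ‖v - V.starProjection v‖ ≤ δ * ‖v‖ := by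
  have h1 := ((Vᗮ.starProjection).comp (spanOf x).subtypeL).le_opNorm ⟨v, hv⟩
  have h2 : ((Vᗮ.starProjection).comp (spanOf x).subtypeL) ⟨v, hv⟩ = v - V.starProjection v := by
    simp [Submodule.starProjection_orthogonal]
  rw [h2] at h1
  exact h1.trans (mul_le_mul_of_nonneg_right h (norm_nonneg _))

theorem sum_smul_mem_spanOf (g : Fin r → ℝ) : ∑ i, g i • x i ∈ spanOf x :=
  Submodule.sum_mem _ fun i _ => Submodule.smul_mem _ _ (Submodule.subset_span ⟨i, rfl⟩)

/-- Projecting to `V` moves a vector of the span by at most half its length, so the lower bound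
loses at most a factor of two. -/
theorem robust_starProjection (hδ : δ ≤ 1 / 2) (hx : Robust c x)
    (h : sinAngle (spanOf x) V ≤ δ) : Robust (c / 2) fun i => V.starProjection (x i) := by
  intro g
  have h1 := norm_sub_starProjection_le h (sum_smul_mem_spanOf (x := x) fun i => g i)
  have h2 : ∑ i, g i • V.starProjection (x i) = V.starProjection (∑ i, g i • x i) := by
    simp [map_sum]
  have h3 := hx g
  rw [h2]
  have h4 := norm_sub_norm_le (∑ i, g i • x i) (V.starProjection (∑ i, g i • x i))
  nlinarith [norm_nonneg (∑ i, g i • x i)]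

/-- The projected vectors are `r` independent vectors of an `r`-dimensional space, so they form the
basis of `V` in which all tensors are later expanded. -/
theorem spanOf_starProjection_eq (hc : 0 < c) (hδ : δ ≤ 1 / 2) (hx : Robust c x)
    (h : sinAngle (spanOf x) V ≤ δ) (hV : Module.finrank ℝ V = r) :
    spanOf (fun i => V.starProjection (x i)) = V := by
  have hle : spanOf (fun i => V.starProjection (x i)) ≤ V := by
    refine Submodule.span_le.2 ?_
    rintro _ ⟨i, rfl⟩
    exact Submodule.starProjection_apply_mem _ _
  refine Submodule.eq_of_le_of_finrank_eq hle ?_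
  rw [hV]
  have := (robust_starProjection hδ hx h).linearIndependent (half_pos hc)
  exact (finrank_span_eq_card this).trans (Fintype.card_fin r)

theorem finrank_spanOf (hc : 0 < c) (hx : Robust c x) : Module.finrank ℝ (spanOf x) = r := by
  exact (finrank_span_eq_card (hx.linearIndependent hc)).trans (Fintype.card_fin r)

/-- A subspace close to an incoherent one is incoherent. -/
theorem abs_inner_le_of_sinAngle_le (hc : 0 < c) (hδ : δ ≤ 1 / 2) (hx : Robust c x)
    (h : sinAngle (spanOf x) V ≤ δ) (hV : Module.finrank ℝ V = r) (e : Vec n) (he : ‖e‖ ≤ 1) :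
    ‖V.starProjection e‖ ≤ 2 * (‖(spanOf x).starProjection e‖ + δ) := by
  set u := V.starProjection e with hu
  have huV : u ∈ V := Submodule.starProjection_apply_mem _ _
  have huV' := huV
  rw [← spanOf_starProjection_eq hc hδ hx h hV] at huV'
  obtain ⟨g, hg⟩ := (Submodule.mem_span_range_iff_exists_fun ℝ).1 huV'
  set s := ∑ i, g i • x i with hs
  have hsx : s ∈ spanOf x := sum_smul_mem_spanOf g
  have hus : V.starProjection s = u := by rw [← hg, hs]; simp [map_sum]
  have h1 := norm_sub_starProjection_le h hsx
  rw [hus] at h1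
  have h2 := norm_sub_norm_le s u
  have h3 : ‖s‖ ≤ 2 * ‖u‖ := by nlinarith [norm_nonneg s]
  have h4 : ⟪u, u⟫ = ⟪u, e⟫ := by
    have := Submodule.sub_starProjection_mem_orthogonal (K := V) e
    have h5 := Submodule.inner_right_of_mem_orthogonal huV this
    rw [inner_sub_right] at h5
    rw [hu] at h5 ⊢
    linarith
  have h5 : ⟪s, e⟫ = ⟪s, (spanOf x).starProjection e⟫ := by
    have := Submodule.sub_starProjection_mem_orthogonal (K := spanOf x) e
    have h6 := Submodule.inner_right_of_mem_orthogonal hsx this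
    rw [inner_sub_right] at h6
    linarith
  have h6 : ⟪u, e⟫ = ⟪s, e⟫ - ⟪s - u, e⟫ := by rw [inner_sub_left]; ring
  have h7 := real_inner_le_norm s ((spanOf x).starProjection e)
  have h8 := (abs_le.1 (abs_real_inner_le_norm (s - u) e)).1
  have h9 : ‖u‖ ^ 2 ≤ ‖s‖ * (‖(spanOf x).starProjection e‖ + δ) := by
    rw [← real_inner_self_eq_norm_sq, h4, h6, h5]
    have : ‖s - u‖ * ‖e‖ ≤ δ * ‖s‖ := by
      nlinarith [norm_nonneg (s - u), norm_nonneg e]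
    nlinarith
  by_cases hu0 : ‖u‖ = 0
  · rw [hu0] at h3 ⊢
    have : 0 ≤ δ := le_trans (by unfold sinAngle; positivity) h
    positivity
  · have hpos : 0 < ‖u‖ := lt_of_le_of_ne (norm_nonneg _) (Ne.symm hu0)
    have : 0 ≤ δ := le_trans (by unfold sinAngle; positivity) h
    have h10 : ‖u‖ * ‖u‖ ≤ ‖u‖ * (2 * (‖(spanOf x).starProjection e‖ + δ)) := by
      nlinarith [norm_nonneg ((spanOf x).starProjection e)]
    exact le_of_mul_le_mul_left h10 hpos

/-- The squared lengths of the projections of the standard basis vectors sum to the dimension. -/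
theorem sum_sq_norm_starProjection_single (V : Submodule ℝ (Vec n)) :
    ∑ i, ‖V.starProjection (EuclideanSpace.single i (1 : ℝ))‖ ^ 2 = Module.finrank ℝ V := by
  set b := stdOrthonormalBasis ℝ V
  have h1 : ∀ i, ‖V.starProjection (EuclideanSpace.single i (1 : ℝ))‖ ^ 2
      = ∑ k, ((b k : Vec n) i) ^ 2 := fun i => by
    have h2 : ‖V.starProjection (EuclideanSpace.single i (1 : ℝ))‖
        = ‖V.orthogonalProjectionOnto (EuclideanSpace.single i (1 : ℝ))‖ := by
      simp
    rw [h2, ← b.sum_sq_norm_inner_right]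
    refine Finset.sum_congr rfl fun k _ => ?_
    rw [Submodule.inner_orthogonalProjectionOnto_eq_of_mem_left]
    simp [EuclideanSpace.inner_single_right]
  simp only [h1]
  rw [Finset.sum_comm]
  have h3 : ∀ k, ∑ i, ((b k : Vec n) i) ^ 2 = 1 := fun k => by
    rw [← EuclideanSpace.real_norm_sq_eq]
    have := b.orthonormal.1 k
    rw [Submodule.coe_norm] at this
    rw [this]; norm_num
  simp [h3]

end Perturb

noncomputable section

/-! ### Multilinear algebra of rank-one tensors, contractions and slices -/

section Outer

variable {n : ℕ}

theorem outer_apply (x y z : Vec n) (e : Fin n × Fin n × Fin n) :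
    outer x y z e = x e.1 * y e.2.1 * z e.2.2 := rfl

theorem outer_add_right (x y z z' : Vec n) : outer x y (z + z') = outer x y z + outer x y z' := by
  ext e; simp [outer_apply]; ring

theorem outer_sub_left (x x' y z : Vec n) : outer (x - x') y z = outer x y z - outer x' y z := by
  ext e; simp [outer_apply]; ring

theorem outer_sub_mid (x y y' z : Vec n) : outer x (y - y') z = outer x y z - outer x y' z := by
  ext e; simp [outer_apply]; ring

theorem outer_sub_right (x y z z' : Vec n) : outer x y (z - z') = outer x y z - outer x y z' := by
  ext e; simp [outer_apply]; ring

theorem outer_smul_left (s : ℝ) (x y z : Vec n) : outer (s • x) y z = s • outer x y z := by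
  ext e; simp [outer_apply]; ring

theorem outer_smul_mid (s : ℝ) (x y z : Vec n) : outer x (s • y) z = s • outer x y z := by
  ext e; simp [outer_apply]; ring

theorem outer_smul_right (s : ℝ) (x y z : Vec n) : outer x y (s • z) = s • outer x y z := by
  ext e; simp [outer_apply]; ring

theorem outer_sum_left {ι : Type*} (s : Finset ι) (x : ι → Vec n) (y z : Vec n) :
    outer (∑ i ∈ s, x i) y z = ∑ i ∈ s, outer (x i) y z := by
  ext e; simp [outer_apply, Finset.sum_mul]

theorem outer_sum_mid {ι : Type*} (s : Finset ι) (x : Vec n) (y : ι → Vec n) (z : Vec n) :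
    outer x (∑ i ∈ s, y i) z = ∑ i ∈ s, outer x (y i) z := by
  ext e; simp [outer_apply, Finset.sum_mul, Finset.mul_sum]

theorem inner_outer (x y z x' y' z' : Vec n) :
    ⟪outer x y z, outer x' y' z'⟫ = ⟪x, x'⟫ * ⟪y, y'⟫ * ⟪z, z'⟫ := by
  simp only [PiLp.inner_apply, outer_apply, RCLike.inner_apply, conj_trivial,
    Fintype.sum_prod_type]
  rw [Finset.sum_mul_sum, Finset.sum_mul]
  refine Finset.sum_congr rfl fun i _ => ?_
  rw [Finset.sum_mul]
  refine Finset.sum_congr rfl fun j _ => ?_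
  rw [Finset.mul_sum]
  refine Finset.sum_congr rfl fun k _ => ?_
  ring

theorem norm_outer (x y z : Vec n) : ‖outer x y z‖ = ‖x‖ * ‖y‖ * ‖z‖ := by
  have h : ‖outer x y z‖ ^ 2 = (‖x‖ * ‖y‖ * ‖z‖) ^ 2 := by
    rw [← real_inner_self_eq_norm_sq, inner_outer]
    simp only [real_inner_self_eq_norm_sq]; ring
  exact (pow_left_inj₀ (norm_nonneg _) (by positivity) two_ne_zero).1 h

theorem norm_outer_sub_outer_le (x y z x' y' z' : Vec n) :
    ‖outer x y z - outer x' y' z'‖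
      ≤ ‖x - x'‖ * ‖y‖ * ‖z‖ + ‖x'‖ * ‖y - y'‖ * ‖z‖ + ‖x'‖ * ‖y'‖ * ‖z - z'‖ := by
  have h : outer x y z - outer x' y' z'
      = outer (x - x') y z + outer x' (y - y') z + outer x' y' (z - z') := by
    rw [outer_sub_left, outer_sub_mid, outer_sub_right]; abel
  rw [h, ← norm_outer, ← norm_outer, ← norm_outer]
  exact norm_add₃_le

/-- The vector `T(p, q, ·)`. -/
def contractTwo (T : Tensor n) (p q : Vec n) : Vec n :=
  WithLp.toLp 2 fun k => ∑ i, ∑ j, T (i, j, k) * p i * q j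

/-- This adjunction characterises the contraction; its linearity and its value on rank-one tensors
follow by testing against all `s`. -/
theorem inner_contractTwo (T : Tensor n) (p q s : Vec n) :
    ⟪contractTwo T p q, s⟫ = ⟪T, outer p q s⟫ := by
  simp only [PiLp.inner_apply, outer_apply, RCLike.inner_apply, conj_trivial,
    Fintype.sum_prod_type, contractTwo, Finset.mul_sum]
  rw [Finset.sum_comm]
  refine Finset.sum_congr rfl fun i _ => ?_
  rw [Finset.sum_comm]
  refine Finset.sum_congr rfl fun j _ => Finset.sum_congr rfl fun k _ => ?_
  ring

theorem norm_contractTwo_le (T : Tensor n) (p q : Vec n) :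
    ‖contractTwo T p q‖ ≤ ‖T‖ * (‖p‖ * ‖q‖) := by
  have h := real_inner_le_norm T (outer p q (contractTwo T p q))
  rw [← inner_contractTwo, real_inner_self_eq_norm_sq, norm_outer] at h
  by_cases h0 : ‖contractTwo T p q‖ = 0
  · rw [h0]; positivity
  · have hpos : 0 < ‖contractTwo T p q‖ := lt_of_le_of_ne (norm_nonneg _) (Ne.symm h0)
    refine le_of_mul_le_mul_right (a := ‖contractTwo T p q‖) ?_ hpos
    nlinarith

theorem contractTwo_outer (x y z p q : Vec n) :
    contractTwo (outer x y z) p q = (⟪p, x⟫ * ⟪q, y⟫) • z := by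
  refine ext_inner_right ℝ fun s => ?_
  rw [inner_contractTwo, inner_outer, inner_smul_left, real_inner_comm p x, real_inner_comm q y]
  simp

theorem contractTwo_add (T T' : Tensor n) (p q : Vec n) :
    contractTwo (T + T') p q = contractTwo T p q + contractTwo T' p q :=
  ext_inner_right ℝ fun s => by simp only [inner_contractTwo, inner_add_left]

theorem contractTwo_sub (T T' : Tensor n) (p q : Vec n) :
    contractTwo (T - T') p q = contractTwo T p q - contractTwo T' p q :=
  ext_inner_right ℝ fun s => by simp only [inner_contractTwo, inner_sub_left]

theorem contractTwo_smul (c : ℝ) (T : Tensor n) (p q : Vec n) :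
    contractTwo (c • T) p q = c • contractTwo T p q :=
  ext_inner_right ℝ fun s => by simp only [inner_contractTwo, inner_smul_left]

theorem contractTwo_zero (p q : Vec n) : contractTwo (0 : Tensor n) p q = 0 :=
  ext_inner_right ℝ fun s => by simp only [inner_contractTwo, inner_zero_left]

theorem contractTwo_sum {ι : Type*} (s : Finset ι) (T : ι → Tensor n) (p q : Vec n) :
    contractTwo (∑ i ∈ s, T i) p q = ∑ i ∈ s, contractTwo (T i) p q :=
  ext_inner_right ℝ fun s => by simp only [inner_contractTwo, sum_inner]

/-- Expansion of a vector in a basis of a subspace with the help of dual vectors. -/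
theorem sum_inner_smul_eq {r : ℕ} {x x' : Fin r → Vec n}
    (hdual : ∀ i j, ⟪x' i, x j⟫ = if i = j then 1 else 0) {u : Vec n} (hu : u ∈ spanOf x) :
    ∑ i, ⟪x' i, u⟫ • x i = u := by
  obtain ⟨g, rfl⟩ := (Submodule.mem_span_range_iff_exists_fun ℝ).1 hu
  refine Finset.sum_congr rfl fun i _ => ?_
  simp [inner_sum, inner_smul_right, hdual]

/-- Only the first two modes are expanded. The third stays a vector, because that is the mode
contracted with the random directions. -/
theorem tensorSubspace_expansion {r : ℕ} {x x' y y' : Fin r → Vec n}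
    (hx : ∀ i j, ⟪x' i, x j⟫ = if i = j then 1 else 0)
    (hy : ∀ i j, ⟪y' i, y j⟫ = if i = j then 1 else 0) {W : Submodule ℝ (Vec n)} {T : Tensor n}
    (hT : T ∈ tensorSubspace (spanOf x) (spanOf y) W) :
    T = ∑ i, ∑ j, outer (x i) (y j) (contractTwo T (x' i) (y' j)) := by
  induction hT using Submodule.span_induction with
  | mem T hT =>
    obtain ⟨a, ha, b, hb, d, -, rfl⟩ := hT
    conv_lhs => rw [← sum_inner_smul_eq hx ha, ← sum_inner_smul_eq hy hb]
    rw [outer_sum_left]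
    refine Finset.sum_congr rfl fun i _ => ?_
    rw [outer_sum_mid]
    refine Finset.sum_congr rfl fun j _ => ?_
    rw [contractTwo_outer, outer_smul_left, outer_smul_mid, outer_smul_right, smul_smul]
  | zero => simp [contractTwo_zero, show ∀ p q : Vec n, outer p q 0 = 0 from fun p q => by
      ext e; simp [outer_apply]]
  | add T T' _ _ h h' =>
    simp only [contractTwo_add, outer_add_right, Finset.sum_add_distrib]
    rw [← h, ← h']
  | smul c T _ h =>
    simp only [contractTwo_smul, outer_smul_right, ← Finset.smul_sum]
    rw [← h]

/-- The matrix with the given columns. -/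
def colMatrix {r : ℕ} (x : Fin r → Vec n) : Matrix (Fin n) (Fin r) ℝ := Matrix.of fun k i => x i k

theorem colMatrix_apply {r : ℕ} (x : Fin r → Vec n) (k : Fin n) (i : Fin r) :
    colMatrix x k i = x i k := rfl

theorem transpose_colMatrix_mul {r : ℕ} {x x' : Fin r → Vec n}
    (hx : ∀ i j, ⟪x' i, x j⟫ = if i = j then 1 else 0) :
    (colMatrix x').transpose * colMatrix x = 1 := by
  ext i j
  rw [Matrix.one_apply, ← hx i j, Matrix.mul_apply, PiLp.inner_apply]
  simp [colMatrix_apply, mul_comm]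

theorem toLp_colMatrix_mulVec {r : ℕ} (x : Fin r → Vec n) (f : Fin r → ℝ) :
    WithLp.toLp 2 ((colMatrix x).mulVec f) = ∑ i, f i • x i := by
  ext k
  simp [Matrix.mulVec, dotProduct, colMatrix_apply, mul_comm]

theorem contract_sum {ι : Type*} (s : Finset ι) (T : ι → Tensor n) (a : Vec n) :
    contract (∑ i ∈ s, T i) a = ∑ i ∈ s, contract (T i) a := by
  ext p q
  simp only [contract, Matrix.of_apply, WithLp.ofLp_sum, Finset.sum_apply, Finset.sum_mul,
    Matrix.sum_apply]
  exact Finset.sum_comm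

theorem contract_outer_apply (x y w a : Vec n) (p q : Fin n) :
    contract (outer x y w) a p q = x p * y q * ⟪w, a⟫ := by
  simp only [contract, Matrix.of_apply, outer_apply, PiLp.inner_apply, RCLike.inner_apply,
    conj_trivial, Finset.mul_sum]
  exact Finset.sum_congr rfl fun k _ => by ring

/-- Displays a slice as column matrix times an `r × r` coefficient matrix times transposed column
matrix, which reduces the eigenproblems to `r × r` pencils. -/
theorem contract_sum_outer {r : ℕ} (x y : Fin r → Vec n) (w : Fin r → Fin r → Vec n) (a : Vec n) :
    contract (∑ i, ∑ j, outer (x i) (y j) (w i j)) a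
      = colMatrix x * (Matrix.of fun i j => ⟪w i j, a⟫) * (colMatrix y).transpose := by
  ext p q
  simp only [contract_sum, Matrix.sum_apply, contract_outer_apply, Matrix.mul_apply,
    Matrix.transpose_apply, colMatrix_apply, Matrix.of_apply, Finset.sum_mul]
  rw [Finset.sum_comm]
  exact Finset.sum_congr rfl fun j _ => Finset.sum_congr rfl fun i _ => by ring

theorem outer_mem_tensorSubspace {U V W : Submodule ℝ (Vec n)} {x y z : Vec n} (hx : x ∈ U)
    (hy : y ∈ V) (hz : z ∈ W) : outer x y z ∈ tensorSubspace U V W :=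
  Submodule.subset_span ⟨x, hx, y, hy, z, hz, rfl⟩

end Outer

/-! ### From close rank-one tensors to close factors -/

section RankOne

/-- A multiple of a unit vector close to a positive multiple of a unit vector. -/
theorem exists_sign_norm_sub_le {E : Type*} [NormedAddCommGroup E] [NormedSpace ℝ E] {x xh : E}
    {s σ e : ℝ} (hx : ‖x‖ = 1) (hxh : ‖xh‖ = 1) (hσ : 0 < σ)
    (h : ‖s • xh - σ • x‖ ≤ e) :
    ∃ ε ∈ ({-1, 1} : Set ℝ), ‖x - ε • xh‖ ≤ 2 * e / σ := by
  have h1 : |(|s| - σ)| ≤ e := by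
    refine le_trans ?_ h
    have := abs_norm_sub_norm_le (s • xh) (σ • x)
    simpa [norm_smul, hx, hxh, abs_of_pos hσ] using this
  -- `s` lies within `e` of `σ` or of `-σ`. Replacing it by that value costs a second `e`, whence
  -- the factor 2.
  have key : ∀ ε : ℝ, |s - σ * ε| ≤ e → ‖x - ε • xh‖ ≤ 2 * e / σ := fun ε hε => by
    rw [le_div_iff₀ hσ]
    have h2 : σ • (x - ε • xh) = (s - σ * ε) • xh - (s • xh - σ • x) := by
      rw [smul_sub, sub_smul, smul_smul]; abel
    calc ‖x - ε • xh‖ * σ = ‖σ • (x - ε • xh)‖ := by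
          rw [norm_smul, Real.norm_eq_abs, abs_of_pos hσ, mul_comm]
      _ ≤ ‖(s - σ * ε) • xh‖ + ‖s • xh - σ • x‖ := by rw [h2]; exact norm_sub_le _ _
      _ ≤ e + e := add_le_add (by rw [norm_smul, hxh, mul_one]; exact hε) h
      _ = 2 * e := by ring
  rcases le_total 0 s with hs | hs
  · refine ⟨1, by simp, key 1 ?_⟩
    rwa [abs_of_nonneg hs, ← mul_one σ] at h1
  · refine ⟨-1, by simp, key (-1) ?_⟩
    rw [abs_of_nonpos hs] at h1
    rw [← abs_neg]
    convert h1 using 2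
    ring

variable {n : ℕ}

theorem norm_le_of_inner_le {E : Type*} [NormedAddCommGroup E] [InnerProductSpace ℝ E] {d : E}
    {e : ℝ} (he : 0 ≤ e) (h : ⟪d, d⟫ ≤ e * ‖d‖) : ‖d‖ ≤ e := by
  rw [real_inner_self_eq_norm_sq] at h
  by_contra! hlt
  nlinarith [norm_nonneg d]

/-- Rank-one tensors that are close have close factors. -/
theorem rankOne_close {σ σh e : ℝ} {x y z xh yh zh : Vec n} (hσ : 0 < σ) (hσh : 0 ≤ σh)
    (hx : ‖x‖ = 1) (hy : ‖y‖ = 1) (hz : ‖z‖ = 1)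
    (hxh : ‖xh‖ = 1) (hyh : ‖yh‖ = 1) (hzh : ‖zh‖ = 1)
    (h : ‖σh • outer xh yh zh - σ • outer x y z‖ ≤ e) :
    |σ - σh| ≤ e ∧ (∃ ε ∈ ({-1, 1} : Set ℝ), ‖x - ε • xh‖ ≤ 2 * e / σ) ∧
      (∃ ε ∈ ({-1, 1} : Set ℝ), ‖y - ε • yh‖ ≤ 2 * e / σ) ∧
      ∃ ε ∈ ({-1, 1} : Set ℝ), ‖z - ε • zh‖ ≤ 2 * e / σ := by
  have he : 0 ≤ e := (norm_nonneg _).trans h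
  have hin : ∀ X : Tensor n, ⟪σh • outer xh yh zh - σ • outer x y z, X⟫ ≤ e * ‖X‖ := fun X =>
    (real_inner_le_norm _ _).trans (mul_le_mul_of_nonneg_right h (norm_nonneg _))
  have hxx : ⟪x, x⟫ = 1 := by rw [real_inner_self_eq_norm_sq, hx]; norm_num
  have hyy : ⟪y, y⟫ = 1 := by rw [real_inner_self_eq_norm_sq, hy]; norm_num
  have hzz : ⟪z, z⟫ = 1 := by rw [real_inner_self_eq_norm_sq, hz]; norm_num
  refine ⟨?_, ?_, ?_, ?_⟩
  · have := abs_norm_sub_norm_le (σh • outer xh yh zh) (σ • outer x y z)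
    rw [abs_sub_comm]
    refine le_trans (le_of_eq ?_) (this.trans h)
    simp [norm_smul, norm_outer, hx, hy, hz, hxh, hyh, hzh, abs_of_pos hσ, abs_of_nonneg hσh]
  -- Contracting the difference of the two tensors with `y` and `z` leaves the vector `d`. Testing
  -- the difference against `outer d y z` gives `‖d‖² ≤ e‖d‖`.
  · refine exists_sign_norm_sub_le (s := σh * ⟪yh, y⟫ * ⟪zh, z⟫) hx hxh hσ
      (norm_le_of_inner_le he ?_)
    set d := (σh * ⟪yh, y⟫ * ⟪zh, z⟫) • xh - σ • x with hd
    have := hin (outer d y z)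
    rw [norm_outer, hy, hz, mul_one, mul_one] at this
    refine le_trans (le_of_eq ?_) this
    conv_lhs => enter [2]; rw [hd]
    simp only [inner_sub_left, inner_smul_left, inner_outer, hyy, hzz, conj_trivial]
    ring
  · refine exists_sign_norm_sub_le (s := σh * ⟪xh, x⟫ * ⟪zh, z⟫) hy hyh hσ
      (norm_le_of_inner_le he ?_)
    set d := (σh * ⟪xh, x⟫ * ⟪zh, z⟫) • yh - σ • y with hd
    have := hin (outer x d z)
    rw [norm_outer, hx, hz, mul_one, one_mul] at this
    refine le_trans (le_of_eq ?_) this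
    conv_lhs => enter [2]; rw [hd]
    simp only [inner_sub_left, inner_smul_left, inner_outer, hxx, hzz, conj_trivial]
    ring
  · refine exists_sign_norm_sub_le (s := σh * ⟪xh, x⟫ * ⟪yh, y⟫) hz hzh hσ
      (norm_le_of_inner_le he ?_)
    set d := (σh * ⟪xh, x⟫ * ⟪yh, y⟫) • zh - σ • z with hd
    have := hin (outer x y d)
    rw [norm_outer, hx, hy, mul_one, one_mul] at this
    refine le_trans (le_of_eq ?_) this
    conv_lhs => enter [2]; rw [hd]
    simp only [inner_sub_left, inner_smul_left, inner_outer, hxx, hyy, conj_trivial]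
    ring

end RankOne

end

/-! ### Nearly diagonal matrix pencils -/

section Pencil

variable {ι : Type*} [Fintype ι] [DecidableEq ι]

/-- The determinant of a diagonally dominant matrix has the sign of the product of the diagonal. -/
theorem det_diagonal_add_mul_prod_pos {d : ι → ℝ} {E : Matrix ι ι ℝ}
    (h : ∀ i, ∑ j, |E i j| < |d i|) : 0 < (Matrix.diagonal d + E).det * ∏ i, d i := by
  -- Along the segment from `diagonal d` to `diagonal d + E` strict diagonal dominance persists, so
  -- the determinant never vanishes and keeps its sign.
  let φ : ℝ → ℝ := fun s => (Matrix.diagonal d + s • E).det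
  have hφ : Continuous φ := by
    apply Continuous.matrix_det
    fun_prop
  have hne : ∀ s ∈ Set.Icc (0 : ℝ) 1, φ s ≠ 0 := by
    intro s hs
    refine det_ne_zero_of_sum_row_lt_diag fun i => ?_
    have h1 : ∑ j ∈ Finset.univ.erase i, ‖(Matrix.diagonal d + s • E) i j‖
        ≤ ∑ j ∈ Finset.univ.erase i, |E i j| := by
      refine Finset.sum_le_sum fun j hj => ?_
      have hij : i ≠ j := (Finset.ne_of_mem_erase hj).symm
      simp only [Matrix.add_apply, Matrix.diagonal_apply_ne _ hij, zero_add, Matrix.smul_apply,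
        smul_eq_mul, Real.norm_eq_abs, abs_mul, abs_of_nonneg hs.1]
      exact mul_le_of_le_one_left (abs_nonneg _) hs.2
    have h2 := Finset.add_sum_erase Finset.univ (fun j => |E i j|) (Finset.mem_univ i)
    have h3 : |d i| - |E i i| ≤ ‖(Matrix.diagonal d + s • E) i i‖ := by
      have h5 : (Matrix.diagonal d + s • E) i i = d i + s * E i i := by
        rw [Matrix.add_apply, Matrix.diagonal_apply_eq, Matrix.smul_apply, smul_eq_mul]
      rw [h5, Real.norm_eq_abs]
      have h4 := abs_sub_abs_le_abs_sub (d i) (-(s * E i i))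
      rw [sub_neg_eq_add, abs_neg, abs_mul, abs_of_nonneg hs.1] at h4
      nlinarith [abs_nonneg (E i i), hs.2]
    have := h i
    linarith
  have hd : ∀ i, d i ≠ 0 := fun i h0 => by
    have := h i
    rw [h0, abs_zero] at this
    exact absurd this (not_lt.2 (Finset.sum_nonneg fun j _ => abs_nonneg _))
  have h0 : φ 0 = ∏ i, d i := by simp [φ, Matrix.det_diagonal]
  have h1 : φ 1 = (Matrix.diagonal d + E).det := by simp [φ]
  have hp : ∏ i, d i ≠ 0 := Finset.prod_ne_zero_iff.2 fun i _ => hd i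
  rw [← h1, ← h0]
  by_contra! hle
  have h01 : (0 : ℝ) ≤ 1 := zero_le_one
  have h0ne := hne 0 (by simp)
  rcases lt_or_gt_of_ne h0ne with hneg | hpos
  · have : 0 ∈ Set.Icc (φ 0) (φ 1) := ⟨hneg.le, by nlinarith⟩
    obtain ⟨s, hs, hs0⟩ := intermediate_value_Icc h01 hφ.continuousOn this
    exact hne s hs hs0
  · have : 0 ∈ Set.Icc (φ 1) (φ 0) := ⟨by nlinarith, hpos.le⟩
    obtain ⟨s, hs, hs0⟩ := intermediate_value_Icc' h01 hφ.continuousOn this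
    exact hne s hs hs0

/-- The matrices `A`, `B` are close to diagonal matrices with well separated quotients of
diagonal entries; all tolerances are powers of `κ`. -/
structure NearDiagonal (κ : ℝ) (A B : Matrix ι ι ℝ) (α β : ι → ℝ) : Prop where
  pos : 0 < κ
  le : κ ≤ 1 / 1000
  card_mul_le : Fintype.card ι * κ ≤ 1
  left : ∀ i j, |A i j - if i = j then α i else 0| ≤ κ ^ 96
  right : ∀ i j, |B i j - if i = j then β i else 0| ≤ κ ^ 96
  abs_left_le : ∀ i, |α i| ≤ 1
  abs_right_le : ∀ i, |β i| ≤ 1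
  le_abs_left : ∀ i, κ ^ 5 ≤ |α i|
  le_abs_right : ∀ i, κ ^ 5 ≤ |β i|
  gap : ∀ i j, i ≠ j → κ ^ 11 ≤ |α i * β j - α j * β i|

namespace NearDiagonal

variable {κ : ℝ} {A B : Matrix ι ι ℝ} {α β : ι → ℝ}

/-- With `transpose`, this lets every result for the first eigenproblem be reused for the second,
whose pencil is transposed and has `A` and `B` exchanged. -/
theorem swap (h : NearDiagonal κ A B α β) : NearDiagonal κ B A β α where
  pos := h.pos
  le := h.le
  card_mul_le := h.card_mul_le
  left := h.right
  right := h.left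
  abs_left_le := h.abs_right_le
  abs_right_le := h.abs_left_le
  le_abs_left := h.le_abs_right
  le_abs_right := h.le_abs_left
  gap i j hij := by
    have := h.gap j i hij.symm
    rwa [mul_comm (β i), mul_comm (β j)]

theorem transpose (h : NearDiagonal κ A B α β) :
    NearDiagonal κ A.transpose B.transpose α β where
  pos := h.pos
  le := h.le
  card_mul_le := h.card_mul_le
  left i j := by
    have := h.left j i
    rw [Matrix.transpose_apply]
    convert this using 3
    by_cases hij : i = j
    · simp [hij]
    · simp [hij, Ne.symm hij]
  right i j := by
    have := h.right j i
    rw [Matrix.transpose_apply]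
    convert this using 3
    by_cases hij : i = j
    · simp [hij]
    · simp [hij, Ne.symm hij]
  abs_left_le := h.abs_left_le
  abs_right_le := h.abs_right_le
  le_abs_left := h.le_abs_left
  le_abs_right := h.le_abs_right
  gap := h.gap

/-- One spare power of `κ` pays for constants up to 1000; this turns comparisons of powers into
linear arithmetic. -/
theorem pow_succ_le (h : NearDiagonal κ A B α β) {m k : ℕ} (hmk : m < k) :
    κ ^ k ≤ κ ^ m / 1000 := by
  have h1 : κ ^ k ≤ κ ^ (m + 1) := pow_le_pow_of_le_one h.pos.le (by linarith [h.le]) hmk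
  have := pow_pos h.pos m
  rw [pow_succ] at h1
  nlinarith [h.le]

theorem abs_mulVec_sub_le (h : NearDiagonal κ A B α β) {f : ι → ℝ} {m : ℝ}
    (hf : ∀ j, |f j| ≤ m) (i : ι) : |A.mulVec f i - α i * f i| ≤ κ ^ 95 * m := by
  have h1 : A.mulVec f i - α i * f i = ∑ j, (A i j - if i = j then α i else 0) * f j := by
    simp [Matrix.mulVec, dotProduct, sub_mul, Finset.sum_sub_distrib]
  have hm : 0 ≤ m := (abs_nonneg _).trans (hf i)
  calc |A.mulVec f i - α i * f i| ≤ ∑ j, |(A i j - if i = j then α i else 0) * f j| := by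
        rw [h1]; exact Finset.abs_sum_le_sum_abs _ _
    _ ≤ ∑ j : ι, κ ^ 96 * m := by
        refine Finset.sum_le_sum fun j _ => ?_
        rw [abs_mul]
        exact mul_le_mul (h.left i j) (hf j) (abs_nonneg _) (pow_nonneg h.pos.le _)
    _ = (Fintype.card ι * κ) * (κ ^ 95 * m) := by
        rw [Finset.sum_const, Finset.card_univ, nsmul_eq_mul]; ring
    _ ≤ κ ^ 95 * m := mul_le_of_le_one_left (mul_nonneg (pow_nonneg h.pos.le _) hm) h.card_mul_le

/-- The error of `B` is multiplied by `l`, and the a priori bound `|l| ≤ κ⁻⁶` reduces `κ ^ 95` to `κ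
^ 89`; one more power covers the sum of the two errors. -/
theorem abs_pencil_sub_le (h : NearDiagonal κ A B α β) {f : ι → ℝ} {m l : ℝ}
    (hf : ∀ j, |f j| ≤ m) (hl : |l| * κ ^ 6 ≤ 1) (i : ι) :
    |(A.mulVec f i - l * B.mulVec f i) - (α i - l * β i) * f i| ≤ κ ^ 88 * m := by
  have h1 := h.abs_mulVec_sub_le hf i
  have h2 := h.swap.abs_mulVec_sub_le hf i
  have hm : 0 ≤ m := (abs_nonneg _).trans (hf i)
  have h3 : (A.mulVec f i - l * B.mulVec f i) - (α i - l * β i) * f i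
      = (A.mulVec f i - α i * f i) - l * (B.mulVec f i - β i * f i) := by ring
  have h4 : |l * (B.mulVec f i - β i * f i)| ≤ |l| * (κ ^ 95 * m) := by
    rw [abs_mul]; exact mul_le_mul_of_nonneg_left h2 (abs_nonneg _)
  have h5 : |l| * (κ ^ 95 * m) ≤ κ ^ 89 * m := by
    have : |l| * (κ ^ 95 * m) = (|l| * κ ^ 6) * (κ ^ 89 * m) := by ring
    rw [this]
    exact mul_le_of_le_one_left (mul_nonneg (pow_nonneg h.pos.le _) hm) hl
  have h6 := mul_le_mul_of_nonneg_right (h.pow_succ_le (m := 88) (k := 95) (by norm_num)) hm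
  have h7 := mul_le_mul_of_nonneg_right (h.pow_succ_le (m := 88) (k := 89) (by norm_num)) hm
  have h8 : 0 ≤ κ ^ 88 * m := mul_nonneg (pow_nonneg h.pos.le _) hm
  rw [h3]
  refine (abs_sub _ _).trans ?_
  linarith

/-- `α j β k − α k β j` is a combination of the two diagonal entries of the pencil at `l` with
coefficients at most 1, so the gap prevents both from being small. -/
theorem le_abs_of_near (h : NearDiagonal κ A B α β) {l : ℝ} {k j : ι}
    (hk : |α k - l * β k| ≤ κ ^ 13) (hj : j ≠ k) : κ ^ 12 ≤ |α j - l * β j| := by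
  have h1 := h.gap j k hj
  have h2 : α j * β k - α k * β j = β k * (α j - l * β j) - β j * (α k - l * β k) := by ring
  rw [h2] at h1
  have h3 := abs_sub (β k * (α j - l * β j)) (β j * (α k - l * β k))
  rw [abs_mul, abs_mul] at h3
  have h4 : |β k| * |α j - l * β j| ≤ |α j - l * β j| :=
    mul_le_of_le_one_left (abs_nonneg _) (h.abs_right_le k)
  have h5 : |β j| * |α k - l * β k| ≤ κ ^ 13 :=
    (mul_le_of_le_one_left (abs_nonneg _) (h.abs_right_le j)).trans hk
  have h6 := h.pow_succ_le (m := 11) (k := 12) (by norm_num)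
  have h7 := h.pow_succ_le (m := 11) (k := 13) (by norm_num)
  have h8 := pow_pos h.pos 11
  linarith

/-- Null vectors of the pencil `A - l B` are concentrated on one coordinate. -/
theorem exists_concentrated (h : NearDiagonal κ A B α β) {f : ι → ℝ} {l : ℝ} (hf : f ≠ 0)
    (hl : A.mulVec f = l • B.mulVec f) :
    ∃ k, f k ≠ 0 ∧ |l| * κ ^ 6 ≤ 1 ∧ |α k - l * β k| ≤ κ ^ 88 ∧
      ∀ j ≠ k, |f j| ≤ κ ^ 76 * |f k| := by
  obtain ⟨i₀, hi₀⟩ := Function.ne_iff.1 hf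
  have : Nonempty ι := ⟨i₀⟩
  -- `k` is a largest coordinate. Row `k` of the equation makes `α k − l β k` tiny; in every other
  -- row the diagonal entry is then at least `κ ^ 12`, which makes `f j` small: 76 = 88 − 12.
  obtain ⟨k, -, hk⟩ := Finset.exists_max_image Finset.univ (fun i => |f i|) Finset.univ_nonempty
  have hk' : ∀ j, |f j| ≤ |f k| := fun j => hk j (Finset.mem_univ j)
  have hfk : 0 < |f k| := (abs_pos.2 hi₀).trans_le (hk' i₀)
  have hli : ∀ i, A.mulVec f i = l * B.mulVec f i := fun i => by rw [hl]; rfl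
  have p5 := pow_pos h.pos 5
  have p95 := h.pow_succ_le (m := 5) (k := 95) (by norm_num)
  have hA := h.abs_mulVec_sub_le hk' k
  have hB := h.swap.abs_mulVec_sub_le hk' k
  have h1 : |α k - l * β k| ≤ κ ^ 95 * (1 + |l|) := by
    refine le_of_mul_le_mul_right ?_ hfk
    rw [← abs_mul]
    have e1 : (α k - l * β k) * f k
        = l * (B.mulVec f k - β k * f k) - (A.mulVec f k - α k * f k) := by
      rw [hli k]; ring
    rw [e1]
    refine (abs_sub _ _).trans ?_
    rw [abs_mul]
    nlinarith [mul_le_mul_of_nonneg_left hB (abs_nonneg l)]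
  have hl6 : |l| * κ ^ 6 ≤ 1 := by
    have e1 : |l| * |β k| ≤ |α k| + |α k - l * β k| := by
      rw [← abs_mul]
      have := abs_sub (α k) (α k - l * β k)
      rwa [sub_sub_cancel] at this
    have e2 := mul_le_mul_of_nonneg_left (h.le_abs_right k) (abs_nonneg l)
    have e3 := h.abs_left_le k
    have e4 : κ ^ 95 ≤ 1 := pow_le_one₀ h.pos.le (by linarith [h.le])
    have e5 := mul_le_mul_of_nonneg_right p95 (abs_nonneg l)
    have e6 : |l| * κ ^ 5 ≤ 4 := by nlinarith [mul_nonneg (abs_nonneg l) p5.le]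
    have e7 : |l| * κ ^ 6 = |l| * κ ^ 5 * κ := by ring
    rw [e7]
    nlinarith [h.le, h.pos, mul_nonneg (abs_nonneg l) p5.le]
  have hrow : ∀ i, |(α i - l * β i) * f i| ≤ κ ^ 88 * |f k| := fun i => by
    have := h.abs_pencil_sub_le hk' hl6 i
    rwa [hli i, sub_self, zero_sub, abs_neg] at this
  have h88 : |α k - l * β k| ≤ κ ^ 88 := by
    refine le_of_mul_le_mul_right ?_ hfk
    rw [← abs_mul]; exact hrow k
  refine ⟨k, abs_pos.1 hfk, hl6, h88, fun j hj => ?_⟩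
  have h13 : κ ^ 88 ≤ κ ^ 13 := pow_le_pow_of_le_one h.pos.le (by linarith [h.le]) (by norm_num)
  have h12 := h.le_abs_of_near (h88.trans h13) hj
  have p12 := pow_pos h.pos 12
  refine le_of_mul_le_mul_left ?_ p12
  have := hrow j
  rw [abs_mul] at this
  calc κ ^ 12 * |f j| ≤ |α j - l * β j| * |f j| := mul_le_mul_of_nonneg_right h12 (abs_nonneg _)
    _ ≤ κ ^ 88 * |f k| := this
    _ = κ ^ 12 * (κ ^ 76 * |f k|) := by ring

/-- Two normalised null vectors concentrated on the same coordinate are equal. -/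
theorem eq_of_concentrated (h : NearDiagonal κ A B α β) {f f' : ι → ℝ} {l l' : ℝ} {k : ι}
    (hl : A.mulVec f = l • B.mulVec f) (hl' : A.mulVec f' = l' • B.mulVec f')
    (hl6 : |l| * κ ^ 6 ≤ 1) (h88 : |α k - l * β k| ≤ κ ^ 88) (hf : f k = 1) (hf' : f' k = 1)
    (hle : ∀ j, |f' j| ≤ 1) : f = f' := by
  by_contra hne
  -- `g` vanishes at `k` and satisfies `(A − lB)g = (l − l')Bf'`. Row `k` shows that `l' − l` is
  -- tiny relative to the largest entry of `g`; the row of that entry, with diagonal at least `κ ^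
  -- 12`, then gives a contradiction.
  set g := f - f' with hg
  have hg0 : g ≠ 0 := sub_ne_zero.2 hne
  obtain ⟨i₀, hi₀⟩ := Function.ne_iff.1 hg0
  have : Nonempty ι := ⟨i₀⟩
  obtain ⟨j, -, hj⟩ := Finset.exists_max_image Finset.univ (fun i => |g i|) Finset.univ_nonempty
  have hj' : ∀ i, |g i| ≤ |g j| := fun i => hj i (Finset.mem_univ i)
  have hgj : 0 < |g j| := (abs_pos.2 hi₀).trans_le (hj' i₀)
  have hgk : g k = 0 := by simp [hg, hf, hf']
  have hjk : j ≠ k := fun e => by rw [e, hgk, abs_zero] at hgj; exact lt_irrefl _ hgj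
  have hpen : ∀ i, A.mulVec g i - l * B.mulVec g i = (l' - l) * -(B.mulVec f' i) := fun i => by
    have e1 : A.mulVec f i = l * B.mulVec f i := by rw [hl]; rfl
    have e2 : A.mulVec f' i = l' * B.mulVec f' i := by rw [hl']; rfl
    rw [hg, Matrix.mulVec_sub, Matrix.mulVec_sub, Pi.sub_apply, Pi.sub_apply, e1, e2]
    ring
  have hB := h.swap.abs_mulVec_sub_le hle
  have p95 := h.pow_succ_le (m := 5) (k := 95) (by norm_num)
  have p6 := h.pow_succ_le (m := 5) (k := 6) (by norm_num)
  have pp5 := pow_pos h.pos 5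
  have p6pos := pow_pos h.pos 6
  have hBk : κ ^ 6 ≤ |B.mulVec f' k| := by
    have e1 := hB k
    rw [hf', mul_one, mul_one] at e1
    have e2 := abs_sub_abs_le_abs_sub (β k) (B.mulVec f' k)
    rw [abs_sub_comm (β k)] at e2
    linarith [h.le_abs_right k]
  have hBj : |B.mulVec f' j| ≤ 2 := by
    have e1 := hB j
    have e2 := abs_sub_abs_le_abs_sub (B.mulVec f' j) (β j * f' j)
    have e3 : |β j * f' j| ≤ 1 := by
      rw [abs_mul]; exact mul_le_one₀ (h.abs_right_le j) (abs_nonneg _) (hle j)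
    have e4 : κ ^ 95 ≤ 1 := pow_le_one₀ h.pos.le (by linarith [h.le])
    linarith
  have hdiff : |l' - l| ≤ κ ^ 82 * |g j| := by
    have e1 := h.abs_pencil_sub_le hj' hl6 k
    rw [hgk, mul_zero, sub_zero, hpen, abs_mul, abs_neg] at e1
    refine le_of_mul_le_mul_right ?_ p6pos
    calc |l' - l| * κ ^ 6 ≤ |l' - l| * |B.mulVec f' k| :=
          mul_le_mul_of_nonneg_left hBk (abs_nonneg _)
      _ ≤ κ ^ 88 * |g j| := e1
      _ = κ ^ 82 * |g j| * κ ^ 6 := by ring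
  have h13 : κ ^ 88 ≤ κ ^ 13 := pow_le_pow_of_le_one h.pos.le (by linarith [h.le]) (by norm_num)
  have h12 := h.le_abs_of_near (h88.trans h13) hjk
  have e1 := h.abs_pencil_sub_le hj' hl6 j
  rw [hpen] at e1
  have e2 := abs_sub_abs_le_abs_sub ((α j - l * β j) * g j) ((l' - l) * -(B.mulVec f' j))
  rw [abs_sub_comm, abs_mul, abs_mul, abs_neg] at e2
  have e3 : |l' - l| * |B.mulVec f' j| ≤ κ ^ 82 * |g j| * 2 :=
    mul_le_mul hdiff hBj (abs_nonneg _) (mul_nonneg (pow_pos h.pos _).le hgj.le)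
  have e4 := mul_le_mul_of_nonneg_right h12 hgj.le
  have e5 := mul_le_mul_of_nonneg_right (h.pow_succ_le (m := 12) (k := 82) (by norm_num)) hgj.le
  have e6 := mul_le_mul_of_nonneg_right (h.pow_succ_le (m := 12) (k := 88) (by norm_num)) hgj.le
  have e7 : 0 < κ ^ 12 * |g j| := mul_pos (pow_pos h.pos _) hgj
  linarith

theorem pencil_bound (h : NearDiagonal κ A B α β) {l : ℝ} {k : ι}
    (hk : |α k - l * β k| ≤ κ ^ 13) : |l| * κ ^ 6 ≤ 1 := by
  have e1 : |l| * |β k| ≤ |α k| + |α k - l * β k| := by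
    rw [← abs_mul]
    have := abs_sub (α k) (α k - l * β k)
    rwa [sub_sub_cancel] at this
  have e2 := mul_le_mul_of_nonneg_left (h.le_abs_right k) (abs_nonneg l)
  have e3 := h.abs_left_le k
  have e4 : κ ^ 13 ≤ 1 := pow_le_one₀ h.pos.le (by linarith [h.le])
  have e7 : |l| * κ ^ 6 = |l| * κ ^ 5 * κ := by ring
  rw [e7]
  nlinarith [h.le, h.pos, mul_nonneg (abs_nonneg l) (pow_pos h.pos 5).le]

/-- At distance exactly `κ ^ 13` all diagonal entries of the pencil are at least `κ ^ 13`, while the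
row sums of the perturbation are at most `2 * κ ^ 89`, so the pencil is diagonally dominant. -/
theorem det_pencil_mul_prod_pos (h : NearDiagonal κ A B α β) {l : ℝ} {k : ι}
    (hk : |α k - l * β k| = κ ^ 13) : 0 < (A - l • B).det * ∏ i, (α i - l * β i) := by
  have hl := h.pencil_bound hk.le
  set E : Matrix ι ι ℝ := A - l • B - Matrix.diagonal fun i => α i - l * β i with hE
  have h1 : A - l • B = Matrix.diagonal (fun i => α i - l * β i) + E := by rw [hE]; abel
  rw [h1]
  refine det_diagonal_add_mul_prod_pos fun i => ?_
  have hEij : ∀ j, |E i j| ≤ 2 * κ ^ 90 := fun j => by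
    have e1 : E i j = (A i j - if i = j then α i else 0)
        - l * (B i j - if i = j then β i else 0) := by
      simp only [hE, Matrix.sub_apply, Matrix.smul_apply, smul_eq_mul, Matrix.diagonal_apply]
      split_ifs <;> ring
    rw [e1]
    refine (abs_sub _ _).trans ?_
    rw [abs_mul]
    have e2 := mul_le_mul_of_nonneg_left (h.right i j) (abs_nonneg l)
    have e3 : |l| * κ ^ 96 = (|l| * κ ^ 6) * κ ^ 90 := by ring
    have e4 := mul_le_of_le_one_left (pow_pos h.pos 90).le hl
    have e5 := h.pow_succ_le (m := 90) (k := 96) (by norm_num)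
    have e6 := h.left i j
    have e7 := pow_pos h.pos 90
    linarith
  have hsum : ∑ j, |E i j| ≤ 2 * κ ^ 89 := by
    calc ∑ j, |E i j| ≤ ∑ _j : ι, 2 * κ ^ 90 := Finset.sum_le_sum fun j _ => hEij j
      _ = (Fintype.card ι * κ) * (2 * κ ^ 89) := by
          rw [Finset.sum_const, Finset.card_univ, nsmul_eq_mul]; ring
      _ ≤ 2 * κ ^ 89 := mul_le_of_le_one_left (by have := pow_pos h.pos 89; linarith) h.card_mul_le
  have e1 := h.pow_succ_le (m := 13) (k := 89) (by norm_num)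
  have e2 := pow_pos h.pos 13
  by_cases hik : i = k
  · rw [hik] at hsum ⊢; rw [hk]; linarith
  · have := h.le_abs_of_near hk.le hik
    have e3 := h.pow_succ_le (m := 12) (k := 13) (by norm_num)
    have e4 := pow_pos h.pos 12
    linarith

/-- Every quotient `α k / β k` has a root of `det (A - l B)` nearby. -/
theorem exists_det_eq_zero (h : NearDiagonal κ A B α β) (k : ι) :
    ∃ l, |α k - l * β k| ≤ κ ^ 13 ∧ (A - l • B).det = 0 := by
  have hβ : β k ≠ 0 := abs_pos.1 ((pow_pos h.pos 5).trans_le (h.le_abs_right k))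
  have p13 := pow_pos h.pos 13
  -- The parameter is `t = α k − l β k`. Between `t = −κ ^ 13` and `t = κ ^ 13` the `k`-th diagonal
  -- factor changes sign and, by the gap condition, the others do not, so the determinant changes
  -- sign.
  let l : ℝ → ℝ := fun t => (α k - t) / β k
  have hl : ∀ t, α k - l t * β k = t := fun t => by simp only [l]; field_simp; ring
  let φ : ℝ → ℝ := fun t => (A - l t • B).det
  have hφ : Continuous φ := by
    apply Continuous.matrix_det
    simp only [l]
    fun_prop
  have h1 := h.det_pencil_mul_prod_pos (l := l (κ ^ 13)) (k := k) (by rw [hl, abs_of_pos p13])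
  have h2 := h.det_pencil_mul_prod_pos (l := l (-κ ^ 13)) (k := k)
    (by rw [hl, abs_neg, abs_of_pos p13])
  have h3 : (∏ i, (α i - l (κ ^ 13) * β i)) * ∏ i, (α i - l (-κ ^ 13) * β i) < 0 := by
    rw [← Finset.prod_mul_distrib, ← Finset.mul_prod_erase Finset.univ _ (Finset.mem_univ k)]
    refine mul_neg_of_neg_of_pos ?_ (Finset.prod_pos fun j hj => ?_)
    · rw [hl, hl]; nlinarith
    · have hjk : j ≠ k := Finset.ne_of_mem_erase hj
      have e1 : ∀ t, (α j - l t * β j) = ((α j * β k - α k * β j) + t * β j) / β k := fun t => by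
        simp only [l]; field_simp; ring
      rw [e1, e1, div_mul_div_comm]
      refine div_pos ?_ (mul_self_pos.2 hβ)
      have e2 := h.gap j k hjk
      have e3 := h.abs_right_le j
      have e4 := h.pow_succ_le (m := 11) (k := 13) (by norm_num)
      have e5 := pow_pos h.pos 11
      have e6 : (κ ^ 13 * β j) ^ 2 < (α j * β k - α k * β j) ^ 2 := by
        rw [sq_lt_sq, abs_mul, abs_of_pos p13]
        nlinarith [abs_nonneg (β j)]
      nlinarith
  have h4 : φ (κ ^ 13) * φ (-κ ^ 13) < 0 := by
    by_contra! hn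
    have := mul_pos h1 h2
    have e : (A - l (κ ^ 13) • B).det * (∏ i, (α i - l (κ ^ 13) * β i)) *
        ((A - l (-κ ^ 13) • B).det * ∏ i, (α i - l (-κ ^ 13) * β i))
        = (φ (κ ^ 13) * φ (-κ ^ 13)) *
          ((∏ i, (α i - l (κ ^ 13) * β i)) * ∏ i, (α i - l (-κ ^ 13) * β i)) := by
      simp only [φ]; ring
    rw [e] at this
    exact absurd this (not_lt.2 (mul_nonpos_of_nonneg_of_nonpos hn h3.le))
  have hroot : ∃ t ∈ Set.Icc (-κ ^ 13) (κ ^ 13), φ t = 0 := by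
    have hle : -κ ^ 13 ≤ κ ^ 13 := by linarith
    rcases mul_neg_iff.1 h4 with ⟨hp, hn⟩ | ⟨hn, hp⟩
    · exact intermediate_value_Icc hle hφ.continuousOn ⟨hn.le, hp.le⟩
    · exact intermediate_value_Icc' hle hφ.continuousOn ⟨hn.le, hp.le⟩
  obtain ⟨t, ht, ht0⟩ := hroot
  exact ⟨l t, by rw [hl]; exact abs_le.2 ht, ht0⟩

theorem det_ne_zero (h : NearDiagonal κ A B α β) : A.det ≠ 0 := by
  refine det_ne_zero_of_sum_row_lt_diag fun i => ?_
  have h1 : ∑ j ∈ Finset.univ.erase i, ‖A i j‖ ≤ κ ^ 95 := by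
    calc ∑ j ∈ Finset.univ.erase i, ‖A i j‖ ≤ ∑ j ∈ Finset.univ.erase i, κ ^ 96 := by
          refine Finset.sum_le_sum fun j hj => ?_
          have := h.left i j
          rwa [if_neg (Finset.ne_of_mem_erase hj).symm, sub_zero] at this
      _ ≤ ∑ _j : ι, κ ^ 96 := Finset.sum_le_sum_of_subset_of_nonneg (Finset.erase_subset _ _)
          fun _ _ _ => (pow_pos h.pos _).le
      _ = (Fintype.card ι * κ) * κ ^ 95 := by
          rw [Finset.sum_const, Finset.card_univ, nsmul_eq_mul]; ring
      _ ≤ κ ^ 95 := mul_le_of_le_one_left (pow_pos h.pos _).le h.card_mul_le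
  have h2 := h.left i i
  rw [if_pos rfl] at h2
  have h3 := abs_sub_abs_le_abs_sub (α i) (A i i)
  rw [abs_sub_comm (α i)] at h3
  have h4 := h.le_abs_left i
  have e1 := h.pow_succ_le (m := 5) (k := 95) (by norm_num)
  have e2 := h.pow_succ_le (m := 5) (k := 96) (by norm_num)
  have e3 := pow_pos h.pos 5
  rw [Real.norm_eq_abs]
  linarith

end NearDiagonal

end Pencil

open scoped Matrix

/-! ### From eigenvectors of the `n × n` products to null vectors of the `r × r` pencil -/

section Pseudoinverse

variable {n r : ℕ} {X X' Y Y' : Matrix (Fin n) (Fin r) ℝ} {A B : Matrix (Fin r) (Fin r) ℝ}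
  {N : Matrix (Fin n) (Fin n) ℝ}

/-- Cancelling the outer factors by their one-sided inverses in `M N M = M` leaves `B (Yᵀ N X B) =
B`. No other Penrose identity is needed. -/
theorem transpose_mul_mul_mul_eq_one (hX : X'ᵀ * X = 1) (hY : Y'ᵀ * Y = 1) (hB : B.det ≠ 0)
    (hN : X * B * Yᵀ * N * (X * B * Yᵀ) = X * B * Yᵀ) : Yᵀ * N * X * B = 1 := by
  have hY' : Yᵀ * Y' = 1 := by
    have := congrArg Matrix.transpose hY
    simpa using this
  have h1 : X'ᵀ * (X * B * Yᵀ * N * (X * B * Yᵀ)) * Y' = X'ᵀ * (X * B * Yᵀ) * Y' := by rw [hN]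
  have h2 : X'ᵀ * (X * B * Yᵀ * N * (X * B * Yᵀ)) * Y'
      = (X'ᵀ * X) * (B * (Yᵀ * N * X * B)) * (Yᵀ * Y') := by simp only [Matrix.mul_assoc]
  have h3 : X'ᵀ * (X * B * Yᵀ) * Y' = (X'ᵀ * X) * B * (Yᵀ * Y') := by
    simp only [Matrix.mul_assoc]
  rw [h2, h3, hX, hY', Matrix.one_mul, Matrix.mul_one, Matrix.one_mul, Matrix.mul_one] at h1
  have hu : IsUnit B.det := isUnit_iff_ne_zero.2 hB
  calc Yᵀ * N * X * B = B⁻¹ * (B * (Yᵀ * N * X * B)) := by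
        rw [← Matrix.mul_assoc B⁻¹, Matrix.nonsing_inv_mul _ hu, Matrix.one_mul]
    _ = 1 := by rw [h1, Matrix.nonsing_inv_mul _ hu]

/-- A nonzero eigenvalue puts `u` in the range of `X`, where nothing is lost by passing to `f = Yᵀ N
u`. -/
theorem exists_pencil_of_eigenvector (hX : X'ᵀ * X = 1) (hY : Y'ᵀ * Y = 1) (hB : B.det ≠ 0)
    (hN : X * B * Yᵀ * N * (X * B * Yᵀ) = X * B * Yᵀ) {u : Fin n → ℝ} {l : ℝ} (hl : l ≠ 0)
    (hu : (X * A * Yᵀ * N) *ᵥ u = l • u) :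
    ∃ f, A *ᵥ f = l • B *ᵥ f ∧ u = X *ᵥ (B *ᵥ f) := by
  have h1 := transpose_mul_mul_mul_eq_one hX hY hB hN
  have h2 : B * (Yᵀ * N * X) = 1 := mul_eq_one_comm.1 h1
  set f := Yᵀ *ᵥ (N *ᵥ u) with hf
  have h3 : X *ᵥ (A *ᵥ f) = l • u := by
    rw [← hu, hf]; simp only [Matrix.mulVec_mulVec, Matrix.mul_assoc]
  have h4 : u = X *ᵥ (l⁻¹ • A *ᵥ f) := by
    rw [Matrix.mulVec_smul, h3, smul_smul, inv_mul_cancel₀ hl, one_smul]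
  have h5 : B *ᵥ f = l⁻¹ • A *ᵥ f := by
    conv_lhs => rw [hf, h4]
    calc B *ᵥ (Yᵀ *ᵥ (N *ᵥ (X *ᵥ (l⁻¹ • A *ᵥ f)))) = (B * (Yᵀ * N * X)) *ᵥ (l⁻¹ • A *ᵥ f) := by
          simp only [Matrix.mulVec_mulVec, Matrix.mul_assoc]
      _ = _ := by rw [h2, Matrix.one_mulVec]
  refine ⟨f, ?_, ?_⟩
  · rw [h5, smul_smul, mul_inv_cancel₀ hl, one_smul]
  · rw [h5]; exact h4

theorem eigenvector_of_pencil (hX : X'ᵀ * X = 1) (hY : Y'ᵀ * Y = 1) (hB : B.det ≠ 0)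
    (hN : X * B * Yᵀ * N * (X * B * Yᵀ) = X * B * Yᵀ) {f : Fin r → ℝ} {l : ℝ}
    (hf : A *ᵥ f = l • B *ᵥ f) : (X * A * Yᵀ * N) *ᵥ (X *ᵥ (B *ᵥ f)) = l • X *ᵥ (B *ᵥ f) := by
  have h1 := transpose_mul_mul_mul_eq_one hX hY hB hN
  calc (X * A * Yᵀ * N) *ᵥ (X *ᵥ (B *ᵥ f)) = (X * A) *ᵥ ((Yᵀ * N * X * B) *ᵥ f) := by
        simp only [Matrix.mulVec_mulVec, Matrix.mul_assoc]
    _ = X *ᵥ (A *ᵥ f) := by rw [h1, Matrix.one_mulVec, Matrix.mulVec_mulVec]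
    _ = _ := by rw [hf, Matrix.mulVec_smul]

theorem mulVec_mulVec_ne_zero (hX : X'ᵀ * X = 1) (hB : B.det ≠ 0) {f : Fin r → ℝ} (hf : f ≠ 0) :
    X *ᵥ (B *ᵥ f) ≠ 0 := by
  intro h
  have h1 : B *ᵥ f = 0 := by
    have := congrArg (fun v => X'ᵀ *ᵥ v) h
    simpa [Matrix.mulVec_mulVec, ← Matrix.mul_assoc, hX] using this
  exact hf (Matrix.eq_zero_of_mulVec_eq_zero hB h1)

end Pseudoinverse

/-! ### Existence of singular value decompositions and pseudoinverses; triviality of the truncation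
-/

section SVD

variable {n : ℕ}

/-- Every square real matrix has a singular value decomposition. -/
theorem exists_svd (M : Matrix (Fin n) (Fin n) ℝ) :
    ∃ (s : Fin n → ℝ) (p q : Fin n → Vec n), Antitone s ∧ (∀ k, 0 ≤ s k) ∧ Orthonormal ℝ p ∧
      Orthonormal ℝ q ∧ ∀ i j, M i j = ∑ k, s k * p k i * q k j := by
  classical
  set A := Matrix.toEuclideanLin M with hA
  have hn : Module.finrank ℝ (Vec n) = n := by simp
  set hs := A.isSymmetric_adjoint_comp_self
  set q := hs.eigenvectorBasis hn with hq
  let s : Fin n → ℝ := fun k => A.singularValues k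
  have hinner : ∀ j k, ⟪A (q j), A (q k)⟫ = if j = k then s k ^ 2 else 0 := fun j k => by
    have h1 : ⟪A (q j), A (q k)⟫ = ⟪q j, (LinearMap.adjoint A ∘ₗ A) (q k)⟫ := by
      rw [LinearMap.comp_apply, LinearMap.adjoint_inner_right]
    rw [h1, hs.apply_eigenvectorBasis hn k, inner_smul_right,
      orthonormal_iff_ite.1 q.orthonormal j k, ← A.sq_singularValues_fin hn k]
    simp [s]
  -- The vectors `A (q k) / s k` are orthonormal where `s k ≠ 0`; the remaining left singular
  -- vectors come from completing them to an orthonormal basis.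
  have horth : Orthonormal ℝ (({k | s k ≠ 0} : Set (Fin n)).domRestrict
      fun k => (s k)⁻¹ • A (q k)) := by
    rw [orthonormal_iff_ite]
    rintro ⟨j, hj⟩ ⟨k, hk⟩
    change ⟪(s j)⁻¹ • A (q j), (s k)⁻¹ • A (q k)⟫ = _
    simp only [inner_smul_left, inner_smul_right, hinner, Subtype.mk.injEq, conj_trivial]
    have hk : s k ≠ 0 := hk
    split_ifs with h
    · subst h; field_simp
    · simp
  obtain ⟨p, hp⟩ := horth.exists_orthonormalBasis_extension_of_card_eq (by simp)
  have hApq : ∀ k, A (q k) = s k • p k := fun k => by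
    by_cases hk : s k = 0
    · have := hinner k k
      rw [if_pos rfl, hk, real_inner_self_eq_norm_sq] at this
      rw [hk, zero_smul, ← norm_eq_zero]
      simpa using this
    · rw [hp k hk, smul_smul, mul_inv_cancel₀ hk, one_smul]
  refine ⟨s, p, q, fun i j hij => A.singularValues_antitone hij,
    fun k => A.singularValues_nonneg k, p.orthonormal, q.orthonormal, fun i j => ?_⟩
  have h1 : M i j = A (EuclideanSpace.single j 1) i := by
    simp [hA, Matrix.mulVec, dotProduct, Pi.single_apply]
  rw [h1, ← q.sum_repr (EuclideanSpace.single j 1), map_sum]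
  simp only [map_smul, hApq, WithLp.ofLp_sum, Finset.sum_apply, q.repr_apply_apply]
  refine Finset.sum_congr rfl fun k _ => ?_
  simp [EuclideanSpace.inner_single_right]
  ring

/-- For `M = P D Qᵀ` the witness is `Q E Pᵀ`, where `E` inverts `D` entrywise; the convention `0⁻¹ =
0` makes `E` the pseudoinverse of `D`. -/
theorem exists_isPseudoinverse (M : Matrix (Fin n) (Fin n) ℝ) : ∃ N, IsPseudoinverse M N := by
  obtain ⟨s, p, q, -, -, hp, hq, hM⟩ := exists_svd M
  have hpp : (colMatrix p)ᵀ * colMatrix p = 1 := transpose_colMatrix_mul (orthonormal_iff_ite.1 hp)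
  have hqq : (colMatrix q)ᵀ * colMatrix q = 1 := transpose_colMatrix_mul (orthonormal_iff_ite.1 hq)
  set Pm := colMatrix p
  set Q := colMatrix q
  set D := Matrix.diagonal s
  set E := Matrix.diagonal fun k => (s k)⁻¹
  have hMeq : M = Pm * (D * Qᵀ) := by
    ext i j
    rw [hM, Matrix.mul_apply]
    refine Finset.sum_congr rfl fun k _ => ?_
    rw [Matrix.diagonal_mul]
    change _ = p k i * (s k * q k j)
    ring
  have hDED : D * (E * D) = D := by
    simp only [D, E, Matrix.diagonal_mul_diagonal]
    congr 1; ext k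
    by_cases h : s k = 0
    · simp [h]
    · field_simp
  have hEDE : E * (D * E) = E := by
    simp only [D, E, Matrix.diagonal_mul_diagonal]
    congr 1; ext k
    by_cases h : s k = 0
    · simp [h]
    · field_simp
  have hDE : (D * E)ᵀ = D * E := by simp [D, E, Matrix.diagonal_mul_diagonal]
  have hED : (E * D)ᵀ = E * D := by simp [D, E, Matrix.diagonal_mul_diagonal]
  have hQ : ∀ Z : Matrix (Fin n) (Fin n) ℝ, Qᵀ * (Q * Z) = Z := fun Z => by
    rw [← Matrix.mul_assoc, hqq, Matrix.one_mul]
  have hP : ∀ Z : Matrix (Fin n) (Fin n) ℝ, Pmᵀ * (Pm * Z) = Z := fun Z => by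
    rw [← Matrix.mul_assoc, hpp, Matrix.one_mul]
  have hMN : M * (Q * (E * Pmᵀ)) = Pm * ((D * E) * Pmᵀ) := by
    rw [hMeq]; simp only [Matrix.mul_assoc, hQ]
  have hNM : (Q * (E * Pmᵀ)) * M = Q * ((E * D) * Qᵀ) := by
    rw [hMeq]; simp only [Matrix.mul_assoc, hP]
  refine ⟨Q * (E * Pmᵀ), ?_, ?_, ?_, ?_⟩
  · rw [hMN]; conv_lhs => rw [hMeq]
    conv_rhs => rw [hMeq]
    simp only [Matrix.mul_assoc, hP]
    rw [← Matrix.mul_assoc E, ← Matrix.mul_assoc D, hDED]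
  · rw [hNM]
    simp only [Matrix.mul_assoc, hQ]
    rw [← Matrix.mul_assoc D, ← Matrix.mul_assoc E, hEDE]
  · rw [hMN, Matrix.transpose_mul, Matrix.transpose_mul, hDE, Matrix.transpose_transpose,
      Matrix.mul_assoc]
  · rw [hNM, Matrix.transpose_mul, Matrix.transpose_mul, hED, Matrix.transpose_transpose,
      Matrix.mul_assoc]

/-- A matrix of rank at most `r` is the sum of its top `r` components. -/
theorem IsTopComponents.eq_of_eq_mul {r : ℕ} {M N : Matrix (Fin n) (Fin n) ℝ}
    (h : IsTopComponents r M N) {x : Fin r → Vec n} {C : Matrix (Fin r) (Fin n) ℝ}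
    (hM : M = colMatrix x * C) : N = M := by
  obtain ⟨s, p, q, hs, hs0, hp, hq, hMs, hN⟩ := h
  have hzero : ∀ k : Fin n, ¬ k.val < r → s k = 0 := by
    intro k hk
    by_contra hne
    have hpos : 0 < s k := lt_of_le_of_ne (hs0 k) (Ne.symm hne)
    -- Indices start at 0, so a nonzero singular value at some `k ≥ r` makes the first `r + 1` of
    -- them positive. The corresponding `r + 1` orthonormal vectors would all lie in a column space
    -- spanned by `r` vectors.
    let emb : Fin (r + 1) → Fin n := fun j => ⟨j.val, by have := j.2; have := k.2; omega⟩
    have hemb : Function.Injective emb := fun a b hab => by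
      simpa [emb, Fin.ext_iff] using hab
    have hmem : ∀ j, p (emb j) ∈ spanOf x := fun j => by
      have hsj : 0 < s (emb j) := hpos.trans_le (hs (by
        rw [Fin.le_def]; have := j.2; simp only [emb]; omega))
      have h1 : p (emb j) = (s (emb j))⁻¹ • ∑ i, (C *ᵥ q (emb j)) i • x i := by
        rw [← toLp_colMatrix_mulVec, Matrix.mulVec_mulVec, ← hM, eq_inv_smul_iff₀ hsj.ne']
        ext a
        simp only [PiLp.smul_apply, smul_eq_mul, Matrix.mulVec, dotProduct, hMs, Finset.sum_mul]
        rw [Finset.sum_comm]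
        have h2 : ∀ l, ∑ b, s l * p l a * q l b * q (emb j) b
            = if l = emb j then s l * p l a else 0 := fun l => by
          have := orthonormal_iff_ite.1 hq l (emb j)
          rw [PiLp.inner_apply] at this
          simp only [RCLike.inner_apply, conj_trivial] at this
          have h3 : ∑ b, s l * p l a * q l b * q (emb j) b
              = s l * p l a * ∑ b, q (emb j) b * q l b := by
            rw [Finset.mul_sum]; exact Finset.sum_congr rfl fun b _ => by ring
          rw [h3, this]; simp
        simp [h2]
      rw [h1]
      exact Submodule.smul_mem _ _ (sum_smul_mem_spanOf _)
    have hli : LinearIndependent ℝ fun j => (⟨p (emb j), hmem j⟩ : spanOf x) := by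
      have : LinearIndependent ℝ fun j => p (emb j) := hp.linearIndependent.comp emb hemb
      exact LinearIndependent.of_comp (spanOf x).subtype this
    have h1 := hli.fintype_card_le_finrank
    have h2 : Module.finrank ℝ (spanOf x) ≤ r := by
      have := finrank_range_le_card (R := ℝ) x
      rwa [Fintype.card_fin] at this
    rw [Fintype.card_fin] at h1
    omega
  ext i j
  rw [hN, hMs]
  refine Finset.sum_congr rfl fun k _ => ?_
  split_ifs with hk
  · rfl
  · rw [hzero k hk]; ring

theorem isTopComponents_self {r : ℕ} {M : Matrix (Fin n) (Fin n) ℝ} {x : Fin r → Vec n}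
    {C : Matrix (Fin r) (Fin n) ℝ} (hM : M = colMatrix x * C) : IsTopComponents r M M := by
  obtain ⟨s, p, q, h1, h2, h3, h4, h5⟩ := exists_svd M
  have h : IsTopComponents r M (Matrix.of fun i j =>
      ∑ k : Fin n, if k.val < r then s k * p k i * q k j else 0) :=
    ⟨s, p, q, h1, h2, h3, h4, h5, fun i j => rfl⟩
  rwa [h.eq_of_eq_mul hM] at h

end SVD

/-! ### Normalised eigenvectors and the pairing of eigenvalues -/

namespace NearDiagonal

variable {ι : Type*} [Fintype ι] [DecidableEq ι] {κ : ℝ} {A B : Matrix ι ι ℝ} {α β : ι → ℝ}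

theorem right_ne_zero (h : NearDiagonal κ A B α β) (k : ι) : β k ≠ 0 :=
  abs_pos.1 ((pow_pos h.pos 5).trans_le (h.le_abs_right k))

/-- The image under `B` of a concentrated vector is close to a multiple of a basis vector. -/
theorem abs_normalized_sub_le (h : NearDiagonal κ A B α β) {f : ι → ℝ} {k : ι} (hk : f k ≠ 0)
    (hf : ∀ j ≠ k, |f j| ≤ κ ^ 76 * |f k|) (i : ι) :
    |(f k * β k)⁻¹ * (B *ᵥ f) i - if i = k then 1 else 0| ≤ κ ^ 70 := by
  have hfk : 0 < |f k| := abs_pos.2 hk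
  have h76 : κ ^ 76 ≤ 1 := pow_le_one₀ h.pos.le (by linarith [h.le])
  have hle : ∀ j, |f j| ≤ |f k| := fun j => by
    by_cases hj : j = k
    · rw [hj]
    · exact (hf j hj).trans (mul_le_of_le_one_left hfk.le h76)
  have hB := h.swap.abs_mulVec_sub_le hle i
  have hβ := h.le_abs_right k
  have hβ0 := h.right_ne_zero k
  have p5 := pow_pos h.pos 5
  have hden : 0 < |f k * β k| := abs_pos.2 (mul_ne_zero hk hβ0)
  have h1 : (f k * β k)⁻¹ * (B *ᵥ f) i - (if i = k then 1 else 0)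
      = ((B *ᵥ f) i - if i = k then f k * β k else 0) / (f k * β k) := by
    split_ifs
    · field_simp
    · rw [sub_zero, sub_zero, div_eq_inv_mul]
  have h2 : |(B *ᵥ f) i - if i = k then f k * β k else 0| ≤ κ ^ 95 * |f k| + κ ^ 76 * |f k| := by
    split_ifs with hik
    · rw [hik] at hB ⊢
      rw [mul_comm (f k)]
      have : 0 ≤ κ ^ 76 * |f k| := mul_nonneg (pow_pos h.pos _).le hfk.le
      linarith
    · have e1 := abs_sub_abs_le_abs_sub ((B *ᵥ f) i) (β i * f i)
      have e2 : |β i * f i| ≤ κ ^ 76 * |f k| := by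
        rw [abs_mul]
        exact (mul_le_of_le_one_left (abs_nonneg _) (h.abs_right_le i)).trans (hf i hik)
      rw [sub_zero]
      linarith
  rw [h1, abs_div, div_le_iff₀ hden, abs_mul]
  have e1 : κ ^ 75 * |f k| ≤ κ ^ 70 * (|f k| * |β k|) := by
    have : κ ^ 70 * |f k| * κ ^ 5 ≤ κ ^ 70 * |f k| * |β k| :=
      mul_le_mul_of_nonneg_left hβ (mul_nonneg (pow_pos h.pos _).le hfk.le)
    calc κ ^ 75 * |f k| = κ ^ 70 * |f k| * κ ^ 5 := by ring
      _ ≤ _ := this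
      _ = _ := by ring
  have e2 := mul_le_mul_of_nonneg_right (h.pow_succ_le (m := 75) (k := 76) (by norm_num)) hfk.le
  have e3 := mul_le_mul_of_nonneg_right (h.pow_succ_le (m := 75) (k := 95) (by norm_num)) hfk.le
  have e4 : 0 < κ ^ 75 * |f k| := mul_pos (pow_pos h.pos _) hfk
  linarith

/-- Perturbed products of diagonal entries. -/
theorem abs_mul_sub_le (h : NearDiagonal κ A B α β) {l ν : ℝ} {k j : ι}
    (hl : |α k - l * β k| ≤ κ ^ 88) (hν : |β j - ν * α j| ≤ κ ^ 88) :
    |(l * ν - 1) * (β k * α j) - (α k * β j - α j * β k)| ≤ κ ^ 87 := by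
  set e := α k - l * β k
  set e' := β j - ν * α j
  -- Here `l β k = α k − e` and `ν α j = β j − e'`, so `lν · β k α j = (α k − e)(β j − e')`.
  have h1 : (l * ν - 1) * (β k * α j) - (α k * β j - α j * β k)
      = e * e' - (α k * e' + e * β j) := by simp only [e, e']; ring
  rw [h1]
  have p88 := pow_pos h.pos 88
  have h2 : |e * e'| ≤ κ ^ 88 := by
    rw [abs_mul]
    have : |e'| ≤ 1 := hν.trans (pow_le_one₀ h.pos.le (by linarith [h.le]))
    nlinarith [abs_nonneg e, abs_nonneg e']
  have h3 : |α k * e'| ≤ κ ^ 88 := by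
    rw [abs_mul]; exact (mul_le_of_le_one_left (abs_nonneg _) (h.abs_left_le k)).trans hν
  have h4 : |e * β j| ≤ κ ^ 88 := by
    rw [abs_mul]; exact (mul_le_of_le_one_right (abs_nonneg _) (h.abs_right_le j)).trans hl
  have h5 := h.pow_succ_le (m := 87) (k := 88) (by norm_num)
  have h6 := abs_sub (e * e') (α k * e' + e * β j)
  have h7 := abs_add_le (α k * e') (e * β j)
  have p87 := pow_pos h.pos 87
  linarith

/-- Pairing the eigenvalues so that they are as nearly reciprocal as possible pairs those that
belong to the same coordinate. -/
theorem pairing_eq (h : NearDiagonal κ A B α β) {eu ev : ι → ℝ} {π ρ : ι → ι}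
    (hπ : Function.Injective π) (hρ : Function.Injective ρ)
    (hu : ∀ i, |α (π i) - eu i * β (π i)| ≤ κ ^ 88)
    (hv : ∀ i, |β (ρ i) - ev i * α (ρ i)| ≤ κ ^ 88)
    (hmin : ∀ τ : Equiv.Perm ι, ∑ i, |eu i * ev i - 1| ≤ ∑ i, |eu i * ev (τ i) - 1|) : π = ρ := by
  have hπ' := Finite.injective_iff_bijective.1 hπ
  have hρ' := Finite.injective_iff_bijective.1 hρ
  -- `τ` pairs by coordinate and has cost at most `κ ^ 76`, so by minimality the actual pairing
  -- costs no more. A pair with different coordinates would then have a minor of size at most `κ ^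
  -- 76 + κ ^ 87`, below the gap.
  set τ : Equiv.Perm ι := (Equiv.ofBijective π hπ').trans (Equiv.ofBijective ρ hρ').symm
  have hτ : ∀ i, ρ (τ i) = π i := fun i =>
    (Equiv.ofBijective ρ hρ').apply_symm_apply (π i)
  have hsmall : ∀ i, |eu i * ev (τ i) - 1| ≤ κ ^ 77 := fun i => by
    have e1 := hv (τ i)
    rw [hτ] at e1
    have e2 := h.abs_mul_sub_le (hu i) e1
    rw [sub_self, sub_zero, abs_mul, abs_mul] at e2
    have e3 : κ ^ 10 ≤ |β (π i)| * |α (π i)| := by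
      calc κ ^ 10 = κ ^ 5 * κ ^ 5 := by ring
        _ ≤ _ := mul_le_mul (h.le_abs_right _) (h.le_abs_left _) (pow_pos h.pos _).le (abs_nonneg _)
    refine le_of_mul_le_mul_right ?_ (pow_pos h.pos 10)
    calc |eu i * ev (τ i) - 1| * κ ^ 10 ≤ |eu i * ev (τ i) - 1| * (|β (π i)| * |α (π i)|) :=
          mul_le_mul_of_nonneg_left e3 (abs_nonneg _)
      _ ≤ κ ^ 87 := e2
      _ = κ ^ 77 * κ ^ 10 := by ring
  have hsum : ∑ i, |eu i * ev i - 1| ≤ κ ^ 76 := by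
    calc _ ≤ ∑ i, |eu i * ev (τ i) - 1| := hmin τ
      _ ≤ ∑ _i : ι, κ ^ 77 := Finset.sum_le_sum fun i _ => hsmall i
      _ = (Fintype.card ι * κ) * κ ^ 76 := by
          rw [Finset.sum_const, Finset.card_univ, nsmul_eq_mul]; ring
      _ ≤ κ ^ 76 := mul_le_of_le_one_left (pow_pos h.pos _).le h.card_mul_le
  funext i
  by_contra hne
  have e1 : |eu i * ev i - 1| ≤ κ ^ 76 :=
    (Finset.single_le_sum (f := fun i => |eu i * ev i - 1|) (fun i _ => abs_nonneg _)
      (Finset.mem_univ i)).trans hsum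
  have e2 := h.abs_mul_sub_le (hu i) (hv i)
  have e3 := h.gap (π i) (ρ i) hne
  have e4 := abs_sub_abs_le_abs_sub (α (π i) * β (ρ i) - α (ρ i) * β (π i))
    ((eu i * ev i - 1) * (β (π i) * α (ρ i)))
  rw [abs_sub_comm] at e2
  have e5 : |(eu i * ev i - 1) * (β (π i) * α (ρ i))| ≤ κ ^ 76 := by
    rw [abs_mul, abs_mul]
    exact (mul_le_of_le_one_right (abs_nonneg _) (mul_le_one₀ (h.abs_right_le _) (abs_nonneg _)
      (h.abs_left_le _))).trans e1
  have e6 := h.pow_succ_le (m := 11) (k := 76) (by norm_num)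
  have e7 := h.pow_succ_le (m := 11) (k := 87) (by norm_num)
  have e8 := pow_pos h.pos 11
  linarith

/-- Null vectors concentrated on the same coordinate are proportional. -/
theorem smul_eq_smul_of_concentrated (h : NearDiagonal κ A B α β) {f f' : ι → ℝ} {l l' : ℝ} {k : ι}
    (hl : A *ᵥ f = l • B *ᵥ f) (hl' : A *ᵥ f' = l' • B *ᵥ f')
    (hl6 : |l| * κ ^ 6 ≤ 1) (h88 : |α k - l * β k| ≤ κ ^ 88) (hf : f k ≠ 0) (hf' : f' k ≠ 0)
    (hle : ∀ j ≠ k, |f' j| ≤ κ ^ 76 * |f' k|) : (f' k) • f = (f k) • f' := by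
  have h1 := h.eq_of_concentrated (f := (f k)⁻¹ • f) (f' := (f' k)⁻¹ • f') (l := l) (l' := l')
    (k := k) (by rw [Matrix.mulVec_smul, Matrix.mulVec_smul, hl, smul_comm])
    (by rw [Matrix.mulVec_smul, Matrix.mulVec_smul, hl', smul_comm]) hl6 h88 (by simp [hf])
    (by simp [hf']) (fun j => by
      rw [Pi.smul_apply, smul_eq_mul, abs_mul, abs_inv, inv_mul_le_iff₀ (abs_pos.2 hf'), mul_one]
      by_cases hj : j = k
      · rw [hj]
      · exact (hle j hj).trans (mul_le_of_le_one_left (abs_nonneg _)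
          (pow_le_one₀ h.pos.le (by linarith [h.le]))))
  calc (f' k) • f = (f' k * f k) • ((f k)⁻¹ • f) := by
        rw [smul_smul, mul_assoc, mul_inv_cancel₀ hf, mul_one]
    _ = (f' k * f k) • ((f' k)⁻¹ • f') := by rw [h1]
    _ = (f k) • f' := by rw [smul_smul, mul_comm (f' k), mul_assoc, mul_inv_cancel₀ hf', mul_one]

end NearDiagonal

/-! ### Eigenvectors approximate the hidden factors -/

section Recovery

variable {n r : ℕ} {κ : ℝ} {A B : Matrix (Fin r) (Fin r) ℝ} {α β : Fin r → ℝ}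

theorem NearDiagonal.norm_sum_sub_le (h : NearDiagonal κ A B α β) {x xt : Fin r → Vec n}
    (hxt : ∀ i, ‖xt i‖ ≤ 1) (hx : ∀ i, ‖xt i - x i‖ ≤ κ ^ 100) {g : Fin r → ℝ} {k : Fin r}
    (hg : ∀ i, |g i - if i = k then 1 else 0| ≤ κ ^ 70) :
    ‖∑ i, g i • xt i - x k‖ ≤ κ ^ 68 := by
  have h1 : ∑ i, g i • xt i - x k = ∑ i, (g i - if i = k then 1 else 0) • xt i + (xt k - x k) := by
    simp [sub_smul, Finset.sum_sub_distrib]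
  have h2 : ‖∑ i, (g i - if i = k then 1 else 0) • xt i‖ ≤ κ ^ 69 := by
    calc _ ≤ ∑ i, ‖(g i - if i = k then 1 else 0) • xt i‖ := norm_sum_le _ _
      _ ≤ ∑ _i : Fin r, κ ^ 70 := Finset.sum_le_sum fun i _ => by
          rw [norm_smul, Real.norm_eq_abs]
          exact (mul_le_of_le_one_right (abs_nonneg _) (hxt i)).trans (hg i)
      _ = (Fintype.card (Fin r) * κ) * κ ^ 69 := by
          rw [Finset.sum_const, Finset.card_univ, nsmul_eq_mul]; ring
      _ ≤ κ ^ 69 := mul_le_of_le_one_left (pow_pos h.pos _).le h.card_mul_le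
  rw [h1]
  refine (norm_add_le _ _).trans ?_
  have e1 := h.pow_succ_le (m := 68) (k := 69) (by norm_num)
  have e2 := h.pow_succ_le (m := 68) (k := 100) (by norm_num)
  have e3 := pow_pos h.pos 68
  linarith [hx k]

/-- Eigenvectors of a product of the form `(X A Yᵀ) (X B Yᵀ)⁺` approximate the columns of `X`. -/
theorem NearDiagonal.exists_recovery (h : NearDiagonal κ A B α β) {x xt xt' yt yt' : Fin r → Vec n}
    (hxt : ∀ i, ‖xt i‖ ≤ 1) (hx : ∀ i, ‖xt i - x i‖ ≤ κ ^ 100)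
    (hxd : ∀ i j, ⟪xt' i, xt j⟫ = if i = j then 1 else 0)
    (hyd : ∀ i j, ⟪yt' i, yt j⟫ = if i = j then 1 else 0) {s : ℝ} (hs : s ≠ 0)
    {N : Matrix (Fin n) (Fin n) ℝ}
    (hN : colMatrix xt * (s • B) * (colMatrix yt)ᵀ * N * (colMatrix xt * (s • B) * (colMatrix yt)ᵀ)
      = colMatrix xt * (s • B) * (colMatrix yt)ᵀ) {u : Fin r → Vec n} {eu : Fin r → ℝ}
    (hu : IsEigensystem (colMatrix xt * (s • A) * (colMatrix yt)ᵀ * N) u eu) :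
    ∃ (π : Fin r → Fin r) (t : Fin r → ℝ), Function.Injective π ∧ (∀ i, t i ≠ 0) ∧
      (∀ i, |α (π i) - eu i * β (π i)| ≤ κ ^ 88) ∧ ∀ i, ‖t i • u i - x (π i)‖ ≤ κ ^ 68 := by
  obtain ⟨hli, heu, hev⟩ := hu
  have hX := transpose_colMatrix_mul hxd
  have hY := transpose_colMatrix_mul hyd
  have hB : (s • B).det ≠ 0 := by
    rw [Matrix.det_smul]; exact mul_ne_zero (pow_ne_zero _ hs) h.swap.det_ne_zero
  have key : ∀ i, ∃ f, A *ᵥ f = eu i • B *ᵥ f ∧ u i = ∑ j, (B *ᵥ f) j • xt j := fun i => by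
    have h1 : (colMatrix xt * (s • A) * (colMatrix yt)ᵀ * N) *ᵥ (u i).ofLp = eu i • (u i).ofLp :=
      congrArg WithLp.ofLp (hev i)
    obtain ⟨f, hf, huf⟩ := exists_pencil_of_eigenvector hX hY hB hN (heu i) h1
    -- The scale `s` moves from the matrices into the null vector, so that the pencil is that of the
    -- normalised `A` and `B`.
    refine ⟨s • f, ?_, ?_⟩
    · rw [Matrix.mulVec_smul, Matrix.mulVec_smul, ← Matrix.smul_mulVec, hf, Matrix.smul_mulVec]
    · rw [← toLp_colMatrix_mulVec, Matrix.mulVec_smul, ← Matrix.smul_mulVec, ← huf]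
  choose f hf huf using key
  have hf0 : ∀ i, f i ≠ 0 := fun i h0 => hli.ne_zero i (by rw [huf i, h0]; simp)
  choose π hπ hl6 h88 hconc using fun i => h.exists_concentrated (hf0 i) (hf i)
  refine ⟨π, fun i => (f i (π i) * β (π i))⁻¹, fun i j hij => ?_, fun i =>
    inv_ne_zero (mul_ne_zero (hπ i) (h.right_ne_zero _)), h88, fun i => ?_⟩
  -- Two eigenvectors attached to the same coordinate have proportional null vectors, hence are
  -- proportional, against linear independence.
  · by_contra hne
    have h1 := h.smul_eq_smul_of_concentrated (hf i) (hf j) (hl6 i) (h88 i) (hπ i)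
      (by rw [hij]; exact hπ j) (by rw [hij]; exact hconc j)
    have h2 : f j (π i) • u i = f i (π i) • u j := by
      rw [huf i, huf j, Finset.smul_sum, Finset.smul_sum]
      refine Finset.sum_congr rfl fun l _ => ?_
      have h4 : f j (π i) • B *ᵥ f i = f i (π i) • B *ᵥ f j := by
        rw [← Matrix.mulVec_smul, h1, Matrix.mulVec_smul]
      rw [smul_smul, smul_smul]
      exact congrArg (· • xt l) (congrFun h4 l)
    have h3 := linearIndependent_iff'.1 hli {i, j}
      (fun k => if k = i then f j (π i) else -f i (π i)) (by
        rw [Finset.sum_pair hne, if_pos rfl, if_neg (Ne.symm hne), neg_smul, h2, add_neg_cancel])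
      j (by simp)
    rw [if_neg (Ne.symm hne)] at h3
    exact hπ i (neg_eq_zero.1 h3)
  · rw [huf i, Finset.smul_sum]
    simp only [smul_smul]
    exact h.norm_sum_sub_le hxt hx (h.abs_normalized_sub_le (hπ i) (hconc i))

/-- Existence of the eigenvectors used by Jennrich's algorithm. -/
theorem NearDiagonal.exists_eigensystem (h : NearDiagonal κ A B α β) {xt xt' yt yt' : Fin r → Vec n}
    (hxd : ∀ i j, ⟪xt' i, xt j⟫ = if i = j then 1 else 0)
    (hyd : ∀ i j, ⟪yt' i, yt j⟫ = if i = j then 1 else 0) {s : ℝ} (hs : s ≠ 0)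
    {N : Matrix (Fin n) (Fin n) ℝ}
    (hN : colMatrix xt * (s • B) * (colMatrix yt)ᵀ * N * (colMatrix xt * (s • B) * (colMatrix yt)ᵀ)
      = colMatrix xt * (s • B) * (colMatrix yt)ᵀ) {l : Fin r → ℝ} (hl : ∀ k, l k ≠ 0)
    (hinj : Function.Injective l) (hdet : ∀ k, (A - l k • B).det = 0) :
    ∃ u, IsEigensystem (colMatrix xt * (s • A) * (colMatrix yt)ᵀ * N) u l := by
  have hX := transpose_colMatrix_mul hxd
  have hY := transpose_colMatrix_mul hyd
  have hB : (s • B).det ≠ 0 := by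
    rw [Matrix.det_smul]; exact mul_ne_zero (pow_ne_zero _ hs) h.swap.det_ne_zero
  choose f hf0 hf using fun k => Matrix.exists_mulVec_eq_zero_iff.2 (hdet k)
  have hf' : ∀ k, (s • A) *ᵥ f k = l k • (s • B) *ᵥ f k := fun k => by
    have h1 := hf k
    rw [Matrix.sub_mulVec, sub_eq_zero] at h1
    rw [Matrix.smul_mulVec, h1, Matrix.smul_mulVec, Matrix.smul_mulVec, smul_comm]
  set u : Fin r → Vec n := fun k => WithLp.toLp 2 (colMatrix xt *ᵥ ((s • B) *ᵥ f k)) with hu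
  have hev : ∀ k, Matrix.toEuclideanLin (colMatrix xt * (s • A) * (colMatrix yt)ᵀ * N) (u k)
      = l k • u k := fun k =>
    congrArg (WithLp.toLp 2) (eigenvector_of_pencil hX hY hB hN (hf' k))
  have hu0 : ∀ k, u k ≠ 0 := fun k h0 => by
    have := congrArg WithLp.ofLp h0
    exact mulVec_mulVec_ne_zero hX hB (hf0 k) this
  refine ⟨u, ?_, hl, hev⟩
  refine Module.End.eigenvectors_linearIndependent'
    (Matrix.toEuclideanLin (colMatrix xt * (s • A) * (colMatrix yt)ᵀ * N)) l hinj u fun k => ?_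
  exact ⟨Module.End.mem_eigenspace_iff.2 (hev k), hu0 k⟩

end Recovery

/-! ### Deterministic analysis of Jennrich's algorithm -/

/-- The deterministic conditions under which Jennrich's algorithm on `T'` recovers the components
of `∑ σᵢ (xᵢ ⊗ yᵢ ⊗ zᵢ)`. -/
structure JennrichSetup {n r : ℕ} (κ s c : ℝ) (σ : Fin r → ℝ) (x y z : Fin r → Vec n)
    (U V W : Submodule ℝ (Vec n)) (T' : Tensor n) (a b : Vec n) : Prop where
  pos : 0 < κ
  le : κ ≤ 1 / 1000
  card_mul_le : r * κ ≤ 1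
  two_mul_le : 2 * κ ≤ c
  scale_pos : 0 < s
  weight_le : ∀ i, σ i ≤ s
  le_weight : ∀ i, κ * s ≤ σ i
  robust_x : Robust c x
  robust_y : Robust c y
  norm_x : ∀ i, ‖x i‖ = 1
  norm_y : ∀ i, ‖y i‖ = 1
  norm_z : ∀ i, ‖z i‖ = 1
  finrank_U : Module.finrank ℝ U = r
  finrank_V : Module.finrank ℝ V = r
  angle_U : sinAngle (spanOf x) U ≤ κ ^ 100
  angle_V : sinAngle (spanOf y) V ≤ κ ^ 100
  mem : T' ∈ tensorSubspace U V W
  close : ‖T' - cpTensor σ x y z‖ ≤ s * κ ^ 98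
  norm_a : ‖a‖ = 1
  norm_b : ‖b‖ = 1
  le_inner_a : ∀ i, κ ^ 4 ≤ |⟪z i, a⟫|
  le_inner_b : ∀ i, κ ^ 4 ≤ |⟪z i, b⟫|
  gap : ∀ i j, i ≠ j → κ ^ 9 ≤ |⟪z i, a⟫ * ⟪z j, b⟫ - ⟪z j, a⟫ * ⟪z i, b⟫|

theorem norm_starProjection_sub_le {n r : ℕ} {x : Fin r → Vec n} {V : Submodule ℝ (Vec n)} {δ : ℝ}
    (h : sinAngle (spanOf x) V ≤ δ) {i : Fin r} (hx : ‖x i‖ = 1) :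
    ‖V.starProjection (x i) - x i‖ ≤ δ := by
  have := norm_sub_starProjection_le h (Submodule.subset_span ⟨i, rfl⟩ : x i ∈ spanOf x)
  rwa [hx, mul_one, norm_sub_rev] at this

theorem norm_starProjection_le_one {n : ℕ} {V : Submodule ℝ (Vec n)} {v : Vec n} (hv : ‖v‖ = 1) :
    ‖V.starProjection v‖ ≤ 1 := by
  have := V.norm_starProjection_apply_le v
  rwa [hv] at this

/-- The dual vectors can be taken in `V`, and there pairing with `x j` or with its projection is the
same. One family thus serves both for expanding `T'` and for isolating the components of the hidden
tensor. -/
theorem robust_exists_dual_projection {n r : ℕ} {x : Fin r → Vec n} {V : Submodule ℝ (Vec n)}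
    {c δ : ℝ} (hc : 0 < c) (hδ : δ ≤ 1 / 2) (hx : Robust c x) (h : sinAngle (spanOf x) V ≤ δ)
    (hV : Module.finrank ℝ V = r) :
    ∃ x' : Fin r → Vec n, (∀ i, ‖x' i‖ ≤ (c / 2)⁻¹) ∧
      (∀ i j, ⟪x' i, V.starProjection (x j)⟫ = if i = j then 1 else 0) ∧
      ∀ i j, ⟪x' i, x j⟫ = if i = j then 1 else 0 := by
  obtain ⟨x', hmem, hn, hd⟩ := (robust_starProjection hδ hx h).exists_dual (half_pos hc)
  rw [spanOf_starProjection_eq hc hδ hx h hV] at hmem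
  refine ⟨x', hn, hd, fun i j => ?_⟩
  rw [← hd i j]
  have h1 := Submodule.inner_right_of_mem_orthogonal (hmem i)
    (V.sub_starProjection_mem_orthogonal (x j))
  rw [inner_sub_right] at h1
  linarith

theorem contractTwo_cpTensor {n r : ℕ} {σ : Fin r → ℝ} {x y z x' y' : Fin r → Vec n}
    (hx : ∀ i j, ⟪x' i, x j⟫ = if i = j then 1 else 0)
    (hy : ∀ i j, ⟪y' i, y j⟫ = if i = j then 1 else 0) (i j : Fin r) :
    contractTwo (cpTensor σ x y z) (x' i) (y' j) = if i = j then σ i • z i else 0 := by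
  simp only [cpTensor, contractTwo_sum, contractTwo_smul, contractTwo_outer, hx, hy]
  rw [Finset.sum_eq_single i]
  · by_cases h : i = j
    · simp [h]
    · simp [h, Ne.symm h]
  · intro l _ hl
    simp [Ne.symm hl]
  · simp

namespace JennrichSetup

variable {n r : ℕ} {κ s c : ℝ} {σ : Fin r → ℝ} {x y z : Fin r → Vec n}
  {U V W : Submodule ℝ (Vec n)} {T' : Tensor n} {a b : Vec n}

theorem pow_succ_le (h : JennrichSetup κ s c σ x y z U V W T' a b) {m k : ℕ} (hmk : m < k) :
    κ ^ k ≤ κ ^ m / 1000 := by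
  have h1 : κ ^ k ≤ κ ^ (m + 1) := pow_le_pow_of_le_one h.pos.le (by linarith [h.le]) hmk
  have := pow_pos h.pos m
  rw [pow_succ] at h1
  nlinarith [h.le]

theorem weight_pos (h : JennrichSetup κ s c σ x y z U V W T' a b) (i : Fin r) : 0 < σ i :=
  (mul_pos h.pos h.scale_pos).trans_le (h.le_weight i)

/-- The two contractions of `T'` in approximately diagonalising coordinates. -/
theorem exists_factorization (h : JennrichSetup κ s c σ x y z U V W T' a b) :
    ∃ (xt xt' yt yt' : Fin r → Vec n) (A B : Matrix (Fin r) (Fin r) ℝ) (α β : Fin r → ℝ),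
      NearDiagonal κ A B α β ∧ (∀ i, ‖xt i‖ ≤ 1) ∧ (∀ i, ‖yt i‖ ≤ 1) ∧
      (∀ i, ‖xt i - x i‖ ≤ κ ^ 100) ∧ (∀ i, ‖yt i - y i‖ ≤ κ ^ 100) ∧
      (∀ i j, ⟪xt' i, xt j⟫ = if i = j then 1 else 0) ∧
      (∀ i j, ⟪yt' i, yt j⟫ = if i = j then 1 else 0) ∧
      contract T' a = colMatrix xt * (s • A) * (colMatrix yt)ᵀ ∧
      contract T' b = colMatrix xt * (s • B) * (colMatrix yt)ᵀ := by
  have hc : 0 < c := by linarith [h.pos, h.two_mul_le]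
  have hδ : κ ^ 100 ≤ 1 / 2 := by
    have := h.pow_succ_le (m := 0) (k := 100) (by norm_num)
    rw [pow_zero] at this; linarith
  obtain ⟨xt', hxn, hxd, hxd'⟩ :=
    robust_exists_dual_projection hc hδ h.robust_x h.angle_U h.finrank_U
  obtain ⟨yt', hyn, hyd, hyd'⟩ :=
    robust_exists_dual_projection hc hδ h.robust_y h.angle_V h.finrank_V
  set xt : Fin r → Vec n := fun i => U.starProjection (x i) with hxt
  set yt : Fin r → Vec n := fun i => V.starProjection (y i) with hyt
  have hT' : T' ∈ tensorSubspace (spanOf xt) (spanOf yt) W := by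
    rw [spanOf_starProjection_eq hc hδ h.robust_x h.angle_U h.finrank_U,
      spanOf_starProjection_eq hc hδ h.robust_y h.angle_V h.finrank_V]
    exact h.mem
  have hexp := tensorSubspace_expansion hxd hyd hT'
  set w : Fin r → Fin r → Vec n := fun i j => contractTwo T' (xt' i) (yt' j) with hw
  have hinv : (c / 2)⁻¹ ≤ κ⁻¹ := inv_anti₀ h.pos (by linarith [h.two_mul_le])
  -- Each dual vector has norm at most `κ⁻¹`, so the contraction turns the error `κ ^ 98` into `κ ^
  -- 96`.
  have hwn : ∀ i j, ‖w i j - if i = j then σ i • z i else 0‖ ≤ s * κ ^ 96 := fun i j => by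
    rw [hw, ← contractTwo_cpTensor hxd' hyd' i j, ← contractTwo_sub]
    refine (norm_contractTwo_le _ _ _).trans ?_
    have e1 : ‖xt' i‖ * ‖yt' j‖ ≤ κ⁻¹ * κ⁻¹ :=
      mul_le_mul ((hxn i).trans hinv) ((hyn j).trans hinv) (norm_nonneg _)
        (inv_nonneg.2 h.pos.le)
    calc _ ≤ s * κ ^ 98 * (κ⁻¹ * κ⁻¹) := mul_le_mul h.close e1 (by positivity)
          (mul_nonneg h.scale_pos.le (pow_pos h.pos _).le)
      _ = s * κ ^ 96 := by have := h.pos.ne'; field_simp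
  have hent : ∀ d : Vec n, ‖d‖ = 1 → ∀ i j,
      |s⁻¹ * ⟪w i j, d⟫ - if i = j then s⁻¹ * σ i * ⟪z i, d⟫ else 0| ≤ κ ^ 96 := by
    intro d hd i j
    have e1 : s⁻¹ * ⟪w i j, d⟫ - (if i = j then s⁻¹ * σ i * ⟪z i, d⟫ else 0)
        = s⁻¹ * ⟪w i j - (if i = j then σ i • z i else 0), d⟫ := by
      rw [inner_sub_left]
      split_ifs
      · rw [inner_smul_left, conj_trivial]; ring
      · simp
    rw [e1, abs_mul, abs_inv, abs_of_pos h.scale_pos, inv_mul_le_iff₀ h.scale_pos]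
    refine (abs_real_inner_le_norm _ _).trans ?_
    rw [hd, mul_one]
    exact hwn i j
  have hratio : ∀ i, κ ≤ s⁻¹ * σ i := fun i => by
    rw [le_inv_mul_iff₀ h.scale_pos, mul_comm]; exact h.le_weight i
  have hratio' : ∀ i, s⁻¹ * σ i ≤ 1 := fun i => by
    rw [inv_mul_le_iff₀ h.scale_pos, mul_one]; exact h.weight_le i
  have habs : ∀ i, |s⁻¹ * σ i| = s⁻¹ * σ i := fun i => abs_of_pos (h.pos.trans_le (hratio i))
  have hup : ∀ d : Vec n, ‖d‖ = 1 → ∀ i, |s⁻¹ * σ i * ⟪z i, d⟫| ≤ 1 := fun d hd i => by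
    rw [abs_mul, habs]
    refine mul_le_one₀ (hratio' i) (abs_nonneg _) ?_
    have := abs_real_inner_le_norm (z i) d
    rwa [h.norm_z, hd, mul_one] at this
  have hlow : ∀ d : Vec n, (∀ i, κ ^ 4 ≤ |⟪z i, d⟫|) → ∀ i, κ ^ 5 ≤ |s⁻¹ * σ i * ⟪z i, d⟫| :=
    fun d hd i => by
      rw [abs_mul, habs, show κ ^ 5 = κ * κ ^ 4 by ring]
      exact mul_le_mul (hratio i) (hd i) (pow_pos h.pos _).le (h.pos.le.trans (hratio i))
  have hcontr : ∀ d : Vec n, contract T' d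
      = colMatrix xt * (s • Matrix.of fun i j => s⁻¹ * ⟪w i j, d⟫) * (colMatrix yt)ᵀ := fun d => by
    rw [hexp, contract_sum_outer]
    congr 2
    ext i j
    simp [h.scale_pos.ne', hw]
  refine ⟨xt, xt', yt, yt', Matrix.of fun i j => s⁻¹ * ⟪w i j, a⟫,
    Matrix.of fun i j => s⁻¹ * ⟪w i j, b⟫, fun i => s⁻¹ * σ i * ⟪z i, a⟫,
    fun i => s⁻¹ * σ i * ⟪z i, b⟫, ?_, fun i => norm_starProjection_le_one (h.norm_x i),
    fun i => norm_starProjection_le_one (h.norm_y i),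
    fun i => norm_starProjection_sub_le h.angle_U (h.norm_x i),
    fun i => norm_starProjection_sub_le h.angle_V (h.norm_y i), hxd, hyd, hcontr a, hcontr b⟩
  -- The normalised weights lie in `[κ, 1]`. One of them enters each diagonal entry and two enter
  -- each minor, so the bounds `κ ^ 4` and `κ ^ 9` become `κ ^ 5` and `κ ^ 11`.
  refine ⟨h.pos, h.le, by rw [Fintype.card_fin]; exact h.card_mul_le, hent a h.norm_a,
    hent b h.norm_b, hup a h.norm_a, hup b h.norm_b, hlow a h.le_inner_a, hlow b h.le_inner_b,
    fun i j hij => ?_⟩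
  have e1 : s⁻¹ * σ i * ⟪z i, a⟫ * (s⁻¹ * σ j * ⟪z j, b⟫)
      - s⁻¹ * σ j * ⟪z j, a⟫ * (s⁻¹ * σ i * ⟪z i, b⟫)
      = (s⁻¹ * σ i) * (s⁻¹ * σ j) * (⟪z i, a⟫ * ⟪z j, b⟫ - ⟪z j, a⟫ * ⟪z i, b⟫) := by ring
  rw [e1, abs_mul, abs_mul, habs, habs, show κ ^ 11 = κ * κ * κ ^ 9 by ring]
  exact mul_le_mul (mul_le_mul (hratio i) (hratio j) h.pos.le (h.pos.le.trans (hratio i)))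
    (h.gap i j hij) (pow_pos h.pos _).le
    (mul_nonneg (h.pos.le.trans (hratio i)) (h.pos.le.trans (hratio j)))

end JennrichSetup

/-- Least squares problems have solutions. -/
theorem exists_least_squares {E F : Type*} [AddCommGroup E] [Module ℝ E] [FiniteDimensional ℝ E]
    [NormedAddCommGroup F] [InnerProductSpace ℝ F] (L : E →ₗ[ℝ] F) (T : F) :
    ∃ w, ∀ w', ‖T - L w‖ ≤ ‖T - L w'‖ := by
  have : FiniteDimensional ℝ (LinearMap.range L) := inferInstance
  obtain ⟨w, hw⟩ := LinearMap.mem_range.1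
    ((LinearMap.range L).starProjection_apply_mem T)
  refine ⟨w, fun w' => ?_⟩
  rw [hw]
  have h1 : T - L w' = (T - (LinearMap.range L).starProjection T)
      + ((LinearMap.range L).starProjection T - L w') := by abel
  have h2 : ⟪T - (LinearMap.range L).starProjection T,
      (LinearMap.range L).starProjection T - L w'⟫ = 0 :=
    Submodule.inner_left_of_mem_orthogonal
      (Submodule.sub_mem _ ((LinearMap.range L).starProjection_apply_mem T) ⟨w', rfl⟩)
      ((LinearMap.range L).sub_starProjection_mem_orthogonal T)
  have h3 := norm_add_sq_eq_norm_sq_add_norm_sq_of_inner_eq_zero _ _ h2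
  rw [← h1] at h3
  -- Pythagoras: the residual of the orthogonal projection is one leg of every competing residual.
  refine le_of_sq_le_sq ?_ (norm_nonneg _)
  nlinarith [mul_self_nonneg ‖(LinearMap.range L).starProjection T - L w'‖]

namespace JennrichSetup

variable {n r : ℕ} {κ s c : ℝ} {σ : Fin r → ℝ} {x y z : Fin r → Vec n}
  {U V W : Submodule ℝ (Vec n)} {T' : Tensor n} {a b : Vec n}

theorem c_inv_le (h : JennrichSetup κ s c σ x y z U V W T' a b) : c⁻¹ ≤ κ⁻¹ :=
  inv_anti₀ h.pos (by linarith [h.two_mul_le, h.pos])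

theorem c_pos (h : JennrichSetup κ s c σ x y z U V W T' a b) : 0 < c := by
  linarith [h.pos, h.two_mul_le]

theorem norm_outer_sub_le (h : JennrichSetup κ s c σ x y z U V W T' a b) {xh yh : Vec n}
    {k : Fin r} (hx : ‖xh - x k‖ ≤ κ ^ 68) (hy : ‖yh - y k‖ ≤ κ ^ 68) :
    ‖outer xh yh (z k) - outer (x k) (y k) (z k)‖ ≤ κ ^ 67 := by
  refine (norm_outer_sub_outer_le _ _ _ _ _ _).trans ?_
  rw [sub_self, norm_zero, h.norm_x, h.norm_z]
  have h1 : ‖yh‖ ≤ 2 := by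
    have := norm_sub_norm_le yh (y k)
    rw [h.norm_y] at this
    have e : κ ^ 68 ≤ 1 := pow_le_one₀ h.pos.le (by linarith [h.le])
    linarith
  have h2 : ‖xh - x k‖ * ‖yh‖ ≤ κ ^ 68 * 2 :=
    mul_le_mul hx h1 (norm_nonneg _) (pow_pos h.pos _).le
  have e1 := h.pow_succ_le (m := 67) (k := 68) (by norm_num)
  have e2 := pow_pos h.pos 67
  linarith

theorem cpTensor_reindex (π : Equiv.Perm (Fin r)) :
    cpTensor σ x y z = ∑ i, σ (π i) • outer (x (π i)) (y (π i)) (z (π i)) :=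
  (Equiv.sum_comp π fun i => σ i • outer (x i) (y i) (z i)).symm

/-- The least squares step gives accurate components if the first two factors are accurate. -/
theorem norm_outer_sub_smul_outer_le (h : JennrichSetup κ s c σ x y z U V W T' a b)
    (π : Equiv.Perm (Fin r)) {xh yh w : Fin r → Vec n} (hx : ∀ i, ‖xh i - x (π i)‖ ≤ κ ^ 68)
    (hy : ∀ i, ‖yh i - y (π i)‖ ≤ κ ^ 68)
    (hw : ‖T' - ∑ i, outer (xh i) (yh i) (w i)‖
      ≤ ‖T' - ∑ i, outer (xh i) (yh i) (σ (π i) • z (π i))‖) (i : Fin r) :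
    ‖outer (xh i) (yh i) (w i) - σ (π i) • outer (x (π i)) (y (π i)) (z (π i))‖ ≤ s * κ ^ 62 := by
  have hs := h.scale_pos
  have hσ : ∀ i, |σ i| ≤ s := fun i => by rw [abs_of_pos (h.weight_pos i)]; exact h.weight_le i
  -- The true third factors are an admissible competitor with small residual, and the minimiser can
  -- only do better.
  have hresid : ‖T' - ∑ i, outer (xh i) (yh i) (σ (π i) • z (π i))‖ ≤ s * κ ^ 65 := by
    have e1 : T' - ∑ i, outer (xh i) (yh i) (σ (π i) • z (π i)) = (T' - cpTensor σ x y z)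
        - ∑ i, σ (π i) • (outer (xh i) (yh i) (z (π i))
          - outer (x (π i)) (y (π i)) (z (π i))) := by
      rw [cpTensor_reindex π]
      simp only [outer_smul_right, smul_sub, Finset.sum_sub_distrib]
      abel
    have e2 : ‖∑ i, σ (π i) • (outer (xh i) (yh i) (z (π i))
          - outer (x (π i)) (y (π i)) (z (π i)))‖ ≤ s * κ ^ 66 := by
      calc _ ≤ ∑ i, ‖σ (π i) • (outer (xh i) (yh i) (z (π i))
          - outer (x (π i)) (y (π i)) (z (π i)))‖ := norm_sum_le _ _
        _ ≤ ∑ _i : Fin r, s * κ ^ 67 := Finset.sum_le_sum fun i _ => by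
            rw [norm_smul, Real.norm_eq_abs]
            exact mul_le_mul (hσ _) (h.norm_outer_sub_le (hx i) (hy i)) (norm_nonneg _) hs.le
        _ = (r * κ) * (s * κ ^ 66) := by
            rw [Finset.sum_const, Finset.card_univ, nsmul_eq_mul, Fintype.card_fin]; ring
        _ ≤ s * κ ^ 66 :=
            mul_le_of_le_one_left (mul_nonneg hs.le (pow_pos h.pos _).le) h.card_mul_le
    rw [e1]
    refine (norm_sub_le _ _).trans ((add_le_add h.close e2).trans ?_)
    rw [← mul_add]
    refine mul_le_mul_of_nonneg_left ?_ hs.le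
    have e3 := h.pow_succ_le (m := 65) (k := 66) (by norm_num)
    have e4 := h.pow_succ_le (m := 65) (k := 98) (by norm_num)
    have e5 := pow_pos h.pos 65
    linarith
  -- Both residuals being small, `∑ xh ⊗ yh ⊗ d` is small. Contracting it with the duals of `x` and
  -- `y` gives `d k` up to a coefficient matrix close to the identity.
  set d : Fin r → Vec n := fun i => w i - σ (π i) • z (π i) with hd
  have hD : ‖∑ i, outer (xh i) (yh i) (d i)‖ ≤ 2 * (s * κ ^ 65) := by
    have e1 : ∑ i, outer (xh i) (yh i) (d i)
        = (T' - ∑ i, outer (xh i) (yh i) (σ (π i) • z (π i)))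
          - (T' - ∑ i, outer (xh i) (yh i) (w i)) := by
      simp only [hd, outer_sub_right, Finset.sum_sub_distrib]; abel
    rw [e1]
    refine (norm_sub_le _ _).trans ?_
    linarith
  obtain ⟨x', -, hxn, hxd⟩ := h.robust_x.exists_dual h.c_pos
  obtain ⟨y', -, hyn, hyd⟩ := h.robust_y.exists_dual h.c_pos
  have hnear : ∀ (v v' vh : Fin r → Vec n), (∀ i, ‖v' i‖ ≤ c⁻¹) →
      (∀ i j, ⟪v' i, v j⟫ = if i = j then 1 else 0) → (∀ i, ‖vh i - v (π i)‖ ≤ κ ^ 68) →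
      ∀ i j, |⟪v' (π i), vh j⟫ - if i = j then 1 else 0| ≤ κ ^ 67 := by
    intro v v' vh hvn hvd hv i j
    have e1 : ⟪v' (π i), vh j⟫ - (if i = j then (1 : ℝ) else 0)
        = ⟪v' (π i), vh j - v (π j)⟫ := by
      rw [inner_sub_right, hvd]; simp
    rw [e1]
    refine (abs_real_inner_le_norm _ _).trans ?_
    calc _ ≤ κ⁻¹ * κ ^ 68 := mul_le_mul ((hvn _).trans h.c_inv_le) (hv j) (norm_nonneg _)
          (inv_nonneg.2 h.pos.le)
      _ = κ ^ 67 := by have := h.pos.ne'; field_simp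
  have hpx := hnear x x' xh hxn hxd hx
  have hpy := hnear y y' yh hyn hyd hy
  have hprod : ∀ i j, |⟪x' (π i), xh j⟫ * ⟪y' (π i), yh j⟫ - if i = j then 1 else 0|
      ≤ κ ^ 66 := fun i j => by
    have e1 := hpx i j
    have e2 := hpy i j
    set p := ⟪x' (π i), xh j⟫
    set q := ⟪y' (π i), yh j⟫
    set o : ℝ := if i = j then 1 else 0 with ho
    have ho1 : |o| ≤ 1 := by rw [ho]; split_ifs <;> simp
    have hoo : o * o = o := by rw [ho]; split_ifs <;> simp
    have e3 : p * q - o = (p - o) * (q - o) + o * (q - o) + (p - o) * o := by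
      linear_combination hoo
    have e4 : |p * q - o| ≤ |(p - o) * (q - o)| + |o * (q - o)| + |(p - o) * o| := by
      rw [e3]; exact abs_add_three _ _ _
    rw [abs_mul, abs_mul, abs_mul] at e4
    have e5 : κ ^ 67 ≤ 1 := pow_le_one₀ h.pos.le (by linarith [h.le])
    have e6 := h.pow_succ_le (m := 66) (k := 67) (by norm_num)
    have e7 := pow_pos h.pos 66
    have e8 := mul_le_mul e1 (e2.trans e5) (abs_nonneg _) (pow_pos h.pos _).le
    have e9 := mul_le_mul ho1 e2 (abs_nonneg _) zero_le_one
    have e10 := mul_le_mul e1 ho1 (abs_nonneg _) (pow_pos h.pos _).le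
    linarith
  have : Nonempty (Fin r) := ⟨i⟩
  -- For the largest `d k` the off-diagonal terms are at most `κ ^ 65 * ‖d k‖` and can be absorbed
  -- on the left.
  obtain ⟨k, -, hk⟩ := Finset.exists_max_image Finset.univ (fun i => ‖d i‖) Finset.univ_nonempty
  have hk' : ∀ i, ‖d i‖ ≤ ‖d k‖ := fun i => hk i (Finset.mem_univ i)
  have hdk : ‖d k‖ ≤ s * κ ^ 62 / 4 := by
    have e1 : contractTwo (∑ i, outer (xh i) (yh i) (d i)) (x' (π k)) (y' (π k))
        = d k + ∑ j, (⟪x' (π k), xh j⟫ * ⟪y' (π k), yh j⟫ - if k = j then 1 else 0) • d j := by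
      simp [contractTwo_sum, contractTwo_outer, sub_smul, Finset.sum_sub_distrib]
    have e2 : ‖contractTwo (∑ i, outer (xh i) (yh i) (d i)) (x' (π k)) (y' (π k))‖
        ≤ 2 * (s * κ ^ 63) := by
      refine (norm_contractTwo_le _ _ _).trans ?_
      have e3 : ‖x' (π k)‖ * ‖y' (π k)‖ ≤ κ⁻¹ * κ⁻¹ :=
        mul_le_mul ((hxn _).trans h.c_inv_le) ((hyn _).trans h.c_inv_le) (norm_nonneg _)
          (inv_nonneg.2 h.pos.le)
      calc _ ≤ 2 * (s * κ ^ 65) * (κ⁻¹ * κ⁻¹) := mul_le_mul hD e3 (by positivity)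
            (by have := pow_pos h.pos 65; positivity)
        _ = 2 * (s * κ ^ 63) := by have := h.pos.ne'; field_simp
    have e3 : ‖∑ j, (⟪x' (π k), xh j⟫ * ⟪y' (π k), yh j⟫ - if k = j then 1 else 0) • d j‖
        ≤ κ ^ 65 * ‖d k‖ := by
      calc _ ≤ ∑ j, ‖(⟪x' (π k), xh j⟫ * ⟪y' (π k), yh j⟫ - if k = j then 1 else 0) • d j‖ :=
            norm_sum_le _ _
        _ ≤ ∑ _j : Fin r, κ ^ 66 * ‖d k‖ := Finset.sum_le_sum fun j _ => by
            rw [norm_smul, Real.norm_eq_abs]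
            exact mul_le_mul (hprod k j) (hk' j) (norm_nonneg _) (pow_pos h.pos _).le
        _ = (r * κ) * (κ ^ 65 * ‖d k‖) := by
            rw [Finset.sum_const, Finset.card_univ, nsmul_eq_mul, Fintype.card_fin]; ring
        _ ≤ κ ^ 65 * ‖d k‖ := mul_le_of_le_one_left
            (mul_nonneg (pow_pos h.pos _).le (norm_nonneg _)) h.card_mul_le
    have e4 : d k = contractTwo (∑ i, outer (xh i) (yh i) (d i)) (x' (π k)) (y' (π k))
        - ∑ j, (⟪x' (π k), xh j⟫ * ⟪y' (π k), yh j⟫ - if k = j then 1 else 0) • d j := by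
      rw [e1]; abel
    have e5 : ‖d k‖ ≤ 2 * (s * κ ^ 63) + κ ^ 65 * ‖d k‖ := by
      conv_lhs => rw [e4]
      exact (norm_sub_le _ _).trans (add_le_add e2 e3)
    have e6 := h.pow_succ_le (m := 0) (k := 65) (by norm_num)
    rw [pow_zero] at e6
    have e7 := mul_le_mul_of_nonneg_left (h.pow_succ_le (m := 62) (k := 63) (by norm_num)) hs.le
    have e8 := mul_le_mul_of_nonneg_right e6 (norm_nonneg (d k))
    have e9 := mul_pos hs (pow_pos h.pos 62)
    linarith [norm_nonneg (d k)]
  have hle2 : ∀ (v vh : Vec n), ‖v‖ = 1 → ‖vh - v‖ ≤ κ ^ 68 → ‖vh‖ ≤ 1 + κ ^ 68 := by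
    intro v vh hv hvh
    have := norm_sub_norm_le vh v
    linarith
  have e1 : outer (xh i) (yh i) (w i) - σ (π i) • outer (x (π i)) (y (π i)) (z (π i))
      = outer (xh i) (yh i) (d i)
        + σ (π i) • (outer (xh i) (yh i) (z (π i)) - outer (x (π i)) (y (π i)) (z (π i))) := by
    simp only [hd, outer_sub_right, outer_smul_right, smul_sub]; abel
  have e2 : ‖outer (xh i) (yh i) (d i)‖ ≤ s * κ ^ 62 / 2 := by
    rw [norm_outer]
    have f1 := hle2 _ _ (h.norm_x _) (hx i)
    have f2 := hle2 _ _ (h.norm_y _) (hy i)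
    have f3 := h.pow_succ_le (m := 0) (k := 68) (by norm_num)
    rw [pow_zero] at f3
    have f4 : ‖xh i‖ * ‖yh i‖ ≤ 2 := by
      nlinarith [norm_nonneg (xh i), norm_nonneg (yh i)]
    calc _ ≤ 2 * (s * κ ^ 62 / 4) :=
          mul_le_mul f4 ((hk' i).trans hdk) (norm_nonneg _) (by norm_num)
      _ = _ := by ring
  have e3 : ‖σ (π i) • (outer (xh i) (yh i) (z (π i)) - outer (x (π i)) (y (π i)) (z (π i)))‖
      ≤ s * κ ^ 67 := by
    rw [norm_smul, Real.norm_eq_abs]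
    exact mul_le_mul (hσ _) (h.norm_outer_sub_le (hx i) (hy i)) (norm_nonneg _) hs.le
  rw [e1]
  refine (norm_add_le _ _).trans ?_
  have e7 := mul_le_mul_of_nonneg_left (h.pow_succ_le (m := 62) (k := 67) (by norm_num)) hs.le
  have e9 := mul_pos hs (pow_pos h.pos 62)
  linarith

/-- All outputs of Jennrich's algorithm are accurate. -/
theorem isJennrichOutput_close (h : JennrichSetup κ s c σ x y z U V W T' a b)
    {comp : Fin r → Tensor n} (hcomp : IsJennrichOutput T' a b comp) :
    ∃ π : Equiv.Perm (Fin r), ∀ i,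
      ‖comp i - σ (π i) • outer (x (π i)) (y (π i)) (z (π i))‖ ≤ s * κ ^ 62 := by
  obtain ⟨Ta, Tb, Tai, Tbi, u, v, w, eu, ev, hTa, hTb, hTai, hTbi, hu, hv, hmin, hls, hc⟩ := hcomp
  obtain ⟨xt, xt', yt, yt', A, B, α, β, hAB, hxt, hyt, hxx, hyy, hxd, hyd, ha, hb⟩ :=
    h.exists_factorization
  have hs0 := h.scale_pos.ne'
  -- A slice of `T'` factors through `r` columns, so any truncation to the top `r` components
  -- returns the slice itself.
  have hTa' := hTa.eq_of_eq_mul (ha.trans (Matrix.mul_assoc _ _ _))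
  have hTb' := hTb.eq_of_eq_mul (hb.trans (Matrix.mul_assoc _ _ _))
  rw [ha] at hTa'
  rw [hb] at hTb'
  subst hTa' hTb'
  obtain ⟨π, t, hπ, ht, hπ88, hπx⟩ :=
    hAB.exists_recovery hxt hxx hxd hyd hs0 hTbi.mul_mul_left hu
  have hNa : colMatrix yt * (s • Aᵀ) * (colMatrix xt)ᵀ * Taiᵀ
      * (colMatrix yt * (s • Aᵀ) * (colMatrix xt)ᵀ)
      = colMatrix yt * (s • Aᵀ) * (colMatrix xt)ᵀ := by
    have := congrArg Matrix.transpose hTai.mul_mul_left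
    simpa [Matrix.transpose_mul, Matrix.mul_assoc] using this
  -- Transposing `Ta⁺ Tb` gives `Tbᵀ (Ta⁺)ᵀ`: the same shape as the first problem with `X` and `Y`
  -- exchanged and `A`, `B` exchanged and transposed.
  have hv' : IsEigensystem (colMatrix yt * (s • Bᵀ) * (colMatrix xt)ᵀ * Taiᵀ) v ev := by
    have e : (Tai * (colMatrix xt * (s • B) * (colMatrix yt)ᵀ))ᵀ
        = colMatrix yt * (s • Bᵀ) * (colMatrix xt)ᵀ * Taiᵀ := by
      simp [Matrix.transpose_mul, Matrix.mul_assoc]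
    rwa [e] at hv
  obtain ⟨ρ, t', hρ, ht', hρ88, hρy⟩ :=
    hAB.swap.transpose.exists_recovery hyt hyy hyd hxd hs0 hNa hv'
  have hpair := hAB.pairing_eq hπ hρ hπ88 hρ88 hmin
  subst hpair
  set π' : Equiv.Perm (Fin r) := Equiv.ofBijective π (Finite.injective_iff_bijective.1 hπ)
  refine ⟨π', fun i => ?_⟩
  -- Eigenvectors are determined only up to scale. The scalars are moved into the third factors,
  -- over which the least squares step minimises freely.
  have hresc : ∀ (w : Fin r → Vec n) i, outer (u i) (v i) (w i)
      = outer (t i • u i) (t' i • v i) ((t i * t' i)⁻¹ • w i) := fun w i => by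
    rw [outer_smul_left, outer_smul_mid, outer_smul_right, smul_smul, smul_smul,
      mul_inv_cancel₀ (mul_ne_zero (ht i) (ht' i)), one_smul]
  rw [hc i, hresc w]
  refine h.norm_outer_sub_smul_outer_le π' (xh := fun i => t i • u i) (yh := fun i => t' i • v i)
    (w := fun i => (t i * t' i)⁻¹ • w i) hπx hρy ?_ i
  have h1 := hls fun i => (t i * t' i) • (σ (π' i) • z (π' i))
  rw [sq_le_sq₀ (norm_nonneg _) (norm_nonneg _)] at h1
  simp only [hresc] at h1
  refine h1.trans (le_of_eq ?_)
  congr 3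
  funext i
  rw [outer_smul_right, outer_smul_left, outer_smul_mid, smul_smul]

/-- Jennrich's algorithm can be carried out. -/
theorem exists_isJennrichOutput (h : JennrichSetup κ s c σ x y z U V W T' a b) :
    ∃ u v w : Fin r → Vec n, IsJennrichOutput T' a b fun i => outer (u i) (v i) (w i) := by
  obtain ⟨xt, xt', yt, yt', A, B, α, β, hAB, hxt, hyt, hxx, hyy, hxd, hyd, ha, hb⟩ :=
    h.exists_factorization
  have hs0 := h.scale_pos.ne'
  obtain ⟨Tai, hTai⟩ := exists_isPseudoinverse (contract T' a)
  obtain ⟨Tbi, hTbi⟩ := exists_isPseudoinverse (contract T' b)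
  have hTa := isTopComponents_self (ha.trans (Matrix.mul_assoc _ _ _))
  have hTb := isTopComponents_self (hb.trans (Matrix.mul_assoc _ _ _))
  choose l hl hdet using hAB.exists_det_eq_zero
  have e1 := hAB.pow_succ_le (m := 5) (k := 13) (by norm_num)
  have e2 := pow_pos hAB.pos 5
  have hl0 : ∀ k, l k ≠ 0 := fun k h0 => by
    have := hl k
    rw [h0, zero_mul, sub_zero] at this
    linarith [hAB.le_abs_left k]
  -- The roots are distinct, since one `l` cannot be near two of the quotients; this yields linearly
  -- independent eigenvectors.
  have hinj : Function.Injective l := fun j k hjk => by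
    by_contra hne
    have f1 := hAB.le_abs_of_near (hl k) hne
    rw [← hjk] at f1
    have f2 := hAB.pow_succ_le (m := 12) (k := 13) (by norm_num)
    linarith [hl j, pow_pos hAB.pos 12]
  have hNb := hTbi.mul_mul_left
  rw [hb] at hNb
  obtain ⟨u, hu⟩ := hAB.exists_eigensystem hxd hyd hs0 hNb hl0 hinj hdet
  have hNa : colMatrix yt * (s • Aᵀ) * (colMatrix xt)ᵀ * Taiᵀ
      * (colMatrix yt * (s • Aᵀ) * (colMatrix xt)ᵀ)
      = colMatrix yt * (s • Aᵀ) * (colMatrix xt)ᵀ := by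
    have := congrArg Matrix.transpose hTai.mul_mul_left
    rw [ha] at this
    simpa [Matrix.transpose_mul, Matrix.mul_assoc] using this
  -- The inverses of the roots are roots of the reversed transposed pencil. With this choice paired
  -- eigenvalues are exactly reciprocal and the pairing cost is zero, hence minimal.
  have hdet' : ∀ k, (Bᵀ - (l k)⁻¹ • Aᵀ).det = 0 := fun k => by
    have f1 : Bᵀ - (l k)⁻¹ • Aᵀ = (-(l k)⁻¹) • (A - l k • B)ᵀ := by
      rw [Matrix.transpose_sub, Matrix.transpose_smul, smul_sub, smul_smul, neg_mul,
        inv_mul_cancel₀ (hl0 k), neg_smul, neg_smul, one_smul]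
      abel
    rw [f1, Matrix.det_smul, Matrix.det_transpose, hdet, mul_zero]
  obtain ⟨v, hv⟩ := hAB.swap.transpose.exists_eigensystem hyd hxd hs0 hNa
    (l := fun k => (l k)⁻¹) (fun k => inv_ne_zero (hl0 k)) (inv_injective.comp hinj) hdet'
  let L : (Fin r → Vec n) →ₗ[ℝ] Tensor n :=
    { toFun := fun w => ∑ i, outer (u i) (v i) (w i)
      map_add' := fun w w' => by simp [outer_add_right, Finset.sum_add_distrib]
      map_smul' := fun t w => by simp [outer_smul_right, Finset.smul_sum] }
  obtain ⟨w, hw⟩ := exists_least_squares L T'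
  refine ⟨u, v, w, contract T' a, contract T' b, Tai, Tbi, u, v, w, l, fun k => (l k)⁻¹, hTa, hTb,
    hTai, hTbi, by rw [ha]; exact hu, ?_, fun τ => ?_, fun w' => ?_, fun i => rfl⟩
  · have e : (Tai * contract T' b)ᵀ = colMatrix yt * (s • Bᵀ) * (colMatrix xt)ᵀ * Taiᵀ := by
      rw [hb]
      simp [Matrix.transpose_mul, Matrix.mul_assoc]
    rw [e]
    exact hv
  · have : ∀ i, |l i * (l i)⁻¹ - 1| = 0 := fun i => by rw [mul_inv_cancel₀ (hl0 i)]; simp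
    simp only [this, Finset.sum_const_zero]
    exact Finset.sum_nonneg fun i _ => abs_nonneg _
  · exact pow_le_pow_left₀ (norm_nonneg _) (hw w') 2

end JennrichSetup

/-- Every rank-one tensor is a nonnegative multiple of a product of unit vectors. -/
theorem exists_unit_outer {n : ℕ} (hn : 0 < n) (u v w : Vec n) :
    ∃ (s : ℝ) (x y z : Vec n), 0 ≤ s ∧ ‖x‖ = 1 ∧ ‖y‖ = 1 ∧ ‖z‖ = 1 ∧
      outer u v w = s • outer x y z := by
  have key : ∀ v : Vec n, ∃ x : Vec n, ‖x‖ = 1 ∧ v = ‖v‖ • x := fun v => by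
    by_cases hv : v = 0
    · exact ⟨EuclideanSpace.single ⟨0, hn⟩ 1, by simp, by simp [hv]⟩
    · refine ⟨‖v‖⁻¹ • v, norm_smul_inv_norm hv, ?_⟩
      rw [smul_smul, mul_inv_cancel₀ (norm_ne_zero_iff.2 hv), one_smul]
  obtain ⟨x, hx, hux⟩ := key u
  obtain ⟨y, hy, hvy⟩ := key v
  obtain ⟨z, hz, hwz⟩ := key w
  refine ⟨‖u‖ * (‖v‖ * ‖w‖), x, y, z, by positivity, hx, hy, hz, ?_⟩
  conv_lhs => rw [hux, hvy, hwz]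
  rw [outer_smul_left, outer_smul_mid, outer_smul_right, smul_smul, smul_smul, mul_assoc]

/-! ### The projection step -/

section Restrict

variable {n : ℕ} {S : Set (Fin n × Fin n × Fin n)}

theorem restrictTo_sub (X Y : Tensor n) :
    restrictTo S (X - Y) = restrictTo S X - restrictTo S Y := by
  ext e; simp [restrictTo, Set.indicator]; split_ifs <;> simp

theorem restrictTo_add (X Y : Tensor n) :
    restrictTo S (X + Y) = restrictTo S X + restrictTo S Y := by
  ext e; simp [restrictTo, Set.indicator]; split_ifs <;> simp

theorem restrictTo_smul (c : ℝ) (X : Tensor n) : restrictTo S (c • X) = c • restrictTo S X := by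
  ext e; simp +contextual [restrictTo, Set.indicator]

theorem restrictTo_restrictTo (X : Tensor n) : restrictTo S (restrictTo S X) = restrictTo S X := by
  ext e; simp +contextual [restrictTo, Set.indicator]

theorem norm_restrictTo_le (X : Tensor n) : ‖restrictTo S X‖ ≤ ‖X‖ := by
  refine le_of_sq_le_sq ?_ (norm_nonneg _)
  rw [EuclideanSpace.real_norm_sq_eq, EuclideanSpace.real_norm_sq_eq]
  refine Finset.sum_le_sum fun e _ => ?_
  simp only [restrictTo, Set.indicator]
  split_ifs
  · exact le_rfl
  · simpa using sq_nonneg _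

theorem isProjectionStep_iff {T T' : Tensor n} {U V W : Submodule ℝ (Vec n)} :
    IsProjectionStep S (restrictTo S T) U V W T' ↔ T' ∈ tensorSubspace U V W ∧
      ∀ X ∈ tensorSubspace U V W, ‖restrictTo S T - restrictTo S T'‖
        ≤ ‖restrictTo S T - restrictTo S X‖ := by
  simp only [IsProjectionStep, restrictTo_sub, restrictTo_restrictTo,
    sq_le_sq₀ (norm_nonneg _) (norm_nonneg _), norm_sub_rev]

theorem exists_isProjectionStep (S : Set (Fin n × Fin n × Fin n)) (T : Tensor n)
    (U V W : Submodule ℝ (Vec n)) : ∃ T', IsProjectionStep S (restrictTo S T) U V W T' := by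
  let R : Tensor n →ₗ[ℝ] Tensor n :=
    { toFun := restrictTo S
      map_add' := restrictTo_add
      map_smul' := restrictTo_smul }
  obtain ⟨T', hT'⟩ := exists_least_squares (R ∘ₗ (tensorSubspace U V W).subtype) (restrictTo S T)
  exact ⟨T', isProjectionStep_iff.2 ⟨T'.2, fun X hX => hT' ⟨X, hX⟩⟩⟩

/-- The projection step is accurate if the sample determines the tensors of the subspace. -/
theorem IsProjectionStep.norm_sub_le_mul {T T' X : Tensor n} {U V W : Submodule ℝ (Vec n)}
    (h : IsProjectionStep S (restrictTo S T) U V W T') {L : ℝ} (hL : 1 ≤ L)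
    (hS : ∀ Y ∈ tensorSubspace U V W, ‖Y‖ ≤ L * ‖restrictTo S Y‖)
    (hX : X ∈ tensorSubspace U V W) : ‖T' - T‖ ≤ 3 * L * ‖X - T‖ := by
  obtain ⟨hmem, hmin⟩ := isProjectionStep_iff.1 h
  have h1 := hmin X hX
  have h2 : ‖restrictTo S T - restrictTo S X‖ ≤ ‖X - T‖ := by
    rw [← restrictTo_sub, norm_sub_rev X]; exact norm_restrictTo_le _
  -- On the sample both `T'` and `X` are within `‖X - T‖` of `T`. The difference lies in the
  -- subspace, where `hS` returns to the full norm; the final constant comes from `2L + 1 ≤ 3L`.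
  have h3 : ‖restrictTo S (T' - X)‖ ≤ 2 * ‖X - T‖ := by
    have e : restrictTo S (T' - X) = (restrictTo S T - restrictTo S X)
        - (restrictTo S T - restrictTo S T') := by rw [restrictTo_sub]; abel
    rw [e]
    refine (norm_sub_le _ _).trans ?_
    linarith
  have h4 := hS (T' - X) (Submodule.sub_mem _ hmem hX)
  have h5 : ‖T' - T‖ ≤ ‖T' - X‖ + ‖X - T‖ := norm_sub_le_norm_sub_add_norm_sub _ _ _
  nlinarith [norm_nonneg (X - T)]

/-- The hidden tensor is close to the tensor product of nearby subspaces. -/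
theorem exists_mem_tensorSubspace_norm_sub_le {r : ℕ} {σ : Fin r → ℝ} {x y z : Fin r → Vec n}
    {U V W : Submodule ℝ (Vec n)} {s δ : ℝ} (hσ : ∀ i, |σ i| ≤ s)
    (hx : ∀ i, ‖x i‖ = 1) (hy : ∀ i, ‖y i‖ = 1) (hz : ∀ i, ‖z i‖ = 1)
    (hU : sinAngle (spanOf x) U ≤ δ) (hV : sinAngle (spanOf y) V ≤ δ)
    (hW : sinAngle (spanOf z) W ≤ δ) :
    ∃ X ∈ tensorSubspace U V W, ‖X - cpTensor σ x y z‖ ≤ r * (s * (3 * δ)) := by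
  refine ⟨cpTensor σ (fun i => U.starProjection (x i)) (fun i => V.starProjection (y i))
    (fun i => W.starProjection (z i)), Submodule.sum_mem _ fun i _ => Submodule.smul_mem _ _
      (outer_mem_tensorSubspace (Submodule.starProjection_apply_mem _ _)
      (Submodule.starProjection_apply_mem _ _) (Submodule.starProjection_apply_mem _ _)), ?_⟩
  rw [cpTensor, cpTensor, ← Finset.sum_sub_distrib]
  refine (norm_sum_le _ _).trans ?_
  have key : ∀ i, ‖σ i • outer (U.starProjection (x i)) (V.starProjection (y i))
      (W.starProjection (z i)) - σ i • outer (x i) (y i) (z i)‖ ≤ s * (3 * δ) := fun i => by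
    have hs : 0 ≤ s := (abs_nonneg _).trans (hσ i)
    rw [← smul_sub, norm_smul, Real.norm_eq_abs]
    refine mul_le_mul (hσ i) ?_ (norm_nonneg _) hs
    refine (norm_outer_sub_outer_le _ _ _ _ _ _).trans ?_
    rw [hx, hy]
    have h1 := norm_starProjection_sub_le hU (hx i)
    have h2 := norm_starProjection_sub_le hV (hy i)
    have h3 := norm_starProjection_sub_le hW (hz i)
    have h4 := norm_starProjection_le_one (V := V) (hy i)
    have h5 := norm_starProjection_le_one (V := W) (hz i)
    have hδ : 0 ≤ δ := (norm_nonneg _).trans h1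
    have h6 := mul_le_mul h1 (mul_le_one₀ h4 (norm_nonneg _) h5) (by positivity) hδ
    have h7 := mul_le_mul h2 h5 (norm_nonneg _) hδ
    linarith
  calc _ ≤ ∑ _i : Fin r, s * (3 * δ) := Finset.sum_le_sum fun i _ => key i
    _ = _ := by rw [Finset.sum_const, Finset.card_univ, nsmul_eq_mul, Fintype.card_fin]

end Restrict

open scoped Pointwise

/-! ### Anticoncentration of uniform directions -/

section Sphere

variable {n : ℕ}

/-- A slab of the unit ball has small volume: many of its translates are disjoint. -/
theorem mul_volume_slab_le {v : Vec n} (hv : ‖v‖ = 1) {t : ℝ} {K : ℕ} (ht : 0 < t)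
    (hK : 2 * t * K * n ≤ 1) :
    (K : ENNReal) * volume {x : Vec n | x ∈ Metric.ball 0 1 ∧ |⟪x, v⟫| < t}
      ≤ 3 * volume (Metric.ball (0 : Vec n) 1) := by
  set Sl : Set (Vec n) := {x | x ∈ Metric.ball 0 1 ∧ |⟪x, v⟫| < t} with hSl
  have hmeas : MeasurableSet Sl := by
    have h : MeasurableSet {x : Vec n | |⟪x, v⟫| < t} :=
      measurableSet_lt (by fun_prop) measurable_const
    exact Metric.isOpen_ball.measurableSet.inter h
  have hvv : ⟪v, v⟫ = 1 := by rw [real_inner_self_eq_norm_sq, hv]; norm_num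
  -- Shifts by `2tk` along `v` make the `K` slabs disjoint. All lie in the ball of radius `1 + 2tK`,
  -- whose volume exceeds that of the unit ball by a factor at most `exp (2tKn) ≤ e ≤ 3`.
  let tr : Fin K → Set (Vec n) := fun k => (fun x => ((2 * t * k) • v) + x) '' Sl
  have htr : ∀ k, volume (tr k) = volume Sl := fun k => by
    simp only [tr, Set.image_add_left, measure_preimage_add]
  have htrm : ∀ k, MeasurableSet (tr k) := fun k => by
    simp only [tr, Set.image_add_left]
    exact (measurable_const_add _) hmeas
  have hinner : ∀ k, ∀ p ∈ tr k, |⟪p, v⟫ - 2 * t * k| < t := by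
    rintro k _ ⟨x, hx, rfl⟩
    have : ⟪(2 * t * k) • v + x, v⟫ - 2 * t * k = ⟪x, v⟫ := by
      rw [inner_add_left, inner_smul_left, hvv]; simp
    rw [this]
    exact hx.2
  have hdisj : Pairwise (Function.onFun Disjoint tr) := by
    intro j k hjk
    rw [Function.onFun, Set.disjoint_left]
    intro p hj hk
    have h1 := abs_lt.1 (hinner j p hj)
    have h2 := abs_lt.1 (hinner k p hk)
    have hne : (j : ℕ) ≠ k := fun h => hjk (Fin.ext h)
    rcases lt_or_gt_of_ne hne with h | h
    · have : ((j : ℕ) : ℝ) + 1 ≤ (k : ℕ) := by exact_mod_cast h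
      nlinarith
    · have : ((k : ℕ) : ℝ) + 1 ≤ (j : ℕ) := by exact_mod_cast h
      nlinarith
  set R : ℝ := 1 + 2 * t * K with hR
  have hR1 : 0 < R := by positivity
  have hsub : (⋃ k, tr k) ⊆ Metric.ball (0 : Vec n) R := by
    refine Set.iUnion_subset fun k => ?_
    rintro _ ⟨x, hx, rfl⟩
    have h1 : ‖x‖ < 1 := by simpa using hx.1
    have h2 : ((k : ℕ) : ℝ) ≤ K := by exact_mod_cast k.2.le
    rw [mem_ball_zero_iff]
    calc ‖(2 * t * k) • v + x‖ ≤ ‖(2 * t * k) • v‖ + ‖x‖ := norm_add_le _ _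
      _ < 2 * t * k + 1 := by
          rw [norm_smul, hv, mul_one, Real.norm_eq_abs, abs_of_nonneg (by positivity)]
          linarith
      _ ≤ R := by rw [hR]; nlinarith
  have hpow : R ^ n ≤ 3 := by
    have h1 : R ≤ Real.exp (2 * t * K) := by
      rw [hR, add_comm]; exact Real.add_one_le_exp _
    calc R ^ n ≤ Real.exp (2 * t * K) ^ n := pow_le_pow_left₀ hR1.le h1 n
      _ = Real.exp (2 * t * K * n) := by rw [← Real.exp_nat_mul, mul_comm]
      _ ≤ Real.exp 1 := Real.exp_le_exp.2 hK
      _ ≤ 3 := by linarith [Real.exp_one_lt_d9]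
  calc (K : ENNReal) * volume Sl = ∑ k : Fin K, volume (tr k) := by simp [htr]
    _ = volume (⋃ k, tr k) := by rw [measure_iUnion hdisj htrm, tsum_fintype]
    _ ≤ volume (Metric.ball (0 : Vec n) R) := measure_mono hsub
    _ = ENNReal.ofReal (R ^ n) * volume (Metric.ball (0 : Vec n) 1) := by
        rw [Measure.addHaar_ball_of_pos _ _ hR1]; simp
    _ ≤ 3 * volume (Metric.ball (0 : Vec n) 1) := by
        gcongr
        exact (ENNReal.ofReal_le_ofReal hpow).trans (by simp)

theorem isProbabilityMeasure_uniformSphere (hn : 0 < n) :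
    IsProbabilityMeasure (uniformSphere n) := by
  have : Nontrivial (Vec n) := by
    refine ⟨⟨EuclideanSpace.single ⟨0, hn⟩ 1, 0, fun h => ?_⟩⟩
    have := congrArg norm h
    simp at this
  refine ⟨?_⟩
  rw [uniformSphere, Measure.smul_apply, smul_eq_mul]
  exact ENNReal.inv_mul_cancel (Measure.measure_univ_ne_zero.2 (Measure.toSphere_ne_zero _))
    (measure_ne_top _ _)

/-- Small inner products with a fixed vector are unlikely. -/
theorem uniformSphere_slab_le (hn : 0 < n) (v : Vec n) {t : ℝ} {K : ℕ} (ht : 0 < t)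
    (hK : 2 * t * K * n ≤ 1) (hK0 : K ≠ 0) :
    uniformSphere n {p | |⟪v, (p : Vec n)⟫| < t * ‖v‖} ≤ 3 / K := by
  by_cases hv : v = 0
  · simp [hv]
  have hv0 : 0 < ‖v‖ := norm_pos_iff.2 hv
  set e : Vec n := ‖v‖⁻¹ • v with he
  have he1 : ‖e‖ = 1 := norm_smul_inv_norm hv
  have hset : {p : Metric.sphere (0 : Vec n) 1 | |⟪v, (p : Vec n)⟫| < t * ‖v‖}
      = {p : Metric.sphere (0 : Vec n) 1 | |⟪(p : Vec n), e⟫| < t} := by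
    ext p
    simp only [Set.mem_ofPred_eq, he, inner_smul_right, abs_mul, abs_inv, abs_norm]
    rw [inv_mul_lt_iff₀ hv0, real_inner_comm, mul_comm t]
  rw [hset]
  have hmeas : MeasurableSet {p : Metric.sphere (0 : Vec n) 1 | |⟪(p : Vec n), e⟫| < t} :=
    (isOpen_lt (by fun_prop) continuous_const).measurableSet
  rw [uniformSphere, Measure.smul_apply, smul_eq_mul, Measure.toSphere_apply' _ hmeas,
    Measure.toSphere_apply_univ]
  -- The surface measure of a set is `n` times the volume of the cone over it, and this cone lies in
  -- a slab of the unit ball.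
  have hsub : Set.Ioo (0 : ℝ) 1 • (Subtype.val '' {p : Metric.sphere (0 : Vec n) 1 |
      |⟪(p : Vec n), e⟫| < t}) ⊆ {x : Vec n | x ∈ Metric.ball 0 1 ∧ |⟪x, e⟫| < t} := by
    rintro _ ⟨s, hs, _, ⟨p, hp, rfl⟩, rfl⟩
    have hp1 : ‖(p : Vec n)‖ = 1 := by simp
    have hp : |⟪(p : Vec n), e⟫| < t := hp
    simp only [Set.mem_ofPred_eq, mem_ball_zero_iff, norm_smul, hp1, inner_smul_left, abs_mul,
      conj_trivial, Real.norm_eq_abs, abs_of_pos hs.1, mul_one]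
    exact ⟨hs.2, lt_of_le_of_lt (mul_le_of_le_one_left (abs_nonneg _) hs.2.le) hp⟩
  have h1 := mul_volume_slab_le he1 ht hK
  have h2 := measure_mono (μ := volume) hsub
  set B := volume (Metric.ball (0 : Vec n) 1) with hB
  have hB0 : B ≠ 0 := (Metric.measure_ball_pos volume 0 one_pos).ne'
  have hBt : B ≠ ⊤ := measure_ball_lt_top.ne
  have hKt : (K : ENNReal) ≠ ⊤ := ENNReal.natCast_ne_top K
  have hK0' : (K : ENNReal) ≠ 0 := by exact_mod_cast hK0
  have hfin : Module.finrank ℝ (Vec n) = n := by simp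
  have hnt : (n : ENNReal) ≠ ⊤ := ENNReal.natCast_ne_top n
  have hn0 : (n : ENNReal) ≠ 0 := by exact_mod_cast hn.ne'
  rw [hfin, ENNReal.mul_inv (Or.inl hn0) (Or.inl hnt)]
  rw [ENNReal.le_div_iff_mul_le (Or.inl hK0') (Or.inl hKt)]
  set M := volume (Set.Ioo (0 : ℝ) 1 • (Subtype.val '' {p : Metric.sphere (0 : Vec n) 1 |
      |⟪(p : Vec n), e⟫| < t})) with hM
  calc (n : ENNReal)⁻¹ * B⁻¹ * (n * M) * K = ((n : ENNReal)⁻¹ * n) * (B⁻¹ * (K * M)) := by ring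
    _ ≤ ((n : ENNReal)⁻¹ * n) * (B⁻¹ * (3 * B)) := by
        exact mul_le_mul_right (mul_le_mul_right ((mul_le_mul_right h2 _).trans h1) _) _
    _ = 3 := by
        rw [ENNReal.inv_mul_cancel hn0 hnt, one_mul, mul_comm 3, ← mul_assoc,
          ENNReal.inv_mul_cancel hB0 hBt, one_mul]

/-- Small inner products with a vector depending on an independent direction are unlikely. -/
theorem prod_slab_le (hn : 0 < n) {F : Vec n → Vec n} (hF : Continuous F) {t : ℝ} {K : ℕ}
    (ht : 0 < t) (hK : 2 * t * K * n ≤ 1) (hK0 : K ≠ 0) :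
    ((uniformSphere n).prod (uniformSphere n))
      {q | |⟪F (q.2 : Vec n), (q.1 : Vec n)⟫| < t * ‖F (q.2 : Vec n)‖} ≤ 3 / K := by
  have := isProbabilityMeasure_uniformSphere hn
  have hmeas : MeasurableSet {q : Metric.sphere (0 : Vec n) 1 × Metric.sphere (0 : Vec n) 1 |
      |⟪F (q.2 : Vec n), (q.1 : Vec n)⟫| < t * ‖F (q.2 : Vec n)‖} :=
    measurableSet_lt (by fun_prop) (by fun_prop)
  rw [Measure.prod_apply_symm hmeas]
  calc _ ≤ ∫⁻ _q : Metric.sphere (0 : Vec n) 1, (3 / K : ENNReal) ∂(uniformSphere n) :=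
        lintegral_mono fun q => uniformSphere_slab_le hn (F q) ht hK hK0
    _ = 3 / K := by simp

/-- Genericity of the random directions of Jennrich's algorithm. -/
def GoodDirections {r : ℕ} (t : ℝ) (z : Fin r → Vec n)
    (q : Metric.sphere (0 : Vec n) 1 × Metric.sphere (0 : Vec n) 1) : Prop :=
  (∀ i, t ≤ |⟪z i, (q.1 : Vec n)⟫|) ∧ (∀ i, t ≤ |⟪z i, (q.2 : Vec n)⟫|) ∧
    ∀ i j, i ≠ j → t * ‖⟪z j, (q.2 : Vec n)⟫ • z i + (-⟪z i, (q.2 : Vec n)⟫) • z j‖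
      ≤ |⟪⟪z j, (q.2 : Vec n)⟫ • z i + (-⟪z i, (q.2 : Vec n)⟫) • z j, (q.1 : Vec n)⟫|

theorem measurableSet_goodDirections {r : ℕ} (t : ℝ) (z : Fin r → Vec n) :
    MeasurableSet {q | GoodDirections t z q} := by
  refine IsClosed.measurableSet ?_
  simp only [GoodDirections, Set.ofPred_and, Set.ofPred_forall]
  refine (isClosed_iInter fun i => isClosed_le continuous_const (by fun_prop)).inter
    ((isClosed_iInter fun i => isClosed_le continuous_const (by fun_prop)).inter
    (isClosed_iInter fun i => isClosed_iInter fun j => isClosed_iInter fun _ =>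
      isClosed_le (by fun_prop) (by fun_prop)))

/-- Union bound over `r + r + r²` slabs. For the minors the slab is orthogonal to a vector depending
on the second direction only, so it is bounded for each fixed value of that direction; the pairs `i
= j` are counted harmlessly. -/
theorem measure_not_goodDirections_le {r : ℕ} (hn : 0 < n) {z : Fin r → Vec n}
    (hz : ∀ i, ‖z i‖ = 1) {t : ℝ} {K : ℕ} (ht : 0 < t) (hK : 2 * t * K * n ≤ 1) (hK0 : K ≠ 0) :
    ((uniformSphere n).prod (uniformSphere n)) {q | ¬ GoodDirections t z q}
      ≤ (r + r + r * r) * (3 / K) := by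
  have := isProbabilityMeasure_uniformSphere hn
  set ν := (uniformSphere n).prod (uniformSphere n) with hν
  let A : Fin r → Set (Metric.sphere (0 : Vec n) 1 × Metric.sphere (0 : Vec n) 1) := fun i =>
    {q | |⟪z i, (q.1 : Vec n)⟫| < t}
  let B : Fin r → Set (Metric.sphere (0 : Vec n) 1 × Metric.sphere (0 : Vec n) 1) := fun i =>
    {q | |⟪z i, (q.2 : Vec n)⟫| < t}
  let F : Fin r × Fin r → Vec n → Vec n := fun p b => ⟪z p.2, b⟫ • z p.1 + (-⟪z p.1, b⟫) • z p.2
  let C : Fin r × Fin r → Set (Metric.sphere (0 : Vec n) 1 × Metric.sphere (0 : Vec n) 1) :=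
    fun p => {q | |⟪F p (q.2 : Vec n), (q.1 : Vec n)⟫| < t * ‖F p (q.2 : Vec n)‖}
  have hA : ∀ i, ν (A i) ≤ 3 / K := fun i => by
    have h1 := prod_slab_le hn (F := fun _ => z i) continuous_const ht hK hK0
    simpa [hz] using h1
  have hB : ∀ i, ν (B i) ≤ 3 / K := fun i => by
    have h1 := uniformSphere_slab_le hn (z i) ht hK hK0
    rw [hz, mul_one] at h1
    have h2 : B i = Set.univ ×ˢ {p : Metric.sphere (0 : Vec n) 1 | |⟪z i, (p : Vec n)⟫| < t} := by
      ext q; simp [B]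
    rw [h2, hν, Measure.prod_prod, measure_univ, one_mul]
    exact h1
  have hC : ∀ p, ν (C p) ≤ 3 / K := fun p => prod_slab_le hn (by fun_prop) ht hK hK0
  have hsub : {q | ¬ GoodDirections t z q} ⊆ ((⋃ i, A i) ∪ ⋃ i, B i) ∪ ⋃ p, C p := by
    intro q hq
    by_contra hnot
    simp only [Set.mem_union, Set.mem_iUnion, not_or, not_exists] at hnot
    obtain ⟨⟨h1, h2⟩, h3⟩ := hnot
    exact hq ⟨fun i => not_lt.1 (h1 i), fun i => not_lt.1 (h2 i),
      fun i j _ => not_lt.1 (h3 (i, j))⟩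
  have hU : ∀ {ι : Type} [Fintype ι] (D : ι → Set (Metric.sphere (0 : Vec n) 1 ×
      Metric.sphere (0 : Vec n) 1)), (∀ i, ν (D i) ≤ 3 / K) →
      ν (⋃ i, D i) ≤ Fintype.card ι * (3 / K) := fun {ι} _ D hD => by
    calc ν (⋃ i, D i) ≤ ∑ i, ν (D i) := measure_iUnion_fintype_le _ _
      _ ≤ ∑ _i : ι, (3 / K : ENNReal) := Finset.sum_le_sum fun i _ => hD i
      _ = _ := by rw [Finset.sum_const, Finset.card_univ, nsmul_eq_mul]
  calc _ ≤ ν (((⋃ i, A i) ∪ ⋃ i, B i) ∪ ⋃ p, C p) := measure_mono hsub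
    _ ≤ (ν (⋃ i, A i) + ν (⋃ i, B i)) + ν (⋃ p, C p) :=
        (measure_union_le _ _).trans (add_le_add (measure_union_le _ _) le_rfl)
    _ ≤ (r * (3 / K) + r * (3 / K)) + (r * r) * (3 / K) := by
        have h1 := hU A hA
        have h2 := hU B hB
        have h3 := hU C hC
        simp only [Fintype.card_fin, Fintype.card_prod, Nat.cast_mul] at h1 h2 h3
        exact add_le_add (add_le_add h1 h2) h3
    _ = _ := by ring

end Sphere

/-! ### Second moments of sampled Gram matrices -/

section Moments

variable {ι : Type*} [Fintype ι]

open Classical in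
/-- The centered indicator of the event `e ∈ S`. -/
noncomputable def centered (q : ℝ) (S : Set ι) (e : ι) : ℝ := (if e ∈ S then 1 else 0) - q

theorem integral_bernoulli (q : unitInterval) (φ : Prop → ℝ) :
    ∫ p, φ p ∂(unitInterval.toNNReal q • Measure.dirac True
      + unitInterval.toNNReal (unitInterval.symm q) • Measure.dirac False)
      = q * φ True + (1 - q) * φ False := by
  rw [integral_add_measure .of_finite .of_finite, integral_smul_nnreal_measure,
    integral_smul_nnreal_measure, integral_dirac, integral_dirac]
  rfl

/-- Distinct entries are independent and centered, which kills the covariance; on the diagonal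
stands the Bernoulli variance. -/
theorem integral_centered_mul [DecidableEq ι] (q : unitInterval) (e e' : ι) :
    ∫ S, centered q S e * centered q S e' ∂(setBernoulli Set.univ q)
      = if e = e' then (q : ℝ) * (1 - q) else 0 := by
  classical
  let φ : Prop → ℝ := fun p => (if p then 1 else 0) - (q : ℝ)
  rw [setBernoulli_eq_map, integral_map Measurable.of_discrete.aemeasurable
    (by fun_prop), Measure.infinitePi_eq_pi]
  change ∫ s : ι → Prop, φ (s e) * φ (s e') ∂_ = _
  simp only [Set.mem_univ]
  split_ifs with h
  · subst h
    rw [integral_comp_eval (X := fun _ : ι => Prop) (i := e) (f := fun p : Prop => φ p * φ p)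
      Measurable.of_discrete.aestronglyMeasurable, integral_bernoulli]
    simp [φ]; ring
  · have hind := (iIndepFun_pi (X := fun (_ : ι) (p : Prop) => φ p)
      (μ := fun _ : ι => unitInterval.toNNReal q • Measure.dirac True
        + unitInterval.toNNReal (unitInterval.symm q) • Measure.dirac False)
      (fun _ => Measurable.of_discrete.aemeasurable)).indepFun h
    rw [hind.integral_fun_mul_eq_mul_integral Measurable.of_discrete.aestronglyMeasurable
        Measurable.of_discrete.aestronglyMeasurable,
      integral_comp_eval (X := fun _ : ι => Prop) (i := e) (f := φ)
        Measurable.of_discrete.aestronglyMeasurable,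
      integral_comp_eval (X := fun _ : ι => Prop) (i := e') (f := φ)
        Measurable.of_discrete.aestronglyMeasurable, integral_bernoulli]
    simp [φ]; ring_nf

/-- The squared Frobenius norm of the centered Gram matrix of a family of functions. -/
noncomputable def gramDeviation {D : ℕ} (q : ℝ) (f : Fin D → ι → ℝ) (S : Set ι) : ℝ :=
  ∑ k, ∑ l, (∑ e, centered q S e * (f k e * f l e)) ^ 2

/-- Each entry of the deviation is a sum of uncorrelated terms with second moment at most `q ∑ (f k
e * f l e)²`; summing over `k` and `l` produces the square of `∑ f k e²`. -/
theorem integral_gramDeviation_le {D : ℕ} (q : unitInterval) (f : Fin D → ι → ℝ) :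
    ∫ S, gramDeviation q f S ∂(setBernoulli Set.univ q) ≤ q * ∑ e, (∑ k, f k e ^ 2) ^ 2 := by
  classical
  have hq0 := q.2.1
  have hq1 := q.2.2
  have h1 : ∀ w : ι → ℝ, ∫ S, (∑ e, centered q S e * w e) ^ 2 ∂(setBernoulli Set.univ q)
      ≤ q * ∑ e, w e ^ 2 := fun w => by
    have e1 : ∀ S : Set ι, (∑ e, centered q S e * w e) ^ 2
        = ∑ e, ∑ e', (w e * w e') * (centered q S e * centered q S e') := fun S => by
      rw [sq, Finset.sum_mul_sum]
      exact Finset.sum_congr rfl fun e _ => Finset.sum_congr rfl fun e' _ => by ring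
    simp only [e1]
    rw [integral_finsetSum _ fun _ _ => .of_finite, Finset.mul_sum]
    refine Finset.sum_le_sum fun e _ => ?_
    rw [integral_finsetSum _ fun _ _ => .of_finite]
    simp only [integral_const_mul, integral_centered_mul, mul_ite, mul_zero, Finset.sum_ite_eq,
      Finset.mem_univ, if_true]
    nlinarith [mul_nonneg (mul_nonneg hq0 hq0) (sq_nonneg (w e))]
  unfold gramDeviation
  rw [integral_finsetSum _ fun _ _ => .of_finite]
  calc _ ≤ ∑ k, ∑ l, (q : ℝ) * ∑ e, (f k e * f l e) ^ 2 := by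
        refine Finset.sum_le_sum fun k _ => ?_
        rw [integral_finsetSum _ fun _ _ => .of_finite]
        exact Finset.sum_le_sum fun l _ => h1 _
    _ = q * ∑ e, (∑ k, f k e ^ 2) ^ 2 := by
        simp only [← Finset.mul_sum]
        congr 1
        have : ∀ e, (∑ k, f k e ^ 2) ^ 2 = ∑ k, ∑ l, (f k e * f l e) ^ 2 := fun e => by
          rw [sq, Finset.sum_mul_sum]
          exact Finset.sum_congr rfl fun k _ => Finset.sum_congr rfl fun l _ => by ring
        simp only [this]
        rw [eq_comm, Finset.sum_comm]
        exact Finset.sum_congr rfl fun k _ => Finset.sum_comm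

/-- If the centered Gram matrix is small, then sampling preserves a fraction of the norm. -/
theorem mul_sum_sq_le_of_gramDeviation {D : ℕ} {q : ℝ} (hq : 0 ≤ q) {f : Fin D → ι → ℝ} {S : Set ι}
    (hS : gramDeviation q f S < (q / 2) ^ 2) (g : Fin D → ℝ)
    (hg : ∑ e, (∑ k, g k * f k e) ^ 2 = ∑ k, g k ^ 2) :
    q / 2 * ∑ k, g k ^ 2 ≤ ∑ e, S.indicator (fun e => (∑ k, g k * f k e) ^ 2) e := by
  classical
  have h1 : ∑ e, S.indicator (fun e => (∑ k, g k * f k e) ^ 2) e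
      = q * ∑ k, g k ^ 2 + ∑ e, centered q S e * (∑ k, g k * f k e) ^ 2 := by
    rw [← hg, Finset.mul_sum, ← Finset.sum_add_distrib]
    refine Finset.sum_congr rfl fun e _ => ?_
    simp only [centered, Set.indicator]
    split_ifs <;> ring
  have h2 : ∑ e, centered q S e * (∑ k, g k * f k e) ^ 2
      = ∑ p : Fin D × Fin D, (g p.1 * g p.2) * ∑ e, centered q S e * (f p.1 e * f p.2 e) := by
    rw [Fintype.sum_prod_type]
    have e1 : ∀ e, centered q S e * (∑ k, g k * f k e) ^ 2
        = ∑ k, ∑ l, g k * g l * (centered q S e * (f k e * f l e)) := fun e => by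
      rw [sq, Finset.sum_mul_sum, Finset.mul_sum]
      refine Finset.sum_congr rfl fun k _ => ?_
      rw [Finset.mul_sum]
      exact Finset.sum_congr rfl fun l _ => by ring
    simp only [e1, Finset.mul_sum]
    rw [Finset.sum_comm]
    exact Finset.sum_congr rfl fun k _ => Finset.sum_comm
  set N := ∑ k, g k ^ 2 with hN
  have hN0 : 0 ≤ N := Finset.sum_nonneg fun k _ => sq_nonneg _
  -- Cauchy–Schwarz over pairs `(k, l)`: a quadratic form is at most the Frobenius norm of its
  -- matrix times `∑ g k²`.
  have h3 : (∑ e, centered q S e * (∑ k, g k * f k e) ^ 2) ^ 2 ≤ (N * (q / 2)) ^ 2 := by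
    rw [h2]
    refine (Finset.sum_mul_sq_le_sq_mul_sq _ _ _).trans ?_
    have e1 : ∑ p : Fin D × Fin D, (g p.1 * g p.2) ^ 2 = N ^ 2 := by
      rw [Fintype.sum_prod_type, hN, sq, Finset.sum_mul_sum]
      exact Finset.sum_congr rfl fun k _ => Finset.sum_congr rfl fun l _ => by ring
    have e2 : ∑ p : Fin D × Fin D, (∑ e, centered q S e * (f p.1 e * f p.2 e)) ^ 2
        = gramDeviation q f S := by
      rw [Fintype.sum_prod_type]; rfl
    rw [e1, e2, mul_pow]
    exact mul_le_mul_of_nonneg_left hS.le (sq_nonneg _)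
  have h4 := (abs_le.1 (abs_le_of_sq_le_sq h3 (by positivity))).1
  rw [h1]
  linarith

end Moments

/-! ### Sampling on tensor product subspaces -/

section Sampling

variable {n : ℕ} {U V W : Submodule ℝ (Vec n)}

theorem apply_eq_inner_outer (X : Tensor n) (e : Fin n × Fin n × Fin n) :
    X e = ⟪X, outer (EuclideanSpace.single e.1 1) (EuclideanSpace.single e.2.1 1)
      (EuclideanSpace.single e.2.2 1)⟫ := by
  have : outer (EuclideanSpace.single e.1 (1 : ℝ)) (EuclideanSpace.single e.2.1 1)
      (EuclideanSpace.single e.2.2 1) = EuclideanSpace.single e 1 := by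
    ext d
    obtain ⟨i, j, k⟩ := e
    obtain ⟨i', j', k'⟩ := d
    simp only [outer_apply, PiLp.single_apply, Prod.mk.injEq]
    split_ifs <;> simp_all
  rw [this, EuclideanSpace.inner_single_right]
  simp

/-- A weak form of the fact that the product of the three projections is the projection onto the
product subspace. It replaces a unit tensor by a product of projected basis vectors. -/
theorem inner_outer_starProjection {X : Tensor n} (hX : X ∈ tensorSubspace U V W) (x y z : Vec n) :
    ⟪X, outer (U.starProjection x) (V.starProjection y) (W.starProjection z)⟫
      = ⟪X, outer x y z⟫ := by
  have key : ∀ (V : Submodule ℝ (Vec n)) (v x : Vec n), v ∈ V →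
      ⟪v, V.starProjection x⟫ = ⟪v, x⟫ := fun V v x hv => by
    have h := Submodule.inner_right_of_mem_orthogonal hv (V.sub_starProjection_mem_orthogonal x)
    rw [inner_sub_right] at h
    linarith
  induction hX using Submodule.span_induction with
  | mem X hX =>
    obtain ⟨a, ha, b, hb, d, hd, rfl⟩ := hX
    rw [inner_outer, inner_outer, key U a x ha, key V b y hb, key W d z hd]
  | zero => simp
  | add X Y _ _ h h' => rw [inner_add_left, inner_add_left, h, h']
  | smul c X _ h => rw [inner_smul_left, inner_smul_left, h]

/-- Sampling is well conditioned on incoherent tensor product subspaces. -/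
theorem measure_sample_le {r : ℕ} (hU : Module.finrank ℝ U = r) (hV : Module.finrank ℝ V = r)
    (hW : Module.finrank ℝ W = r) {m : ℝ}
    (hUm : ∀ i, ‖U.starProjection (EuclideanSpace.single i 1)‖ ^ 2 ≤ m)
    (hVm : ∀ i, ‖V.starProjection (EuclideanSpace.single i 1)‖ ^ 2 ≤ m) (q : unitInterval)
    (hq : 0 < (q : ℝ)) :
    (setBernoulli (Set.univ : Set (Fin n × Fin n × Fin n)) q).real
      {S | ¬ ∀ X ∈ tensorSubspace U V W, (q : ℝ) / 2 * ‖X‖ ^ 2 ≤ ‖restrictTo S X‖ ^ 2}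
      ≤ 4 * (m ^ 2 * r ^ 3) / q := by
  set b := stdOrthonormalBasis ℝ (tensorSubspace U V W) with hb
  set f : Fin (Module.finrank ℝ (tensorSubspace U V W)) → Fin n × Fin n × Fin n → ℝ :=
    fun k e => (b k : Tensor n) e with hf
  set pu : Fin n → ℝ := fun i => ‖U.starProjection (EuclideanSpace.single i 1)‖ ^ 2 with hpu
  set pv : Fin n → ℝ := fun i => ‖V.starProjection (EuclideanSpace.single i 1)‖ ^ 2 with hpv
  set pw : Fin n → ℝ := fun i => ‖W.starProjection (EuclideanSpace.single i 1)‖ ^ 2 with hpw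
  have hbo : Orthonormal ℝ fun k => (b k : Tensor n) :=
    b.orthonormal.comp_linearIsometry (tensorSubspace U V W).subtypeₗᵢ
  -- The entry of `b k` at `e` is its inner product with the projected unit tensor, so this is
  -- Bessel's inequality.
  have hbound : ∀ e, ∑ k, f k e ^ 2 ≤ pu e.1 * pv e.2.1 * pw e.2.2 := fun e => by
    have h1 := hbo.sum_inner_products_le (s := Finset.univ)
      (x := outer (U.starProjection (EuclideanSpace.single e.1 1))
        (V.starProjection (EuclideanSpace.single e.2.1 1))
        (W.starProjection (EuclideanSpace.single e.2.2 1)))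
    rw [norm_outer, mul_pow, mul_pow] at h1
    refine le_trans (le_of_eq (Finset.sum_congr rfl fun k _ => ?_)) h1
    rw [inner_outer_starProjection (b k).2, ← apply_eq_inner_outer, Real.norm_eq_abs, sq_abs]
  have hpw1 : ∀ i, pw i ≤ 1 := fun i => by
    have := norm_starProjection_le_one (V := W)
      (v := EuclideanSpace.single i (1 : ℝ)) (by simp)
    exact pow_le_one₀ (norm_nonneg _) this
  -- One factor of each square is bounded by `m ^ 2`, using 1 for the third length; the other is
  -- summed exactly, each mode contributing its dimension `r`.
  have hsumsq : ∑ e, (∑ k, f k e ^ 2) ^ 2 ≤ m ^ 2 * r ^ 3 := by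
    have h1 : ∀ e, (∑ k, f k e ^ 2) ^ 2 ≤ m ^ 2 * (pu e.1 * (pv e.2.1 * pw e.2.2)) := fun e => by
      have hu : 0 ≤ pu e.1 := sq_nonneg _
      have hv : 0 ≤ pv e.2.1 := sq_nonneg _
      have hw : 0 ≤ pw e.2.2 := sq_nonneg _
      have h2 : pu e.1 * pv e.2.1 * pw e.2.2 ≤ m ^ 2 := by
        have := mul_le_mul (hUm e.1) (hVm e.2.1) hv (hu.trans (hUm e.1))
        calc _ ≤ pu e.1 * pv e.2.1 := mul_le_of_le_one_right (mul_nonneg hu hv) (hpw1 _)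
          _ ≤ m ^ 2 := by rw [sq]; exact this
      have h3 : 0 ≤ pu e.1 * pv e.2.1 * pw e.2.2 := by positivity
      calc _ ≤ (pu e.1 * pv e.2.1 * pw e.2.2) ^ 2 :=
            pow_le_pow_left₀ (Finset.sum_nonneg fun k _ => sq_nonneg _) (hbound e) 2
        _ ≤ m ^ 2 * (pu e.1 * pv e.2.1 * pw e.2.2) := by
            rw [sq]; exact mul_le_mul_of_nonneg_right h2 h3
        _ = _ := by ring
    refine (Finset.sum_le_sum fun e _ => h1 e).trans (le_of_eq ?_)
    rw [← Finset.mul_sum]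
    congr 1
    have su := sum_sq_norm_starProjection_single U
    have sv := sum_sq_norm_starProjection_single V
    have sw := sum_sq_norm_starProjection_single W
    rw [hU] at su
    rw [hV] at sv
    rw [hW] at sw
    simp only [Fintype.sum_prod_type, ← Finset.mul_sum, ← Finset.sum_mul]
    rw [su, sv, sw]
    ring
  have hsub : {S | ¬ ∀ X ∈ tensorSubspace U V W, (q : ℝ) / 2 * ‖X‖ ^ 2 ≤ ‖restrictTo S X‖ ^ 2}
      ⊆ {S | ((q : ℝ) / 2) ^ 2 ≤ gramDeviation q f S} := by
    intro S hS
    by_contra hlt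
    refine hS fun X hX => ?_
    have hlt' : gramDeviation q f S < ((q : ℝ) / 2) ^ 2 := not_le.1 hlt
    set g := fun k => ⟪b k, (⟨X, hX⟩ : tensorSubspace U V W)⟫ with hg
    have hXe : ∀ e, X e = ∑ k, g k * f k e := fun e => by
      have h1 := congrArg Subtype.val (b.sum_repr' ⟨X, hX⟩)
      have h2 := congrArg (fun Y : Tensor n => Y e) h1
      rw [← h2]
      simp [hg, hf]
    have hXn : ‖X‖ ^ 2 = ∑ k, g k ^ 2 := by
      have h1 := b.sum_sq_norm_inner_right ⟨X, hX⟩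
      rw [Submodule.coe_norm] at h1
      rw [← h1]
      simp [hg]
    have h1 := mul_sum_sq_le_of_gramDeviation hq.le hlt' g (by
      rw [← hXn, EuclideanSpace.real_norm_sq_eq]
      simp only [hXe])
    rw [← hXn] at h1
    refine h1.trans (le_of_eq ?_)
    rw [EuclideanSpace.real_norm_sq_eq]
    refine Finset.sum_congr rfl fun e _ => ?_
    simp only [restrictTo, Set.indicator, hXe]
    split_ifs <;> simp
  have hmarkov := mul_meas_ge_le_integral_of_nonneg (μ := setBernoulli Set.univ q)
    (f := gramDeviation (q : ℝ) f)
    (.of_forall fun S => Finset.sum_nonneg fun k _ => Finset.sum_nonneg fun l _ => sq_nonneg _)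
    .of_finite (((q : ℝ) / 2) ^ 2)
  have hint := integral_gramDeviation_le q f
  have hle := measureReal_mono hsub (measure_ne_top (setBernoulli Set.univ q) _)
  rw [le_div_iff₀ hq]
  have h5 := hmarkov.trans (hint.trans (mul_le_mul_of_nonneg_left hsumsq hq.le))
  have h6 := mul_le_mul_of_nonneg_left hle (sq_nonneg ((q : ℝ) / 2))
  refine le_of_mul_le_mul_right ?_ hq
  nlinarith

end Sampling

/-! ### Incoherence and numerical parameters -/

section Parameters

variable {n r : ℕ} {σ : Fin r → ℝ} {x y z : Fin r → Vec n} {c μ : ℝ}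

/-- The squared lengths of the projected basis vectors have average `r / n`, so their upper bound `μ
r / n` cannot be smaller. -/
theorem Incoherent.one_le {V : Submodule ℝ (Vec n)} (hr : 0 < r) (hn : 0 < n)
    (hV : Module.finrank ℝ V = r) (h : Incoherent V μ) : 1 ≤ μ := by
  by_contra! hlt
  have hr' : (0 : ℝ) < r := by exact_mod_cast hr
  have hn' : (0 : ℝ) < n := by exact_mod_cast hn
  have h1 := sum_sq_norm_starProjection_single V
  rw [hV] at h1
  -- The maximum with 0 is needed because `√` vanishes on negative arguments and the sign of `μ` is
  -- not yet known.
  have h2 : ∀ i, ‖V.starProjection (EuclideanSpace.single i (1 : ℝ))‖ ^ 2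
      ≤ max 0 (μ * r / n) := fun i => by
    have := h i
    rw [hV] at this
    calc _ ≤ (√(μ * r / n)) ^ 2 := pow_le_pow_left₀ (norm_nonneg _) this 2
      _ ≤ _ := by rw [Real.sq_sqrt']; exact (max_comm _ _).le
  have h3 : (r : ℝ) ≤ n * max 0 (μ * r / n) := by
    refine h1.symm.le.trans ?_
    calc _ ≤ ∑ _i : Fin n, max 0 (μ * r / n) := Finset.sum_le_sum fun i _ => h2 i
      _ = _ := by rw [Finset.sum_const, Finset.card_univ, nsmul_eq_mul, Fintype.card_fin]
  rcases max_cases 0 (μ * r / n) with ⟨h4, -⟩ | ⟨h4, -⟩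
  · rw [h4] at h3; linarith
  · rw [h4] at h3
    have : (n : ℝ) * (μ * r / n) = μ * r := by field_simp
    rw [this] at h3
    nlinarith

/-- One factor 2 comes from tilting the subspace, another from `δ ≤ √(μ r / n)`; squaring gives 16.
-/
theorem sq_norm_starProjection_le {V : Submodule ℝ (Vec n)} {δ : ℝ} (hr : 0 < r) (hn : 0 < n)
    (hc : 0 < c) (hδ : δ ≤ 1 / n) (hδ2 : δ ≤ 1 / 2) (hx : Robust c x)
    (h : sinAngle (spanOf x) V ≤ δ) (hV : Module.finrank ℝ V = r) (hinc : Incoherent (spanOf x) μ)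
    (i : Fin n) : ‖V.starProjection (EuclideanSpace.single i 1)‖ ^ 2 ≤ 16 * (μ * r / n) := by
  have hfr := finrank_spanOf hc hx
  have hμ := hinc.one_le hr hn hfr
  have hr' : (1 : ℝ) ≤ r := by exact_mod_cast hr
  have hn' : (1 : ℝ) ≤ n := by exact_mod_cast hn
  have h1 := abs_inner_le_of_sinAngle_le hc hδ2 hx h hV (EuclideanSpace.single i 1) (by simp)
  have h2 := hinc i
  rw [hfr] at h2
  have hpos : 0 ≤ μ * r / n := by positivity
  have h3 : δ ≤ √(μ * r / n) := by
    refine hδ.trans (Real.le_sqrt_of_sq_le ?_)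
    rw [div_pow, one_pow, div_le_div_iff₀ (by positivity) (by positivity)]
    have : (n : ℝ) ≤ n ^ 2 := by nlinarith
    have : 1 ≤ μ * r := by nlinarith
    nlinarith [sq_nonneg (n : ℝ)]
  have h4 : ‖V.starProjection (EuclideanSpace.single i 1)‖ ≤ 4 * √(μ * r / n) := by linarith
  calc _ ≤ (4 * √(μ * r / n)) ^ 2 := pow_le_pow_left₀ (norm_nonneg _) h4 2
    _ = _ := by rw [mul_pow, Real.sq_sqrt hpos]; norm_num

/-- Numerical consequences of the assumptions on the parameters. -/
theorem sampling_bounds {R q : ℝ} (hn : 2 ≤ n) (hr : 0 < r) (hμ : 1 ≤ μ) (hc : 0 < c) (hc1 : c ≤ 1)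
    (hR : 1 ≤ R) (hq1 : 2 * q ≤ 1)
    (hq : q = Real.log n ^ 2 / (n : ℝ) ^ 2 * (10 * r * μ / c * R) ^ 10) :
    100 ≤ n ∧ 4 * 10 ^ 9 * (μ ^ 2 * r ^ 5) ≤ q * n ^ 2 := by
  have hn' : (2 : ℝ) ≤ n := by exact_mod_cast hn
  have hr' : (1 : ℝ) ≤ r := by exact_mod_cast hr
  have hn0 : (n : ℝ) ≠ 0 := by positivity
  have hlog : 0.69 ≤ Real.log n := by
    have h1 := Real.log_two_gt_d9
    have h2 := Real.log_le_log (by norm_num) hn'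
    linarith
  have hlog2 : 0.4 ≤ Real.log n ^ 2 := by nlinarith
  have h1 : 10 * r * μ ≤ 10 * r * μ / c * R := by
    have : 10 * r * μ ≤ 10 * r * μ / c := by
      rw [le_div_iff₀ hc]
      exact mul_le_of_le_one_right (by positivity) hc1
    refine this.trans (le_mul_of_one_le_right (by positivity) hR)
  have h2 : (10 * r * μ) ^ 10 ≤ (10 * r * μ / c * R) ^ 10 := pow_le_pow_left₀ (by positivity) h1 10
  have h3 : 10 ^ 10 * (μ ^ 2 * r ^ 5) ≤ (10 * r * μ) ^ 10 := by
    have e1 : μ ^ 2 ≤ μ ^ 10 := pow_le_pow_right₀ hμ (by norm_num)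
    have e2 : (r : ℝ) ^ 5 ≤ r ^ 10 := pow_le_pow_right₀ hr' (by norm_num)
    calc 10 ^ 10 * (μ ^ 2 * r ^ 5) ≤ 10 ^ 10 * (μ ^ 10 * r ^ 10) := by gcongr
      _ = _ := by ring
  have h4 : q * n ^ 2 = Real.log n ^ 2 * (10 * r * μ / c * R) ^ 10 := by
    rw [hq]; field_simp
  have h5 : 4 * 10 ^ 9 * (μ ^ 2 * r ^ 5) ≤ q * n ^ 2 := by
    rw [h4]
    calc 4 * 10 ^ 9 * (μ ^ 2 * r ^ 5) = 0.4 * (10 ^ 10 * (μ ^ 2 * r ^ 5)) := by ring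
      _ ≤ Real.log n ^ 2 * (10 * r * μ / c * R) ^ 10 :=
          mul_le_mul hlog2 (h3.trans h2) (by positivity) (sq_nonneg _)
  refine ⟨?_, h5⟩
  -- As `q ≤ 1/2`, the bound just proved forces `n² ≥ 8·10⁹`, which excludes small `n`.
  by_contra! hlt
  have h6 : (n : ℝ) ≤ 100 := by exact_mod_cast hlt.le
  have h7 : 1 ≤ μ ^ 2 * (r : ℝ) ^ 5 :=
    one_le_mul_of_one_le_of_one_le (one_le_pow₀ hμ) (one_le_pow₀ hr')
  have h8 : (n : ℝ) ^ 2 ≤ 100 ^ 2 := pow_le_pow_left₀ (by positivity) h6 2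
  nlinarith [sq_nonneg (n : ℝ)]

end Parameters

/-! ### The good event -/

section Event

variable {Ω : Type*} [MeasurableSpace Ω] {P : Measure Ω} [IsProbabilityMeasure P] {n r : ℕ}
  {p : unitInterval} {obs obsMinus obsTilde : Ω → Set (Fin n × Fin n × Fin n)}
  {a b : Ω → Metric.sphere (0 : Vec n) 1}

/-- Union bound for the sample and the directions. These variables are only almost everywhere
measurable, so `G` is a measurable subset of the good event with the same measure. -/
theorem IsRunRandomness.exists_event (h : IsRunRandomness P p obs obsMinus obsTilde a b)
    (A : Set (Set (Fin n × Fin n × Fin n)))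
    {B : Set (Metric.sphere (0 : Vec n) 1 × Metric.sphere (0 : Vec n) 1)} (hB : MeasurableSet B)
    (hn : 0 < n) {ε : ℝ} (hε : 0 ≤ ε)
    (hA : setBernoulli (Set.univ : Set (Fin n × Fin n × Fin n)) (halfProb p) Aᶜ
      ≤ ENNReal.ofReal ε)
    (hB' : ((uniformSphere n).prod (uniformSphere n)) Bᶜ ≤ ENNReal.ofReal ε) :
    ∃ G, MeasurableSet G ∧ ENNReal.ofReal (1 - 2 * ε) ≤ P G ∧
      ∀ ω ∈ G, obsMinus ω ∈ A ∧ (a ω, b ω) ∈ B := by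
  have := isProbabilityMeasure_uniformSphere hn
  have hab : HasLaw (fun ω => (a ω, b ω)) ((uniformSphere n).prod (uniformSphere n)) P :=
    h.indep_directions.hasLaw_prod h.law_a h.law_b
  have hAm : MeasurableSet A := .of_discrete
  have hN1 : NullMeasurableSet {ω | obsMinus ω ∈ A} P := h.law_minus.aemeasurable.nullMeasurable hAm
  have hN2 : NullMeasurableSet {ω | (a ω, b ω) ∈ B} P := hab.aemeasurable.nullMeasurable hB
  have hN := hN1.inter hN2
  obtain ⟨G, hGs, hG, hGe⟩ := hN.exists_measurable_subset_ae_eq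
  refine ⟨G, hG, ?_, fun ω hω => hGs hω⟩
  rw [measure_congr hGe]
  have h1 : P ({ω | obsMinus ω ∈ A} ∩ {ω | (a ω, b ω) ∈ B})ᶜ ≤ ENNReal.ofReal (2 * ε) := by
    rw [Set.compl_inter]
    refine (measure_union_le _ _).trans ?_
    have e1 : P {ω | obsMinus ω ∈ A}ᶜ ≤ ENNReal.ofReal ε := by
      refine le_trans (le_of_eq ?_) hA
      exact h.law_minus.measure_eq (p := fun S => S ∈ Aᶜ) hAm.compl
    have e2 : P {ω | (a ω, b ω) ∈ B}ᶜ ≤ ENNReal.ofReal ε := by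
      refine le_trans (le_of_eq ?_) hB'
      exact hab.measure_eq (p := fun q => q ∈ Bᶜ) hB.compl
    rw [two_mul, ENNReal.ofReal_add hε hε]
    exact add_le_add e1 e2
  have h2 := measure_add_measure_compl₀ hN
  rw [measure_univ] at h2
  rw [ENNReal.ofReal_sub _ (by positivity), ENNReal.ofReal_one, ← h2]
  refine tsub_le_iff_right.2 ?_
  gcongr

end Event

/-! ### Accuracy and existence of the estimates -/

section Recovery

variable {n r : ℕ} {σ : Fin r → ℝ} {x y z : Fin r → Vec n} {c μ : ℝ} {κ s : ℝ}
  {U V W : Submodule ℝ (Vec n)} {T' : Tensor n} {a b : Vec n}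

/-- Accuracy of the estimates under the deterministic conditions. -/
theorem JennrichSetup.estimates_close (h : JennrichSetup κ s c σ x y z U V W T' a b)
    {σh : Fin r → ℝ} {xh yh zh : Fin r → Vec n} (hxh : ∀ i, ‖xh i‖ = 1) (hyh : ∀ i, ‖yh i‖ = 1)
    (hzh : ∀ i, ‖zh i‖ = 1) (hσh : ∀ i, 0 ≤ σh i)
    (hout : IsJennrichOutput T' a b fun i => σh i • outer (xh i) (yh i) (zh i)) :
    ∃ (π : Equiv.Perm (Fin r)) (εx εy εz : Fin r → ℝ),
      (∀ i, εx i ∈ ({-1, 1} : Set ℝ)) ∧ (∀ i, εy i ∈ ({-1, 1} : Set ℝ)) ∧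
      (∀ i, εz i ∈ ({-1, 1} : Set ℝ)) ∧
      ∀ i, |σ i - σh (π i)| / s ≤ κ ^ 20 ∧ ‖x i - εx i • xh (π i)‖ ≤ κ ^ 20 ∧
        ‖y i - εy i • yh (π i)‖ ≤ κ ^ 20 ∧ ‖z i - εz i • zh (π i)‖ ≤ κ ^ 20 := by
  obtain ⟨π, hπ⟩ := h.isJennrichOutput_close hout
  have hs := h.scale_pos
  -- `π` sends outputs to hidden components; the conclusion needs the opposite direction, hence
  -- `π.symm`.
  have hπ' : ∀ i, ‖σh (π.symm i) • outer (xh (π.symm i)) (yh (π.symm i)) (zh (π.symm i))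
      - σ i • outer (x i) (y i) (z i)‖ ≤ s * κ ^ 62 := fun i => by
    have := hπ (π.symm i)
    rwa [π.apply_symm_apply] at this
  have hclose := fun i => rankOne_close (h.weight_pos i) (hσh _) (h.norm_x i) (h.norm_y i)
    (h.norm_z i) (hxh _) (hyh _) (hzh _) (hπ' i)
  choose h1 h2 h3 h4 using hclose
  choose εx hεx hx using h2
  choose εy hεy hy using h3
  choose εz hεz hz using h4
  have e62 := h.pow_succ_le (m := 20) (k := 62) (by norm_num)
  have e61 := h.pow_succ_le (m := 21) (k := 62) (by norm_num)
  have p20 := pow_pos h.pos 20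
  have p21 := pow_pos h.pos 21
  have hb1 : ∀ i, 2 * (s * κ ^ 62) / σ i ≤ κ ^ 20 := fun i => by
    rw [div_le_iff₀ (h.weight_pos i)]
    have e1 : κ ^ 20 * (κ * s) ≤ κ ^ 20 * σ i := mul_le_mul_of_nonneg_left (h.le_weight i) p20.le
    have e2 : κ ^ 20 * (κ * s) = s * κ ^ 21 := by ring
    rw [e2] at e1
    refine le_trans ?_ e1
    have e3 := mul_le_mul_of_nonneg_left e61 hs.le
    have e4 := mul_pos hs p21
    linarith
  refine ⟨π.symm, εx, εy, εz, hεx, hεy, hεz, fun i => ⟨?_, (hx i).trans (hb1 i),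
    (hy i).trans (hb1 i), (hz i).trans (hb1 i)⟩⟩
  rw [div_le_iff₀ hs, mul_comm]
  refine (h1 i).trans (mul_le_mul_of_nonneg_left ?_ hs.le)
  linarith

/-- The step after the projection can be completed. -/
theorem JennrichSetup.exists_estimates (h : JennrichSetup κ s c σ x y z U V W T' a b)
    (hn : 0 < n) : ∃ (σh : Fin r → ℝ) (xh yh zh : Fin r → Vec n), (∀ i, ‖xh i‖ = 1) ∧
      (∀ i, ‖yh i‖ = 1) ∧ (∀ i, ‖zh i‖ = 1) ∧ (∀ i, 0 ≤ σh i) ∧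
      IsJennrichOutput T' a b fun i => σh i • outer (xh i) (yh i) (zh i) := by
  obtain ⟨u, v, w, huvw⟩ := h.exists_isJennrichOutput
  choose σh xh yh zh hσ hx hy hz heq using fun i => exists_unit_outer hn (u i) (v i) (w i)
  exact ⟨σh, xh, yh, zh, hx, hy, hz, hσ, (funext heq) ▸ huvw⟩

/-- The minor is the inner product of the first direction with a combination of `z i` and `z j` of
length at least `c * κ ^ 4 ≥ κ ^ 5`; genericity costs another `κ ^ 4`. -/
theorem GoodDirections.le_abs_gap (hκ : 0 < κ) (hκc : κ ≤ c) (hz : Robust c z)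
    {q : Metric.sphere (0 : Vec n) 1 × Metric.sphere (0 : Vec n) 1}
    (h : GoodDirections (κ ^ 4) z q) {i j : Fin r} (hij : i ≠ j) :
    κ ^ 9 ≤ |⟪z i, (q.1 : Vec n)⟫ * ⟪z j, (q.2 : Vec n)⟫
      - ⟪z j, (q.1 : Vec n)⟫ * ⟪z i, (q.2 : Vec n)⟫| := by
  obtain ⟨-, h2, h3⟩ := h
  have h4 := h3 i j hij
  have h5 := hz.mul_abs_le_norm_add (hκ.trans_le hκc) hij ⟪z j, (q.2 : Vec n)⟫
    (-⟪z i, (q.2 : Vec n)⟫)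
  have h6 : κ * κ ^ 4 ≤ c * |⟪z j, (q.2 : Vec n)⟫| :=
    mul_le_mul hκc (h2 j) (pow_pos hκ _).le (hκ.trans_le hκc).le
  calc κ ^ 9 = κ ^ 4 * (κ * κ ^ 4) := by ring
    _ ≤ _ := mul_le_mul_of_nonneg_left (h6.trans h5) (pow_pos hκ _).le
    _ ≤ _ := h4
    _ = _ := by
        rw [inner_add_left, inner_smul_left, inner_smul_left]
        simp only [conj_trivial]
        congr 1; ring

end Recovery

/-! ### Probability estimates and the deterministic setup for the actual parameters -/

section Assembly

variable {n r : ℕ} {σ : Fin r → ℝ} {x y z : Fin r → Vec n} {c μ κ s : ℝ}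
  {U V W : Submodule ℝ (Vec n)}

/-- With `K = 1000 n²` slabs, `2tKn = 2000 (nκ)³ κ` is below 1, and since `r + r + r² ≤ 3n²` the
union bound is at most 9/1000. -/
theorem measure_not_goodDirections_le_ofReal (hn : 0 < n) (hrn : r ≤ n) (hz : ∀ i, ‖z i‖ = 1)
    (hκ : 0 < κ) (hκ1 : κ ≤ 1 / 1000) (hnκ : n * κ ≤ 1 / 10) :
    ((uniformSphere n).prod (uniformSphere n)) {w | GoodDirections (κ ^ 4) z w}ᶜ
      ≤ ENNReal.ofReal (1 / 100) := by
  have hn1 : (1 : ℝ) ≤ n := by exact_mod_cast hn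
  have hK : 2 * κ ^ 4 * ((1000 * n ^ 2 : ℕ) : ℝ) * n ≤ 1 := by
    push_cast
    have e1 : 2 * κ ^ 4 * (1000 * (n : ℝ) ^ 2) * n = 2000 * ((n * κ) ^ 3 * κ) := by ring
    have e2 : (n * κ) ^ 3 ≤ (1 / 10) ^ 3 := pow_le_pow_left₀ (by positivity) hnκ 3
    have e3 : (n * κ) ^ 3 * κ ≤ (1 / 10) ^ 3 * (1 / 1000) :=
      mul_le_mul e2 hκ1 hκ.le (by norm_num)
    rw [e1]
    linarith
  refine (measure_not_goodDirections_le hn hz (pow_pos hκ 4) hK (by positivity)).trans ?_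
  have h1 : ((r : ENNReal) + r + r * r) * (3 / ((1000 * n ^ 2 : ℕ) : ENNReal))
      ≤ ENNReal.ofReal (((r + r + r * r : ℕ) : ℝ) * (3 / ((1000 * n ^ 2 : ℕ) : ℝ))) := by
    rw [ENNReal.ofReal_mul (Nat.cast_nonneg _), ENNReal.ofReal_div_of_pos (by positivity),
      ENNReal.ofReal_natCast, ENNReal.ofReal_natCast, ENNReal.ofReal_ofNat]
    push_cast
    exact le_rfl
  refine h1.trans (ENNReal.ofReal_le_ofReal ?_)
  have hr : (r : ℝ) ≤ n := by exact_mod_cast hrn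
  have hrr : (r : ℝ) * r ≤ n * n := mul_le_mul hr hr (Nat.cast_nonneg _) (by positivity)
  have hnn : (n : ℝ) ≤ n * n := le_mul_of_one_le_left (by positivity) hn1
  push_cast
  rw [mul_div_assoc', div_le_iff₀ (by positivity), sq]
  linarith

/-- For `m = 16μr/n` the failure bound `4m²r³/q` equals `1024 μ²r⁵/(qn²)`, far below 1/100. -/
theorem measure_not_sample_le (hn : 0 < n) (hU : Module.finrank ℝ U = r)
    (hV : Module.finrank ℝ V = r) (hW : Module.finrank ℝ W = r)
    (hUm : ∀ i, ‖U.starProjection (EuclideanSpace.single i 1)‖ ^ 2 ≤ 16 * (μ * r / n))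
    (hVm : ∀ i, ‖V.starProjection (EuclideanSpace.single i 1)‖ ^ 2 ≤ 16 * (μ * r / n))
    (q : unitInterval) (hq : 0 < (q : ℝ))
    (hqn : 4 * 10 ^ 9 * (μ ^ 2 * r ^ 5) ≤ (q : ℝ) * n ^ 2) :
    setBernoulli (Set.univ : Set (Fin n × Fin n × Fin n)) q
      {S | ∀ X ∈ tensorSubspace U V W, (q : ℝ) / 2 * ‖X‖ ^ 2 ≤ ‖restrictTo S X‖ ^ 2}ᶜ
      ≤ ENNReal.ofReal (1 / 100) := by
  have hnR : (0 : ℝ) < n := by exact_mod_cast hn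
  rw [← ofReal_measureReal]
  refine ENNReal.ofReal_le_ofReal ((measure_sample_le hU hV hW hUm hVm q hq).trans ?_)
  rw [div_le_iff₀ hq]
  refine le_of_mul_le_mul_right ?_ (pow_pos hnR 2)
  have e1 : 4 * ((16 * (μ * r / n)) ^ 2 * r ^ 3) * (n : ℝ) ^ 2
      = 1024 * (μ ^ 2 * (r : ℝ) ^ 5) := by field_simp; ring
  have e2 : 0 ≤ μ ^ 2 * (r : ℝ) ^ 5 := by positivity
  rw [e1]
  linarith

/-- The sample costs a factor `3n` and the projected tensor is within `3rsκ ^ 100` of the hidden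
one; as `9(nκ)(rκ) ≤ 1`, two powers of `κ` are spent. -/
theorem IsProjectionStep.jennrichSetup {T' : Tensor n} {a b : Metric.sphere (0 : Vec n) 1}
    {S : Set (Fin n × Fin n × Fin n)} (hn : 0 < n) (hκ : 0 < κ) (hκ1 : κ ≤ 1 / 1000)
    (hrn : r ≤ n) (hnκ : n * κ ≤ 1 / 10) (hκc : 2 * κ ≤ c) (hs : 0 < s) (hσs : ∀ i, σ i ≤ s)
    (hσ : ∀ i, κ * s ≤ σ i) (hx : ∀ i, ‖x i‖ = 1) (hy : ∀ i, ‖y i‖ = 1) (hz : ∀ i, ‖z i‖ = 1)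
    (hRx : Robust c x) (hRy : Robust c y) (hRz : Robust c z)
    (hU : Module.finrank ℝ U = r) (hV : Module.finrank ℝ V = r)
    (hxU : sinAngle (spanOf x) U ≤ κ ^ 100) (hyV : sinAngle (spanOf y) V ≤ κ ^ 100)
    (hzW : sinAngle (spanOf z) W ≤ κ ^ 100)
    (hS : ∀ Y ∈ tensorSubspace U V W, ‖Y‖ ≤ n * ‖restrictTo S Y‖)
    (hab : GoodDirections (κ ^ 4) z (a, b))
    (hT' : IsProjectionStep S (restrictTo S (cpTensor σ x y z)) U V W T') :
    JennrichSetup κ s c σ x y z U V W T' a b := by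
  have hn1 : (1 : ℝ) ≤ n := by exact_mod_cast hn
  have hrκ : r * κ ≤ 1 / 10 :=
    (mul_le_mul_of_nonneg_right (by exact_mod_cast hrn) hκ.le).trans hnκ
  obtain ⟨X, hX, hXT⟩ := exists_mem_tensorSubspace_norm_sub_le (s := s)
    (fun i => by rw [abs_of_pos ((mul_pos hκ hs).trans_le (hσ i))]; exact hσs i)
    hx hy hz hxU hyV hzW
  have hclose := hT'.norm_sub_le_mul hn1 hS hX
  refine
    { pos := hκ, le := hκ1, card_mul_le := by linarith, two_mul_le := hκc,
      scale_pos := hs, weight_le := hσs, le_weight := hσ, robust_x := hRx,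
      robust_y := hRy, norm_x := hx, norm_y := hy, norm_z := hz,
      finrank_U := hU, finrank_V := hV, angle_U := hxU, angle_V := hyV, mem := hT'.1,
      close := hclose.trans ?_, norm_a := by simp, norm_b := by simp, le_inner_a := hab.1,
      le_inner_b := hab.2.1,
      gap := fun i j hij => hab.le_abs_gap hκ (by linarith) hRz hij }
  have h1 : n * κ * (r * κ) ≤ 1 / 10 * (1 / 10) :=
    mul_le_mul hnκ hrκ (by positivity) (by norm_num)
  have h2 : 0 ≤ s * κ ^ 98 := by positivity
  calc 3 * n * ‖X - cpTensor σ x y z‖ ≤ 3 * n * (r * (s * (3 * κ ^ 100))) :=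
        mul_le_mul_of_nonneg_left hXT (by positivity)
    _ = 9 * (n * κ * (r * κ)) * (s * κ ^ 98) := by ring
    _ ≤ 1 * (s * κ ^ 98) := mul_le_mul_of_nonneg_right (by linarith) h2
    _ = s * κ ^ 98 := one_mul _

end Assembly

end TensorCompletion

/-! ### The main theorem -/

open TensorCompletion
theorem theoremC3 {n r : ℕ} (hn : 2 ≤ n) (hr : 0 < r)
    -- the hidden tensor
    (σ : Fin r → ℝ) (x y z : Fin r → Vec n) (c μ : ℝ) (hT : CPAssumptions σ x y z c μ)
    -- the sampling probability
    (p₃ : unitInterval)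
    (hp₃ : (p₃ : ℝ) = 2 * (Real.log n ^ 2 / (n : ℝ) ^ 2)
      * (10 * r * μ / c * (sigmaFirst hr σ / sigmaLast hr σ)) ^ 10)
    -- the input subspaces
    (Vx Vy Vz : Submodule ℝ (Vec n))
    (hdx : Module.finrank ℝ Vx = r) (hdy : Module.finrank ℝ Vy = r)
    (hdz : Module.finrank ℝ Vz = r)
    (hV : max (sinAngle (spanOf x) Vx) (max (sinAngle (spanOf y) Vy) (sinAngle (spanOf z) Vz))
      ≤ (sigmaLast hr σ * c / (10 * sigmaFirst hr σ * n)) ^ (10 ^ 2))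
    -- the randomness of the run
    {Ω : Type*} [MeasurableSpace Ω] (P : Measure Ω) [IsProbabilityMeasure P]
    (obs obsMinus obsTilde : Ω → Set (Fin n × Fin n × Fin n))
    (a b : Ω → Metric.sphere (0 : Vec n) 1)
    (hrun : IsRunRandomness P p₃ obs obsMinus obsTilde a b) :
    ∃ G : Set Ω, MeasurableSet G ∧ ENNReal.ofReal 0.95 ≤ P G ∧ ∀ ω ∈ G,
      -- the algorithm produces estimates
      (∃ (σh : Fin r → ℝ) (xh yh zh : Fin r → Vec n),
        IsEstimate (cpTensor σ x y z) (obsMinus ω) Vx Vy Vz (a ω) (b ω) σh xh yh zh) ∧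
      -- and all estimates that it can produce are accurate
      ∀ (σh : Fin r → ℝ) (xh yh zh : Fin r → Vec n),
        IsEstimate (cpTensor σ x y z) (obsMinus ω) Vx Vy Vz (a ω) (b ω) σh xh yh zh →
        ∃ (π : Equiv.Perm (Fin r)) (εx εy εz : Fin r → ℝ),
          (∀ i, εx i ∈ ({-1, 1} : Set ℝ)) ∧ (∀ i, εy i ∈ ({-1, 1} : Set ℝ)) ∧
          (∀ i, εz i ∈ ({-1, 1} : Set ℝ)) ∧
          ∀ i,
            |σ i - σh (π i)| / sigmaFirst hr σ
              ≤ (c * sigmaLast hr σ / (10 * n * sigmaFirst hr σ)) ^ 20 ∧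
            ‖x i - εx i • xh (π i)‖
              ≤ (c * sigmaLast hr σ / (10 * n * sigmaFirst hr σ)) ^ 20 ∧
            ‖y i - εy i • yh (π i)‖
              ≤ (c * sigmaLast hr σ / (10 * n * sigmaFirst hr σ)) ^ 20 ∧
            ‖z i - εz i • zh (π i)‖
              ≤ (c * sigmaLast hr σ / (10 * n * sigmaFirst hr σ)) ^ 20 := by
  have hn0 : 0 < n := by omega
  have hnR : (0 : ℝ) < n := by exact_mod_cast hn0
  set s := sigmaFirst hr σ with hs_def
  set t := sigmaLast hr σ with ht_def
  have hc := hT.c_pos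
  have hs : 0 < s := hT.pos _
  have ht : 0 < t := hT.pos _
  have hσs : ∀ i, σ i ≤ s := fun i => hT.antitone (Fin.mk_le_of_le_val (Nat.zero_le _))
  have htσ : ∀ i, t ≤ σ i := fun i => hT.antitone (Fin.le_def.2 (Nat.le_sub_one_of_lt i.2))
  have hts : t ≤ s := htσ _
  have hRx : Robust c x := mul_norm_le_norm_sum hr hT.robust_x
  have hRy : Robust c y := mul_norm_le_norm_sum hr hT.robust_y
  have hRz : Robust c z := mul_norm_le_norm_sum hr hT.robust_z
  have hc1 : c ≤ 1 := (hRx.le_norm ⟨0, hr⟩).trans (hT.norm_x _).le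
  have hμ : 1 ≤ μ := hT.incoherent_x.one_le hr hn0 (finrank_spanOf hc hRx)
  have hrn : r ≤ n := by
    rw [← hdx]; exact (Submodule.finrank_le Vx).trans (by simp)
  have hrR : (1 : ℝ) ≤ r := by exact_mod_cast hr
  set q : unitInterval := halfProb p₃ with hq_def
  have hqp : (q : ℝ) = (p₃ : ℝ) / 2 := rfl
  have hq : (q : ℝ) = Real.log n ^ 2 / (n : ℝ) ^ 2 * (10 * r * μ / c * (s / t)) ^ 10 := by
    rw [hqp, hp₃]; ring
  have hq1 : 2 * (q : ℝ) ≤ 1 := by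
    rw [hqp]; linarith [p₃.2.2]
  obtain ⟨hn100, hqn⟩ := sampling_bounds hn hr hμ hc hc1 ((one_le_div ht).2 hts) hq1 hq
  have hn100R : (100 : ℝ) ≤ n := by exact_mod_cast hn100
  have hμr : 1 ≤ μ ^ 2 * (r : ℝ) ^ 5 :=
    one_le_mul_of_one_le_of_one_le (one_le_pow₀ hμ) (one_le_pow₀ hrR)
  have hq0 : 0 < (q : ℝ) := pos_of_mul_pos_left (by linarith : 0 < (q : ℝ) * n ^ 2) (sq_nonneg _)
  -- The common base of the hypothesis on the angles and of the final accuracy. The factor `10 * n`,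
  -- with `n ≥ 100`, makes `κ` at most 1/1000.
  set κ := c * t / (10 * n * s) with hκ_def
  have hκ : 0 < κ := by positivity
  have hκs : 10 * n * κ * s = c * t := by rw [hκ_def]; field_simp
  have hκc : 10 * (n * κ) ≤ c := by
    refine le_of_mul_le_mul_right ?_ hs
    rw [← mul_assoc, hκs]; exact mul_le_mul_of_nonneg_left hts hc.le
  have hnκ : n * κ ≤ 1 / 10 := by linarith
  have hκn : 100 * κ ≤ n * κ := mul_le_mul_of_nonneg_right hn100R hκ.le
  have hκ1 : κ ≤ 1 / 1000 := by linarith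
  have hκσ : ∀ i, κ * s ≤ σ i := fun i => by
    have h1 : 1 * (κ * s) ≤ 10 * n * (κ * s) :=
      mul_le_mul_of_nonneg_right (by linarith) (mul_pos hκ hs).le
    have h2 : c * t ≤ 1 * t := mul_le_mul_of_nonneg_right hc1 ht.le
    linarith [htσ i]
  have hδ : κ ^ 100 ≤ κ := pow_le_of_le_one hκ.le (by linarith) (by norm_num)
  have hδn : κ ^ 100 ≤ 1 / n := hδ.trans (by rw [le_div_iff₀ hnR, mul_comm]; linarith)
  have hκ' : t * c / (10 * s * n) = κ := by
    rw [hκ_def, mul_comm t c, mul_right_comm]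
  rw [hκ', show 10 ^ 2 = 100 by norm_num] at hV
  obtain ⟨hVx, hV'⟩ := max_le_iff.1 hV
  obtain ⟨hVy, hVz⟩ := max_le_iff.1 hV'
  obtain ⟨G, hG, hPG, hGood⟩ := hrun.exists_event _ (measurableSet_goodDirections (κ ^ 4) z) hn0
    (by norm_num : (0 : ℝ) ≤ 1 / 100)
    (measure_not_sample_le hn0 hdx hdy hdz
      (sq_norm_starProjection_le hr hn0 hc hδn (by linarith) hRx hVx hdx hT.incoherent_x)
      (sq_norm_starProjection_le hr hn0 hc hδn (by linarith) hRy hVy hdy hT.incoherent_y) q hq0 hqn)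
    (measure_not_goodDirections_le_ofReal hn0 hrn hT.norm_z hκ hκ1 hnκ)
  -- Two failures of probability at most 1/100 leave 0.98 ≥ 0.95.
  refine ⟨G, hG, le_trans (ENNReal.ofReal_le_ofReal (by norm_num)) hPG, fun ω hω => ?_⟩
  obtain ⟨hS, hD⟩ := hGood ω hω
  have hS' : ∀ Y ∈ tensorSubspace Vx Vy Vz, ‖Y‖ ≤ n * ‖restrictTo (obsMinus ω) Y‖ := by
    intro Y hY
    refine le_of_sq_le_sq ?_ (by positivity)
    -- From `qn² ≥ 4·10⁹ μ²r⁵` and `μ²r⁵ ≥ 1`; this trades the factor `√(2/q)` for the simpler `n`.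
    have h2 : 1 ≤ (n : ℝ) ^ 2 * (q / 2) := by linarith
    calc ‖Y‖ ^ 2 ≤ (n : ℝ) ^ 2 * (q / 2) * ‖Y‖ ^ 2 := le_mul_of_one_le_left (sq_nonneg _) h2
      _ = (n : ℝ) ^ 2 * (q / 2 * ‖Y‖ ^ 2) := mul_assoc _ _ _
      _ ≤ (n : ℝ) ^ 2 * ‖restrictTo (obsMinus ω) Y‖ ^ 2 :=
        mul_le_mul_of_nonneg_left (hS Y hY) (sq_nonneg _)
      _ = _ := (mul_pow _ _ _).symm
  have hsetup : ∀ T', IsProjectionStep (obsMinus ω) (restrictTo (obsMinus ω) (cpTensor σ x y z))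
      Vx Vy Vz T' → JennrichSetup κ s c σ x y z Vx Vy Vz T' (a ω) (b ω) := fun T' hT' =>
    hT'.jennrichSetup hn0 hκ hκ1 hrn hnκ (by linarith) hs hσs hκσ hT.norm_x hT.norm_y
      hT.norm_z hRx hRy hRz hdx hdy hVx hVy hVz hS' hD
  refine ⟨?_, fun σh xh yh zh hest => ?_⟩
  · obtain ⟨T', hT'⟩ := exists_isProjectionStep (obsMinus ω) (cpTensor σ x y z) Vx Vy Vz
    obtain ⟨σh, xh, yh, zh, h1, h2, h3, h4, h5⟩ := (hsetup T' hT').exists_estimates hn0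
    exact ⟨σh, xh, yh, zh, h1, h2, h3, h4, T', hT', h5⟩
  · obtain ⟨h1, h2, h3, h4, T', hT', h5⟩ := hest
    exact (hsetup T' hT').estimates_close h1 h2 h3 h4 h5
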